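/- Let $d\ge 1$ be any integer and let $S:=Q\times\mathbb{R}$ be the $d$-dimensional strip, where $Q:=\mathbb{R}^{d-1}/\mathbb{Z}^{d-1}$ is the flat torus; write $x=(x',z)\in S$. Let $G(s):=\frac{(1-s^2)^2}{4}$, let $v_c(x',z):=\tanh\!\big(\frac{z-c}{\sqrt2}\big)$ for $c\in\mathbb{R}$, and let $\mathcal{K}:=\{v_c : c\in\mathbb{R}\}$ be the set of kinks. Given $T>0$ and $u_0\in L^\infty(S)$, call $u$ a bounded $C^\infty$ solution on $[0,T]$ of $$u_t-\Delta\big(G'(u)-\Delta u\big)=0,\qquad u(0)=u_0, \tag{1}$$ if $u$ is bounded and $C^\infty$ on $(0,T]\times S$, satisfies the equation pointwise on $(0,T]\times S$, has $u(0)=u_0$, and satisfies $u(t)\to u_0$ as $t\to0^+$ in the sense of distributions on $S$. Theorem. Let $\bar\delta>0$. For every $T>0$ there exists $\delta=\delta(T)>0$ (depending only on $d,\bar\delta,T$) such that for every $v\in\mathcal{K}$ and every $u_0\in L^\infty(S)\cap(v+H^1(S))$ with $\|u_0-v\|_{L^\infty}\le\delta$, problem (1) has a unique bounded $C^\infty$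 solution $u$ on $[0,T]$, and it satisfies $\|u(t)-u_0\|_{L^2}\to0$ as $t\to0^+$. Moreover, for every $t\in[0,T]$ there is an $L^2$-closest kink to $u(t)$, i.e. some $$v_{c(t)}\in\operatorname{argmin}\{\|u(t)-w\|_{L^2(S)} : w\in\mathcal{K}\},$$ and for every such $v_{c(t)}$ one has $$\|u(t)-v_{c(t)}\|_{L^\infty}\le\bar\delta \quad\text{for all } t\in[0,T],$$ and $u(t)\in v_{c(t)}+H^j(S)$ for every integer $j\ge0$ and every $t\in(0,T]$. -/

import Mathlib

open MeasureTheory Filter Topology Set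
open scoped ContDiff ENNReal

noncomputable section

namespace CahnHilliard

/-- The strip `S = Q × ℝ` of dimension `d = n + 1`, where `Q = ℝⁿ / ℤⁿ` is the flat torus.
A point is `x = (x', z)`. The measure `volume` on it is Lebesgue measure (each circle has
length one), and it is an additive group. -/
abbrev Strip (n : ℕ) : Type := (Fin n → UnitAddCircle) × ℝ

/-- The quotient map `ℝⁿ × ℝ → S`. -/
def toStrip (n : ℕ) (y : (Fin n → ℝ) × ℝ) : Strip n :=
  (fun i => (y.1 i : UnitAddCircle), y.2)

/-- The displacement of length `s` along a coordinate axis of the strip: `some i` stands for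
the `i`-th periodic direction and `none` for the unbounded direction `z`. -/
def axis {n : ℕ} : Option (Fin n) → ℝ → Strip n
  | some i, s => (Pi.single i (s : UnitAddCircle), 0)
  | none, s => (0, s)

/-- The classical partial derivative of a function on the strip. -/
def partialDeriv {n : ℕ} (i : Option (Fin n)) (f : Strip n → ℝ) (x : Strip n) : ℝ :=
  deriv (fun s : ℝ => f (x + axis i s)) 0

/-- The Laplacian on the strip. -/
def laplacian {n : ℕ} (f : Strip n → ℝ) (x : Strip n) : ℝ :=
  ∑ i : Option (Fin n), partialDeriv i (partialDeriv i f) x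

/-- The test functions `C_c^∞(S)`. -/
def IsTestFunction {n : ℕ} (φ : Strip n → ℝ) : Prop :=
  ContDiff ℝ ∞ (fun y => φ (toStrip n y)) ∧ HasCompactSupport φ

/-- `g` is the weak (distributional) partial derivative of `f` in direction `i`. -/
def IsWeakPartialDeriv {n : ℕ} (i : Option (Fin n)) (f g : Strip n → ℝ) : Prop :=
  ∀ φ : Strip n → ℝ, IsTestFunction φ →
    ∫ x, f x * partialDeriv i φ x = -∫ x, g x * φ x

/-- Membership in the Sobolev space `H^j(S)`: `f ∈ L²`, and all weak partial derivatives of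
orders up to `j` exist and belong to `L²`. -/
def MemSobolev {n : ℕ} : ℕ → (Strip n → ℝ) → Prop
  | 0, f => MemLp f 2 volume
  | j + 1, f => MemLp f 2 volume ∧
      ∀ i, ∃ g : Strip n → ℝ, IsWeakPartialDeriv i f g ∧ MemSobolev j g

/-- The double-well potential `G(s) = (1 - s²)² / 4`. -/
def doubleWell (s : ℝ) : ℝ := (1 - s ^ 2) ^ 2 / 4

/-- The kink `v_c(x', z) = tanh((z - c) / √2)`. -/
def kink {n : ℕ} (c : ℝ) (x : Strip n) : ℝ := Real.tanh ((x.2 - c) / √2)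

/-- `v_c` is an `L²`-closest kink to `f`. -/
def IsClosestKink {n : ℕ} (f : Strip n → ℝ) (c : ℝ) : Prop :=
  ∀ b : ℝ, eLpNorm (f - kink c) 2 volume ≤ eLpNorm (f - kink b) 2 volume

/-- `u` is a bounded `C^∞` solution on `[0, T]` of
`u_t - Δ(G'(u) - Δu) = 0`, `u(0) = u₀`. As `u₀` need not be continuous, smoothness and the
equation are required on `(0, T] × S`, and the initial value is attained as `t → 0⁺` in the
sense of distributions. -/
structure IsSolution {n : ℕ} (T : ℝ) (u₀ : Strip n → ℝ) (u : ℝ → Strip n → ℝ) : Prop where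
  smooth : ContDiffOn ℝ ∞ (fun p : ℝ × ((Fin n → ℝ) × ℝ) => u p.1 (toStrip n p.2))
    (Ioc 0 T ×ˢ univ)
  equation : ∀ t ∈ Ioc 0 T, ∀ x : Strip n,
    HasDerivWithinAt (fun s => u s x)
      (laplacian (fun y => deriv doubleWell (u t y) - laplacian (u t) y) x) (Ioc 0 T) t
  bounded : ∃ M : ℝ, ∀ t ∈ Ioc 0 T, ∀ x, |u t x| ≤ M
  initial : u 0 = u₀
  initial_limit : ∀ φ : Strip n → ℝ, IsTestFunction φ →
    Tendsto (fun t => ∫ x, u t x * φ x) (𝓝[>] 0) (𝓝 (∫ x, u₀ x * φ x))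

end CahnHilliard

end

/-! ### The biharmonic heat kernel, constructed on the Fourier side -/

noncomputable section

namespace CahnHilliard
open SchwartzMap FourierTransform Real
open scoped SchwartzMap LineDeriv Laplacian

/-! No stability of the kinks is used: on a fixed time interval the statement is continuous
dependence on the data, with `δ` of size `e^{-lT}`. The kink profile satisfies `Δv = v³ - v`, so
`G'(v) - Δv = 0`, and `w = u - v` solves `w_t + Δ²w = Δ(G'(v + w) - G'(v))`, a biharmonic heat
equation with a forcing of order `w`.

Existence. Let `K_t` be the kernel of `e^{-tΔ²}` on the universal cover, which acts on functions on
the strip by convolution along the covering map. By scaling, `k` spatial derivatives of `K_t` have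
`L¹` norm proportional to `t^{-k/4}`, integrable at `t = 0` for `k ≤ 3` (`integrable_ker`). For the
damped unknown `W = e^{-lt} w` the Duhamel kernel is `e^{-lt} ΔK_t`, whose space-time mass is a
multiple of `l^{-1/2}` and hence as small as desired (`exists_damping`). With the nonlinearity
truncated at `|w| = 1`, which makes it globally Lipschitz, the mild equation is a contraction for
the sup norm over all times, and its iterates keep an `L²` bound on time slices (`exists_mild`). The
fixed point is bounded by a constant times `δ`, so for small `δ` the truncation is inactive up to
the prescribed time.

Regularity. Multiplying the mild equation by a time cutoff `θ` and using the semigroup law removes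
the rough datum: `θW = K * (θ'W) + ΔK * (θN)`, with `N` the forcing (`IsMild.timeMul_eq`). Both
kernels can absorb one more derivative, so each pass gains one spatial derivative, uniformly and in
`L²` (`Reg_conv_ker`, `IsMild.reg_BL`). The equation then trades a time derivative for four spatial
ones, giving joint smoothness (`IsMild.reg_CK`); the initial value is attained in `L²`
(`IsMild.tendsto_eLpNorm`).

Uniqueness. The difference `z` of two bounded solutions is controlled only weakly as `t → 0`. Its
spatial mollifications are regular and `O(t)`, so Duhamel's formula with zero datum applies to them;
the small mass of the damped kernel gives half of any available bound on `e^{-lt}|z|`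
(`IsWeakPair.abs_scorr_le_half`). Concentrating the mollifier transfers this to `z`, and iteration
gives `z = 0`.

Closest kinks. The squared `L²` distance between `v_b` and `v_c` grows linearly in `|b - c|`
(`le_integral_sq_kink_sub`), so the distance to the family of kinks is coercive and attains its
minimum. If `f` is uniformly `ε`-close to `v_b`, comparing a minimiser `v_c` with `v_b` and using
`‖v_b - v_c‖_{L¹} ≤ C|b - c|` forces `|b - c|` to be small (`IsClosestKink.abs_sub_le`). Then `v_c`
is uniformly close to `v_b`, and so to `f`. -/

/-- The Gaussian `exp (-x² / 2)` as a Schwartz function. -/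
def gaussianSchwartz : 𝓢(ℝ, ℂ) where
  toFun x := (Real.exp (-(x ^ 2 / 2)) : ℝ)
  smooth' := Complex.ofRealCLM.contDiff.comp
    (f := fun x : ℝ => Real.exp (-(x ^ 2 / 2))) (by fun_prop)
  decay' := by
    intro k m
    have key : ∀ j : ℕ, ∃ C, ∀ x : ℝ, |x| ^ j * Real.exp (-(x ^ 2 / 2)) ≤ C := by
      intro j
      -- One term of the exponential series bounds `x^{2j}` by `2^j j! e^{x²/2}`, and `|x|^j ≤ 1 +
      -- x^{2j}`.
      refine ⟨1 + 2 ^ j * j.factorial, fun x => ?_⟩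
      have h1 : (x ^ 2 / 2) ^ j / j.factorial ≤ Real.exp (x ^ 2 / 2) :=
        Real.pow_div_factorial_le_exp _ (by positivity) j
      have hf : (0 : ℝ) < j.factorial := by positivity
      rw [Real.exp_neg, ← div_eq_mul_inv, div_le_iff₀ (Real.exp_pos _)]
      have h2 : (x ^ 2) ^ j ≤ 2 ^ j * j.factorial * Real.exp (x ^ 2 / 2) := by
        rw [div_le_iff₀ hf, div_pow, div_le_iff₀ (by positivity)] at h1
        linarith
      have h3 : |x| ^ j ≤ 1 + (x ^ 2) ^ j := by
        rcases le_total |x| 1 with h | h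
        · have := pow_le_one₀ (abs_nonneg x) h (n := j)
          have : 0 ≤ (x ^ 2) ^ j := by positivity
          linarith
        · have : |x| ^ j ≤ (|x| ^ 2) ^ j := by
            gcongr
            nlinarith
          rw [sq_abs] at this
          linarith
      have h4 : (1 : ℝ) ≤ Real.exp (x ^ 2 / 2) := Real.one_le_exp (by positivity)
      nlinarith
    have hp : ∀ p : Polynomial ℤ, ∃ C, ∀ x : ℝ,
        |x| ^ k * |Polynomial.aeval x p| * Real.exp (-(x ^ 2 / 2)) ≤ C := by
      intro p
      choose c hc using key
      refine ⟨∑ i ∈ Finset.range (p.natDegree + 1), |(p.coeff i : ℝ)| * c (k + i), fun x => ?_⟩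
      rw [Polynomial.aeval_eq_sum_range]
      calc _ ≤ |x| ^ k * (∑ i ∈ Finset.range (p.natDegree + 1), |(p.coeff i : ℝ)| * |x| ^ i)
              * Real.exp (-(x ^ 2 / 2)) := by
            gcongr
            refine (Finset.abs_sum_le_sum_abs _ _).trans (le_of_eq ?_)
            refine Finset.sum_congr rfl fun i _ => ?_
            rw [zsmul_eq_mul, abs_mul, abs_pow]
        _ = ∑ i ∈ Finset.range (p.natDegree + 1), |(p.coeff i : ℝ)| *
              (|x| ^ (k + i) * Real.exp (-(x ^ 2 / 2))) := by
            rw [Finset.mul_sum, Finset.sum_mul]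
            refine Finset.sum_congr rfl fun i _ => ?_
            ring
        _ ≤ _ := by
            gcongr with i _
            exact hc _ _
    -- The `m`-th derivative of the Gaussian is, up to sign, a Hermite polynomial times the
    -- Gaussian.
    obtain ⟨C, hC⟩ := hp (Polynomial.hermite m)
    refine ⟨C, fun x => (le_of_eq ?_).trans (hC x)⟩
    have h1 : (fun x : ℝ => ((Real.exp (-(x ^ 2 / 2)) : ℝ) : ℂ)) =
      Complex.ofRealLI ∘ fun x : ℝ => Real.exp (-(x ^ 2 / 2)) := rfl
    rw [h1, Complex.ofRealLI.norm_iteratedFDeriv_comp_left (n := m) (ContDiff.contDiffAt (by fun_prop)) le_rfl,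
      norm_iteratedFDeriv_eq_norm_iteratedDeriv, iteratedDeriv_eq_iterate,
      Polynomial.deriv_gaussian_eq_hermite_mul_gaussian]
    simp [abs_of_pos (Real.exp_pos _), mul_assoc]

lemma gaussianSchwartz_apply (x : ℝ) :
    gaussianSchwartz x = (Real.exp (-(x ^ 2 / 2)) : ℝ) := rfl

/-- The universal cover `ℝⁿ × ℝ` of the strip. -/
abbrev Cover (n : ℕ) : Type := (Fin n → ℝ) × ℝ

/-- The universal cover of the strip with its Euclidean structure. -/
abbrev EuclideanCover (n : ℕ) : Type := WithLp 2 (EuclideanSpace ℝ (Fin n) × ℝ)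

variable {n : ℕ}

/-- The properness condition for composing a Schwartz function with `ξ ↦ c|ξ|²`. It makes
`exp(-s|2πξ|⁴)` Schwartz as the composition of the one-dimensional Gaussian with a quadratic form.
-/
lemma norm_sq_growth (c : ℝ) (hc : 0 < c) : ∃ (k : ℕ) (C : ℝ), ∀ ξ : EuclideanCover n,
    ‖ξ‖ ≤ C * (1 + ‖c * ‖ξ‖ ^ 2‖) ^ k := by
  refine ⟨1, 1 + c⁻¹, fun ξ => ?_⟩
  have h : 0 ≤ c * ‖ξ‖ ^ 2 := by positivity
  rw [Real.norm_of_nonneg h, pow_one]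
  have h1 : ‖ξ‖ ≤ 1 + ‖ξ‖ ^ 2 := by nlinarith [sq_nonneg (‖ξ‖ - 1), norm_nonneg ξ]
  have h2 : (1 + c⁻¹) * (1 + c * ‖ξ‖ ^ 2) = 1 + c⁻¹ + c * ‖ξ‖ ^ 2 + ‖ξ‖ ^ 2 := by
    field_simp
    ring
  have : 0 < c⁻¹ := by positivity
  rw [h2]
  linarith

/-- The symbol `exp (-s |2πξ|⁴)` of the biharmonic heat semigroup. -/
def heatSymbol (n : ℕ) (s : ℝ) : 𝓢(EuclideanCover n, ℂ) :=
  if h : 0 < s then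
    -- The coefficient is chosen so that half its square is `s (2π)⁴`.
    compCLM ℂ (g := fun ξ : EuclideanCover n => (√(2 * s) * (2 * π) ^ 2) * ‖ξ‖ ^ 2)
      (by fun_prop) (norm_sq_growth _ (by positivity)) gaussianSchwartz
  else 0

lemma heatSymbol_apply {s : ℝ} (hs : 0 < s) (ξ : EuclideanCover n) :
    heatSymbol n s ξ = (Real.exp (-(s * ((2 * π) ^ 2 * ‖ξ‖ ^ 2) ^ 2)) : ℝ) := by
  rw [heatSymbol, dif_pos hs, compCLM_apply, Function.comp, gaussianSchwartz_apply]
  congr 3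
  rw [mul_assoc, mul_pow, Real.sq_sqrt (by positivity)]
  ring

/-- The functions `Δʲ K_s`, where `K_s` is the biharmonic heat kernel, as complex Schwartz
functions. -/
def heatComplex (n j : ℕ) (s : ℝ) : 𝓢(EuclideanCover n, ℂ) :=
  (fun f : 𝓢(EuclideanCover n, ℂ) => Δ f)^[j] (𝓕⁻ (heatSymbol n s))

lemma heatComplex_succ (j : ℕ) (s : ℝ) : heatComplex n (j + 1) s = Δ (heatComplex n j s) :=
  Function.iterate_succ_apply' _ _ _

/-- The real-valued Fourier transform of `heatComplex`. -/
def heatMultiplier (n j : ℕ) (s : ℝ) (ξ : EuclideanCover n) : ℝ :=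
  (-((2 * π) ^ 2 * ‖ξ‖ ^ 2)) ^ j * Real.exp (-(s * ((2 * π) ^ 2 * ‖ξ‖ ^ 2) ^ 2))

/-- Each Laplacian multiplies the transform by `-(2π|ξ|)²`. -/
lemma fourier_heatComplex (j : ℕ) {s : ℝ} (hs : 0 < s) (ξ : EuclideanCover n) :
    𝓕 (heatComplex n j s) ξ = heatMultiplier n j s ξ := by
  induction j with
  | zero => 
    simp only [heatComplex, Function.iterate_zero, id, heatMultiplier, pow_zero, one_mul]
    rw [FourierTransform.fourier_fourierInv_eq, heatSymbol_apply hs]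
  | succ j ih =>
    rw [heatComplex_succ, laplacian_eq_fourierMultiplierCLM, FourierTransform.fourier_smul,
      fourierMultiplierCLM_apply, FourierTransform.fourier_fourierInv_eq, smul_apply,
      smulLeftCLM_apply_apply (by fun_prop), ih]
    simp only [heatMultiplier, pow_succ]
    push_cast
    simp only [Complex.real_smul]
    push_cast
    ring

lemma integrable_heatMultiplier (j : ℕ) {s : ℝ} (hs : 0 < s) :
    Integrable (heatMultiplier n j s) := by
  have h : Integrable (fun ξ => (heatMultiplier n j s ξ : ℂ)) := by
    convert! (𝓕 (heatComplex n j s)).integrable (μ := volume) using 2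
    rw [fourier_heatComplex j hs]
  exact h.re

lemma heatComplex_apply (j : ℕ) {s : ℝ} (hs : 0 < s) (y : EuclideanCover n) :
    heatComplex n j s y = ∫ ξ, (𝐞 (inner ℝ ξ y)) • (heatMultiplier n j s ξ : ℂ) := by
  have h : heatComplex n j s = 𝓕⁻ (𝓕 (heatComplex n j s)) := by simp
  rw [h, fourierInv_coe, Real.fourierInv_eq]
  simp_rw [fourier_heatComplex j hs]

/-- The semigroup law: on the Fourier side the exponents and the powers of the Laplacian symbol add.
-/
lemma convolution_heatComplex (i j : ℕ) {s r : ℝ} (hs : 0 < s) (hr : 0 < r) :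
    convolution (ContinuousLinearMap.mul ℂ ℂ) (heatComplex n i s) (heatComplex n j r) =
      heatComplex n (i + j) (s + r) := by
  have h : 𝓕 (convolution (ContinuousLinearMap.mul ℂ ℂ) (heatComplex n i s) (heatComplex n j r)) =
      𝓕 (heatComplex n (i + j) (s + r)) := by
    ext ξ
    rw [fourier_convolution, pairing_apply_apply, fourier_heatComplex i hs,
      fourier_heatComplex j hr, fourier_heatComplex _ (add_pos hs hr)]
    simp only [ContinuousLinearMap.mul_apply', heatMultiplier]
    rw [← Complex.ofReal_mul]
    congr 1
    rw [pow_add, add_mul, neg_add, Real.exp_add]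
    ring
  have := congrArg (fun f => 𝓕⁻ f) h
  simpa using this

lemma finrank_euclideanCover : Module.finrank ℝ (EuclideanCover n) = n + 1 := by
  rw [(WithLp.linearEquiv 2 ℝ (EuclideanSpace ℝ (Fin n) × ℝ)).finrank_eq]
  simp

/-- The multiplier at time `a⁻⁴` is the one at time `1` evaluated at `ξ / a`, times `a^{2j}`; the
substitution in the inverse transform contributes `a^{n+1}`. This reduces every kernel norm to time
one. -/
lemma heatComplex_scale (j : ℕ) {a : ℝ} (ha : 0 < a) (y : EuclideanCover n) :
    heatComplex n j (a ^ 4)⁻¹ y = a ^ (n + 1 + 2 * j) • heatComplex n j 1 (a • y) := by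
  rw [heatComplex_apply j (by positivity), heatComplex_apply j one_pos]
  have h := Measure.integral_comp_smul (volume : Measure (EuclideanCover n))
    (fun ξ => (𝐞 (inner ℝ ξ (a • y))) • (heatMultiplier n j 1 ξ : ℂ)) a⁻¹
  rw [finrank_euclideanCover] at h
  have h2 : (∫ ξ, (𝐞 (inner ℝ ξ (a • y))) • (heatMultiplier n j 1 ξ : ℂ)) =
    (a ^ (n + 1))⁻¹ • ∫ ξ : EuclideanCover n, (𝐞 (inner ℝ (a⁻¹ • ξ) (a • y))) •
      (heatMultiplier n j 1 (a⁻¹ • ξ) : ℂ) := by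
    rw [h, inv_pow, inv_inv, abs_of_pos (by positivity), smul_smul, inv_mul_cancel₀ (by positivity),
      one_smul]
  rw [h2, smul_smul, pow_add, mul_comm (a ^ (n + 1)), mul_inv_cancel_right₀ (by positivity),
    ← integral_smul]
  congr 1
  ext ξ
  rw [inner_smul_left, inner_smul_right, smul_comm]
  simp only [conj_trivial]
  rw [inv_mul_cancel_left₀ ha.ne']
  congr 1
  rw [Complex.real_smul, ← Complex.ofReal_mul]
  congr 1
  have h3 : -((2 * π) ^ 2 * ‖ξ‖ ^ 2) = a ^ 2 * (-((2 * π) ^ 2 * (a⁻¹ * ‖ξ‖) ^ 2)) := by field_simp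
  have h4 : -((a ^ 4)⁻¹ * ((2 * π) ^ 2 * ‖ξ‖ ^ 2) ^ 2) =
      -(1 * ((2 * π) ^ 2 * (a⁻¹ * ‖ξ‖) ^ 2) ^ 2) := by field_simp
  rw [heatMultiplier, heatMultiplier, norm_smul, norm_inv, Real.norm_of_nonneg ha.le, h4, h3,
    mul_pow, pow_mul, mul_assoc]

/-- The equation `∂_s K = -Δ²K`, by differentiating the symbol under the inverse Fourier integral.
-/
lemma hasDerivAt_heatComplex (j : ℕ) {s : ℝ} (hs : 0 < s) (y : EuclideanCover n) :
    HasDerivAt (fun s => heatComplex n j s y) (-heatComplex n (j + 2) s y) s := by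
  have hev : (fun s => heatComplex n j s y) =ᶠ[𝓝 s]
      fun s => ∫ ξ, (𝐞 (inner ℝ ξ y)) • (heatMultiplier n j s ξ : ℂ) := by
    filter_upwards [lt_mem_nhds hs] with r hr
    exact heatComplex_apply j hr y
  refine HasDerivAt.congr_of_eventuallyEq ?_ hev
  rw [heatComplex_apply _ hs, ← integral_neg]
  have hmeas : ∀ (j : ℕ) (r : ℝ), AEStronglyMeasurable
      (fun ξ : EuclideanCover n => (𝐞 (inner ℝ ξ y)) • (heatMultiplier n j r ξ : ℂ)) volume := by
    intro j r
    refine Continuous.aestronglyMeasurable ?_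
    simp only [Circle.smul_def, heatMultiplier]
    have : Continuous fun ξ : EuclideanCover n => (𝐞 (inner ℝ ξ y) : Circle) :=
      continuous_fourierChar.comp (by fun_prop)
    fun_prop
  refine (hasDerivAt_integral_of_dominated_loc_of_deriv_le (s := Ioi (s / 2))
    (F := fun s ξ => (𝐞 (inner ℝ ξ y)) • (heatMultiplier n j s ξ : ℂ))
    (F' := fun s ξ => -((𝐞 (inner ℝ ξ y)) • (heatMultiplier n (j + 2) s ξ : ℂ)))
    -- The multiplier decreases in time in absolute value, so its value at `s / 2` dominates near
    -- `s`.
    (bound := fun ξ => |heatMultiplier n (j + 2) (s / 2) ξ|) (Ioi_mem_nhds (by linarith))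
    (Eventually.of_forall fun r => hmeas j r) ?_ (hmeas _ _).neg ?_ ?_ ?_).2
  · refine (integrable_heatMultiplier j hs).mono (hmeas _ _) (Eventually.of_forall fun ξ => ?_)
    simp
  · refine Eventually.of_forall fun ξ r hr => ?_
    rw [norm_neg, Circle.norm_smul, Complex.norm_real, Real.norm_eq_abs]
    simp only [heatMultiplier, abs_mul, Real.abs_exp]
    have : s / 2 ≤ r := le_of_lt hr
    gcongr
  · exact (integrable_heatMultiplier _ (half_pos hs)).norm
  · refine Eventually.of_forall fun ξ r hr => ?_
    have h1 : HasDerivAt (fun r => heatMultiplier n j r ξ) (-heatMultiplier n (j + 2) r ξ) r := by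
      simp only [heatMultiplier]
      convert! (((hasDerivAt_id r).mul_const (((2 * π) ^ 2 * ‖ξ‖ ^ 2) ^ 2)).neg.exp).const_mul
        ((-((2 * π) ^ 2 * ‖ξ‖ ^ 2)) ^ j) using 1
      simp only [id, one_mul, Pi.neg_apply]
      ring
    have := (h1.ofReal_comp).const_smul (𝐞 (inner ℝ ξ y))
    rw [Complex.ofReal_neg, smul_neg] at this
    exact this

/-- The multiplier is real and even, so its inverse transform is real. -/
lemma conj_heatComplex (j : ℕ) {s : ℝ} (hs : 0 < s) (y : EuclideanCover n) :
    (starRingEnd ℂ) (heatComplex n j s y) = heatComplex n j s y := by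
  rw [heatComplex_apply j hs, ← integral_conj, ← integral_neg_eq_self]
  congr 1
  ext ξ
  simp only [heatMultiplier, norm_neg, inner_neg_left, Circle.smul_def, smul_eq_mul, map_mul,
    Complex.conj_ofReal, AddChar.map_neg_eq_inv, Circle.coe_inv_eq_conj, Complex.conj_conj]

/-- The total mass is the transform at frequency zero. -/
lemma integral_heatComplex {s : ℝ} (hs : 0 < s) : ∫ y, heatComplex n 0 s y = 1 := by
  have h := fourier_heatComplex 0 hs (0 : EuclideanCover n)
  rw [fourier_coe, Real.fourier_eq] at h
  simpa [heatMultiplier] using h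


/-- The linear identification of the universal cover with its Euclidean version. -/
def coverEquiv (n : ℕ) : Cover n ≃L[ℝ] EuclideanCover n :=
  ((EuclideanSpace.equiv (Fin n) ℝ).symm.prodCongr (ContinuousLinearEquiv.refl ℝ ℝ)).trans
    (WithLp.prodContinuousLinearEquiv 2 ℝ (EuclideanSpace ℝ (Fin n)) ℝ).symm

lemma measurePreserving_coverEquiv : MeasurePreserving (coverEquiv n) := by
  have h1 : MeasurePreserving (Prod.map (WithLp.toLp 2) id :
      Cover n → EuclideanSpace ℝ (Fin n) × ℝ) :=
    (PiLp.volume_preserving_toLp (Fin n)).prod (MeasurePreserving.id volume)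
  exact (WithLp.volume_preserving_toLp (EuclideanSpace ℝ (Fin n)) ℝ).comp h1

/-- The functions `Δʲ K_s`, where `K_s` is the biharmonic heat kernel. -/
def heat (n j : ℕ) (s : ℝ) : 𝓢(Cover n, ℝ) :=
  compCLMOfContinuousLinearEquiv ℝ (coverEquiv n)
    (postcompCLM (𝕜 := ℝ) Complex.reCLM (heatComplex n j s))

lemma heat_eq_re (j : ℕ) (s : ℝ) (y : Cover n) :
    heat n j s y = (heatComplex n j s (coverEquiv n y)).re := rfl

lemma ofReal_heat (j : ℕ) {s : ℝ} (hs : 0 < s) (y : Cover n) :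
    (heat n j s y : ℂ) = heatComplex n j s (coverEquiv n y) := by
  rw [heat_eq_re]
  exact Complex.conj_eq_iff_re.1 (conj_heatComplex j hs _)

lemma integral_heat_mul_heat (i j : ℕ) {s r : ℝ} (hs : 0 < s) (hr : 0 < r) (y : Cover n) :
    ∫ z, heat n i s z * heat n j r (y - z) = heat n (i + j) (s + r) y := by
  have h := convolution_apply (ContinuousLinearMap.mul ℂ ℂ) (heatComplex n i s) (heatComplex n j r)
    (coverEquiv n y)
  rw [convolution_heatComplex i j hs hr, ← ofReal_heat _ (add_pos hs hr)] at h
  apply Complex.ofReal_injective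
  rw [h, ← integral_complex_ofReal, convolution_def,
    ← measurePreserving_coverEquiv.integral_comp
      (coverEquiv n).toHomeomorph.measurableEmbedding]
  congr 1
  ext z
  push_cast
  rw [ofReal_heat i hs, ofReal_heat j hr, map_sub]
  rfl

lemma heat_scale (j : ℕ) {a : ℝ} (ha : 0 < a) (y : Cover n) :
    heat n j (a ^ 4)⁻¹ y = a ^ (n + 1 + 2 * j) * heat n j 1 (a • y) := by
  rw [heat_eq_re, heatComplex_scale j ha, heat_eq_re, (coverEquiv n).map_smul, Complex.smul_re, smul_eq_mul]

lemma hasDerivAt_heat (j : ℕ) {s : ℝ} (hs : 0 < s) (y : Cover n) :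
    HasDerivAt (fun s => heat n j s y) (-heat n (j + 2) s y) s :=
  Complex.reCLM.hasFDerivAt.comp_hasDerivAt s (hasDerivAt_heatComplex j hs (coverEquiv n y))

lemma integral_heat {s : ℝ} (hs : 0 < s) : ∫ y, heat n 0 s y = 1 := by
  have h := integral_heatComplex (n := n) hs
  rw [← measurePreserving_coverEquiv.integral_comp
      (coverEquiv n).toHomeomorph.measurableEmbedding] at h
  simp_rw [← ofReal_heat 0 hs] at h
  rw [integral_complex_ofReal] at h
  exact_mod_cast h

/-- The coordinate directions of the universal cover. -/
def coverBasis {n : ℕ} : Option (Fin n) → Cover n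
  | some i => (Pi.single i 1, 0)
  | none => (0, 1)

/-- The Laplacian of a Schwartz function on the universal cover. -/
def schwartzLaplacian (p : 𝓢(Cover n, ℝ)) : 𝓢(Cover n, ℝ) :=
  ∑ i : Option (Fin n), ∂_{coverBasis i} (∂_{coverBasis i} p)

lemma lineDerivOp_postcomp_re {V : Type*} [NormedAddCommGroup V] [NormedSpace ℝ V]
    (f : 𝓢(V, ℂ)) (m : V) :
    ∂_{m} (postcompCLM (𝕜 := ℝ) Complex.reCLM f) =
      postcompCLM (𝕜 := ℝ) Complex.reCLM (∂_{m} f) := by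
  ext x
  have h := Complex.reCLM.hasFDerivAt.comp x (f.differentiableAt (x := x)).hasFDerivAt
  have h3 : (⇑(postcompCLM (𝕜 := ℝ) Complex.reCLM f)) = Complex.reCLM ∘ f := by
    ext z
    exact postcompCLM_apply _ _ _
  rw [postcompCLM_apply, lineDerivOp_apply_eq_fderiv, lineDerivOp_apply_eq_fderiv, h3, h.fderiv,
    ContinuousLinearMap.comp_apply]

/-- The coordinate directions of the cover correspond to an orthonormal basis of its Euclidean
version, in which the invariant Laplacian is a sum of second line derivatives. -/
lemma schwartzLaplacian_heat (j : ℕ) (s : ℝ) :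
    schwartzLaplacian (heat n j s) = heat n (j + 1) s := by
  have h := laplacian_eq_sum ((EuclideanSpace.basisFun (Fin n) ℝ).prod
    (OrthonormalBasis.singleton Unit ℝ)) (heatComplex n j s)
  rw [heat, heat, heatComplex_succ, h, schwartzLaplacian, Fintype.sum_option, Fintype.sum_sum_type]
  simp only [lineDerivOp_compCLMOfContinuousLinearEquiv, lineDerivOp_postcomp_re, map_add,
    map_sum]
  rw [add_comm]
  congr 1
  · refine Finset.sum_congr rfl fun i _ => ?_
    have : coverEquiv n (coverBasis (some i)) = ((EuclideanSpace.basisFun (Fin n) ℝ).prod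
      (OrthonormalBasis.singleton Unit ℝ)) (Sum.inl i) := by
      refine WithLp.ofLp_injective 2 (Prod.ext ?_ ?_)
      · simp [coverEquiv, coverBasis]
      · simp [coverEquiv, coverBasis]
    rw [this]
  · simp
    have : coverEquiv n (coverBasis none) = ((EuclideanSpace.basisFun (Fin n) ℝ).prod
      (OrthonormalBasis.singleton Unit ℝ)) (Sum.inr ()) := by
      refine WithLp.ofLp_injective 2 (Prod.ext ?_ ?_)
      · simp [coverEquiv, coverBasis]
      · simp [coverEquiv, coverBasis]
    rw [this]
    simp

end CahnHilliard

end

/-! ### Convolution of kernels on a vector space with functions on a quotient group -/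

noncomputable section

set_option linter.unusedSectionVars false

namespace CahnHilliard

section Translation

variable {X : Type*} [AddCommGroup X] [TopologicalSpace X] [IsTopologicalAddGroup X]
  [MeasurableSpace X] [BorelSpace X] [SecondCountableTopology X] [R1Space X] {μ : Measure X}
  [μ.IsAddRightInvariant]

/-- Translations act continuously on `L^p` for finite `p`. It is used for `L¹` kernels, to get
continuity of convolutions, and for the `L²` datum. -/
lemma tendsto_eLpNorm_translate [μ.InnerRegularCompactLTTop] [IsLocallyFiniteMeasure μ]
    {p : ℝ≥0∞} [Fact (1 ≤ p)] (hp : p ≠ ⊤) {f : X → ℝ}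
    (hf : MemLp f p μ) :
    Tendsto (fun h => eLpNorm (fun x => f (x + h) - f x) p μ) (𝓝 0) (𝓝 0) := by
  let g : X → C(X, X) := (ContinuousMap.mk (fun a : X × X => a.2 + a.1) (by fun_prop)).curry
  have hmp : ∀ h : X, MeasurePreserving (⇑(g h)) μ μ := measurePreserving_add_right μ
  have hg : Continuous g := ContinuousMap.continuous _
  have hc := (continuous_const (y := hf.toLp f)).compMeasurePreservingLp hg hmp hp
  have h0 := (hc.tendsto 0).edist (tendsto_const_nhds (x := hf.toLp f))
  have hz : Lp.compMeasurePreserving (⇑(g 0)) (hmp 0) (hf.toLp f) = hf.toLp f := by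
    rw [Lp.toLp_compMeasurePreserving]
    congr 1
    ext x
    simp [g]
  rw [hz, edist_self] at h0
  refine h0.congr fun h => ?_
  rw [Lp.toLp_compMeasurePreserving, Lp.edist_toLp_toLp]
  rfl

end Translation

section HasDir

variable {X : Type*} [AddCommGroup X]

/-- `df` is the derivative of `f` along the one-parameter subgroup `γ`. -/
def HasDir (γ : ℝ → X) (f df : X → ℝ) : Prop :=
  ∀ x, HasDerivAt (fun s => f (x + γ s)) (df x) 0

/-- `γ` is a one-parameter subgroup. -/
def IsOneParam (γ : ℝ → X) : Prop := ∀ s t, γ (s + t) = γ s + γ t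

lemma IsOneParam.zero {γ : ℝ → X} (h : IsOneParam γ) : γ 0 = 0 := by
  have := h 0 0
  simpa using this

/-- A derivative at parameter `0` at every base point gives one at every parameter, by the group
law. -/
lemma HasDir.hasDerivAt {γ : ℝ → X} (hγ : IsOneParam γ) {f f' : X → ℝ} (h : HasDir γ f f')
    (x : X) (s : ℝ) : HasDerivAt (fun s => f (x + γ s)) (f' (x + γ s)) s := by
  have h1 := h (x + γ s)
  have h2 : HasDerivAt (fun r => f (x + γ s + γ r)) (f' (x + γ s)) (s - s) := by simpa using h1
  refine (h2.comp_sub_const s s).congr_of_eventuallyEq (Eventually.of_forall fun r => ?_)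
  simp only [add_assoc, ← hγ s (r - s), add_sub_cancel]

lemma HasDir.unique {γ : ℝ → X} {f f' f'' : X → ℝ} (h : HasDir γ f f') (h' : HasDir γ f f'') :
    f' = f'' := by
  ext x
  exact (h x).unique (h' x)

lemma HasDir.add {γ : ℝ → X} {f f' g g' : X → ℝ} (hf : HasDir γ f f') (hg : HasDir γ g g') :
    HasDir γ (f + g) (f' + g') := fun x => (hf x).add (hg x)

lemma HasDir.neg {γ : ℝ → X} {f f' : X → ℝ} (hf : HasDir γ f f') :
    HasDir γ (-f) (-f') := fun x => (hf x).neg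

lemma HasDir.sub {γ : ℝ → X} {f f' g g' : X → ℝ} (hf : HasDir γ f f') (hg : HasDir γ g g') :
    HasDir γ (f - g) (f' - g') := fun x => (hf x).sub (hg x)

lemma HasDir.mul {γ : ℝ → X} (h0 : γ 0 = 0) {f f' g g' : X → ℝ} (hf : HasDir γ f f')
    (hg : HasDir γ g g') : HasDir γ (f * g) (f' * g + f * g') := fun x => by
  have := (hf x).mul (hg x)
  rw [h0, add_zero] at this
  exact this

lemma hasDir_const (γ : ℝ → X) (c : ℝ) : HasDir γ (fun _ => c) 0 := fun _ => hasDerivAt_const _ _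

end HasDir

section Conv

variable {V X : Type*} [NormedAddCommGroup V] [NormedSpace ℝ V] [MeasureSpace V] [BorelSpace V]
  [FiniteDimensional ℝ V] [(volume : Measure V).IsAddHaarMeasure]
  [AddCommGroup X] [TopologicalSpace X] [IsTopologicalAddGroup X] [MeasurableSpace X] [BorelSpace X]
  [SecondCountableTopology X]

/-- `f` is measurable and bounded by `M`. -/
structure BddMeas (f : X → ℝ) (M : ℝ) : Prop where
  meas : Measurable f
  bdd : ∀ x, |f x| ≤ M

lemma BddMeas.nonneg {f : X → ℝ} {M : ℝ} (hf : BddMeas f M) (x : X) : 0 ≤ M :=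
  (abs_nonneg _).trans (hf.bdd x)

/-- The convolution of a kernel `k` on `V` with a function `f` on `X`, where `V` acts on `X` by
translations through `π`. -/
def conv (π : V →+ X) (k : V → ℝ) (f : X → ℝ) (x : X) : ℝ := ∫ y, k y * f (x - π y)

variable {π : V →+ X} {k k' : V → ℝ} {f f' : X → ℝ} {M M' : ℝ}

lemma measurable_comp_sub (hπ : Continuous π) (hf : Measurable f) (x : X) :
    Measurable fun y => f (x - π y) := by
  have : SecondCountableTopology V := secondCountable_of_proper
  have : Measurable fun y => x - π y := (continuous_const.sub hπ).measurable
  exact hf.comp this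

lemma integrable_conv (hπ : Continuous π) (hk : Integrable k) (hf : BddMeas f M) (x : X) :
    Integrable fun y => k y * f (x - π y) :=
  hk.mul_bdd (c := M) (measurable_comp_sub hπ hf.meas x).aestronglyMeasurable
    (Eventually.of_forall fun _ => hf.bdd _)

lemma abs_conv_le (hf : ∀ x, |f x| ≤ M) (hk : Integrable k) (x : X) :
    |conv π k f x| ≤ (∫ y, |k y|) * M := by
  rw [conv, ← integral_mul_const]
  refine norm_integral_le_of_norm_le (f := fun y => k y * f (x - π y)) (hk.abs.mul_const M) (Eventually.of_forall fun y => ?_)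
  rw [norm_mul, Real.norm_eq_abs, Real.norm_eq_abs]
  gcongr
  exact hf _

/-- Moves a displacement from the point to the kernel, so that the regularity of a convolution comes
from the kernel alone. -/
lemma conv_add_right (k : V → ℝ) (f : X → ℝ) (x : X) (h : V) :
    conv π k f (x + π h) = conv π (fun y => k (y + h)) f x := by
  rw [conv, conv, ← integral_add_right_eq_self _ h]
  congr 1
  ext y
  congr 2
  rw [map_add]
  abel

lemma conv_sub_kernel (hπ : Continuous π) (hk : Integrable k) (hk' : Integrable k')
    (hf : BddMeas f M) (x : X) :
    conv π k f x - conv π k' f x = conv π (fun y => k y - k' y) f x := by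
  rw [conv, conv, conv, ← integral_sub (integrable_conv hπ hk hf x) (integrable_conv hπ hk' hf x)]
  congr 1
  ext y
  ring

/-- A displacement changes the kernel by a small amount in `L¹`, so `f` need only be bounded and
measurable. Openness of `π` ensures that displacements in `V` reach a whole neighbourhood in `X`. -/
lemma continuous_conv (hπ : IsOpenQuotientMap π) (hk : Integrable k) (hf : BddMeas f M) :
    Continuous (conv π k f) := by
  have : SecondCountableTopology V := secondCountable_of_proper
  rw [continuous_iff_continuousAt]
  intro x
  obtain ⟨x, rfl⟩ := hπ.surjective x
  have hshift : Tendsto (fun h => conv π k f (π x + π h)) (𝓝 0) (𝓝 (conv π k f (π x))) := by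
    rw [tendsto_iff_dist_tendsto_zero]
    have h0 := tendsto_eLpNorm_translate (p := 1) ENNReal.one_ne_top (memLp_one_iff_integrable.2 hk)
    have h1 := ((ENNReal.tendsto_toReal ENNReal.zero_ne_top).comp h0).mul_const M
    rw [ENNReal.toReal_zero, zero_mul] at h1
    refine squeeze_zero (fun _ => dist_nonneg) (fun h => ?_) h1
    have hkh : Integrable fun y => k (y + h) := hk.comp_add_right h
    rw [Real.dist_eq, conv_add_right, conv_sub_kernel hπ.continuous hkh hk hf]
    refine (abs_conv_le hf.bdd (hkh.sub hk) _).trans (le_of_eq ?_)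
    congr 1
    simp only [Function.comp, eLpNorm_one_eq_lintegral_enorm]
    exact integral_norm_eq_lintegral_enorm (hkh.sub hk).1
  have hmap : 𝓝 (π x) = map (fun h => π x + π h) (𝓝 0) := by
    have h1 : 𝓝 x = map (fun h => x + h) (𝓝 0) := by rw [map_add_left_nhds, add_zero]
    rw [← (hπ.isOpenMap.map_nhds_eq hπ.continuous.continuousAt), h1, map_map]
    congr 1
    ext h
    simp
  rw [ContinuousAt, hmap]
  exact hshift

lemma isOneParam_map (π : V →+ X) (e : V) : IsOneParam fun s : ℝ => π (s • e) := fun s t => by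
  simp only [add_smul, map_add]

/-- The fundamental theorem of calculus along lines, followed by Fubini. Only integrability of `k'`
is needed, not a locally uniform majorant, so kernels singular at time zero are allowed. -/
lemma hasDir_conv_kernel (hπ : IsOpenQuotientMap π) {e : V} (hk : Integrable k)
    (hk' : Integrable k') (hd : HasDir (fun s : ℝ => s • e) k k')
    (hc : ∀ y, Continuous fun s : ℝ => k' (y + s • e)) (hm : Measurable k')
    (hf : BddMeas f M) :
    HasDir (fun s : ℝ => π (s • e)) (conv π k f) (conv π k' f) := by
  have : SecondCountableTopology V := secondCountable_of_proper
  intro x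
  have hone : IsOneParam fun s : ℝ => s • e := fun s t => add_smul s t e
  have hcont : Continuous fun r : ℝ => conv π k' f (x + π (r • e)) :=
    (continuous_conv hπ hk' hf).comp (continuous_const.add (hπ.continuous.comp (by fun_prop)))
  have key : ∀ h : ℝ, conv π k f (x + π (h • e)) =
      conv π k f x + ∫ r in (0 : ℝ)..h, conv π k' f (x + π (r • e)) := by
    intro h
    rw [← sub_eq_iff_eq_add', conv_add_right,
      conv_sub_kernel hπ.continuous (hk.comp_add_right _) hk hf]
    have h1 : ∀ y, k (y + h • e) - k y = ∫ r in (0 : ℝ)..h, k' (y + r • e) := by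
      intro y
      rw [intervalIntegral.integral_eq_sub_of_hasDerivAt
        (fun r _ => HasDir.hasDerivAt hone hd y r) ((hc y).intervalIntegrable _ _)]
      simp
    simp_rw [conv_add_right, conv, h1]
    rw [intervalIntegral_integral_swap]
    · simp_rw [intervalIntegral.integral_mul_const]
    · have hsm : Measurable fun p : ℝ × V => k' (p.2 + p.1 • e) * f (x - π p.2) := by
        refine (hm.comp (by fun_prop)).mul ?_
        exact (measurable_comp_sub hπ.continuous hf.meas x).comp measurable_snd
      rw [Function.uncurry_def, integrable_prod_iff hsm.aestronglyMeasurable]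
      refine ⟨Eventually.of_forall fun r =>
        integrable_conv hπ.continuous (hk'.comp_add_right (r • e)) hf x,
        ?_⟩
      have : IsFiniteMeasure (volume.restrict (uIoc 0 h)) := by
        rw [uIoc]
        infer_instance
      refine Integrable.of_bound (C := (∫ y, |k' y|) * M) ?_ ?_
      · exact (hsm.norm.stronglyMeasurable.integral_prod_right).aestronglyMeasurable
      · refine Eventually.of_forall fun r => ?_
        rw [Real.norm_of_nonneg (integral_nonneg fun _ => norm_nonneg _),
          ← integral_add_right_eq_self (fun y => |k' y|) (r • e), ← integral_mul_const]
        refine integral_mono_of_nonneg (Eventually.of_forall fun _ => norm_nonneg _)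
          ((hk'.comp_add_right _).abs.mul_const M) (Eventually.of_forall fun y => ?_)
        simp only [norm_mul, Real.norm_eq_abs]
        gcongr
        exact hf.bdd _
  simp_rw [key]
  have := (intervalIntegral.integral_hasDerivAt_right (hcont.intervalIntegrable 0 0)
    (hcont.stronglyMeasurableAtFilter _ _) hcont.continuousAt).const_add (conv π k f x)
  simpa using this

lemma hasDir_conv_right (hπ : Continuous π) {γ : ℝ → X} (hγ : IsOneParam γ) (hk : Integrable k)
    (hf : BddMeas f M) (hf' : BddMeas f' M') (hd : HasDir γ f f') :
    HasDir γ (conv π k f) (conv π k f') := by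
  intro x
  have hx : ∀ s y, x + γ s - π y = x - π y + γ s := fun s y => by abel
  refine ((hasDerivAt_integral_of_dominated_loc_of_deriv_le (s := univ)
    (F := fun s y => k y * f (x + γ s - π y)) (F' := fun s y => k y * f' (x + γ s - π y))
    (bound := fun y => |k y| * M') univ_mem
    (Eventually.of_forall fun s => (integrable_conv hπ hk hf _).1)
    (integrable_conv hπ hk hf _) (integrable_conv hπ hk hf' _).1 ?_ (hk.abs.mul_const M') ?_).2).congr_deriv ?_
  · refine Eventually.of_forall fun y s _ => ?_
    rw [norm_mul, Real.norm_eq_abs, Real.norm_eq_abs]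
    gcongr
    exact hf'.bdd _
  · refine Eventually.of_forall fun y s _ => ?_
    simp_rw [hx]
    exact (HasDir.hasDerivAt hγ hd _ s).const_mul _
  · simp only [hγ.zero, add_zero]
    rfl

/-- Integration by parts: a derivative may be moved from the kernel to the function. -/
lemma conv_deriv_comm (hπ : IsOpenQuotientMap π) {e : V} (hk : Integrable k)
    (hk' : Integrable k') (hd : HasDir (fun s : ℝ => s • e) k k')
    (hc : ∀ y, Continuous fun s : ℝ => k' (y + s • e)) (hm : Measurable k')
    (hf : BddMeas f M) (hf' : BddMeas f' M') (hdf : HasDir (fun s : ℝ => π (s • e)) f f') :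
    conv π k' f = conv π k f' :=
  -- Both sides are the directional derivative of the same convolution `conv π k f`.
  (hasDir_conv_kernel hπ hk hk' hd hc hm hf).unique
    (hasDir_conv_right hπ.continuous (isOneParam_map π e) hk hf hf' hdf)

lemma conv_conv (hπ : Continuous π) (hk : Integrable k) (hk' : Integrable k')
    (hf : BddMeas f M) (x : X) :
    conv π k (conv π k' f) x = conv π (fun y => ∫ z, k z * k' (y - z)) f x := by
  have : SecondCountableTopology V := secondCountable_of_proper
  have h1 : conv π k (conv π k' f) x = ∫ z, ∫ y, k z * k' (y - z) * f (x - π y) := by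
    rw [conv]
    congr 1
    ext z
    rw [conv, ← integral_const_mul, ← integral_sub_right_eq_self _ z]
    congr 1
    ext y
    rw [map_sub, mul_assoc]
    congr 3
    abel
  rw [h1, integral_integral_swap]
  · rw [conv]
    congr 1
    ext y
    rw [integral_mul_const]
  · have h2 : Integrable (fun p : V × V => k p.1 * k' (p.2 - p.1)) := by
      have := hk.convolution_integrand (ContinuousLinearMap.mul ℝ ℝ) hk'
      exact this.swap
    refine h2.mul_bdd (c := M) ?_ (Eventually.of_forall fun p => hf.bdd _)
    exact ((measurable_comp_sub hπ hf.meas x).comp measurable_snd).aestronglyMeasurable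

end Conv

section L2

/-- Minkowski's inequality for superpositions of `L²` functions. -/
lemma eLpNorm_integral_le {Z Y : Type*} [MeasurableSpace Z] [MeasurableSpace Y] {μ : Measure Z}
    {ν : Measure Y} [SFinite μ] [SFinite ν] {k : Z → ℝ} {F : Z → Y → ℝ} (hk : Integrable k μ)
    (hF : Measurable (Function.uncurry F)) {C : ℝ≥0∞} (hC : ∀ z, eLpNorm (F z) 2 ν ≤ C) :
    eLpNorm (fun x => ∫ z, k z * F z x ∂μ) 2 ν ≤ ENNReal.ofReal (∫ z, |k z| ∂μ) * C := by
  have hI : ENNReal.ofReal (∫ z, |k z| ∂μ) = ∫⁻ z, ‖k z‖ₑ ∂μ :=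
    ofReal_integral_norm_eq_lintegral_enorm hk
  set I := ∫⁻ z, ‖k z‖ₑ ∂μ with hIdef
  have hkm : AEMeasurable (fun z => ‖k z‖ₑ) μ := hk.1.enorm
  have hFm : ∀ x, Measurable fun z => ‖F z x‖ₑ := fun x =>
    (hF.comp (measurable_id.prodMk measurable_const)).enorm
  have hsq : ∀ f : Y → ℝ, eLpNorm f 2 ν = (∫⁻ x, ‖f x‖ₑ ^ (2 : ℝ) ∂ν) ^ (1 / (2 : ℝ)) := by
    intro f
    rw [eLpNorm_eq_lintegral_rpow_enorm_toReal (by norm_num) (by norm_num)]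
    simp
  have hpt : ∀ x, ‖∫ z, k z * F z x ∂μ‖ₑ ^ (2 : ℝ) ≤
      I * ∫⁻ z, ‖k z‖ₑ * ‖F z x‖ₑ ^ (2 : ℝ) ∂μ := by
    intro x
    -- Splitting `|k|` into two square roots prepares Cauchy–Schwarz for the measure `|k| μ`.
    have h1 : ‖∫ z, k z * F z x ∂μ‖ₑ ≤
        ∫⁻ z, (‖k z‖ₑ ^ (1 / 2 : ℝ)) * (‖k z‖ₑ ^ (1 / 2 : ℝ) * ‖F z x‖ₑ) ∂μ := by
      refine (enorm_integral_le_lintegral_enorm _).trans (lintegral_mono fun z => ?_)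
      rw [enorm_mul, ← mul_assoc, ← ENNReal.rpow_add_of_nonneg _ _ (by norm_num) (by norm_num)]
      norm_num
    have h2 := ENNReal.lintegral_mul_le_Lp_mul_Lq μ (p := 2) (q := 2)
      (Real.holderConjugate_iff.2 (by norm_num)) (hkm.pow_const (1 / 2 : ℝ))
      ((hkm.pow_const (1 / 2 : ℝ)).mul (hFm x).aemeasurable)
    have h3 := ENNReal.rpow_le_rpow (h1.trans h2) (zero_le_two (α := ℝ))
    refine h3.trans (le_of_eq ?_)
    rw [ENNReal.mul_rpow_of_nonneg _ _ zero_le_two, ← ENNReal.rpow_mul, ← ENNReal.rpow_mul]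
    norm_num
    simp only [mul_pow, ← ENNReal.rpow_natCast, ← ENNReal.rpow_mul]
    norm_num [hIdef]
  rw [hsq]
  have hC' : ∀ z, ∫⁻ x, ‖F z x‖ₑ ^ (2 : ℝ) ∂ν ≤ C ^ (2 : ℝ) := by
    intro z
    have := ENNReal.rpow_le_rpow ((hsq (F z)).symm.trans_le (hC z)) (zero_le_two (α := ℝ))
    rw [← ENNReal.rpow_mul] at this
    simpa using this
  have hmain : ∫⁻ x, ‖∫ z, k z * F z x ∂μ‖ₑ ^ (2 : ℝ) ∂ν ≤ (I * C) ^ (2 : ℝ) := by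
    calc _ ≤ ∫⁻ x, I * ∫⁻ z, ‖k z‖ₑ * ‖F z x‖ₑ ^ (2 : ℝ) ∂μ ∂ν := lintegral_mono hpt
      _ ≤ I * ∫⁻ x, ∫⁻ z, ‖k z‖ₑ * ‖F z x‖ₑ ^ (2 : ℝ) ∂μ ∂ν := by
          rw [lintegral_const_mul' _ _ (by rw [← hI]; exact ENNReal.ofReal_ne_top)]
      _ = I * ∫⁻ z, ∫⁻ x, ‖k z‖ₑ * ‖F z x‖ₑ ^ (2 : ℝ) ∂ν ∂μ := by
          rw [lintegral_lintegral_swap]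
          refine AEMeasurable.mul ?_ ?_
          · exact hkm.comp_quasiMeasurePreserving Measure.quasiMeasurePreserving_snd
          · exact ((hF.comp measurable_swap).enorm.pow_const _).aemeasurable
      _ = I * ∫⁻ z, ‖k z‖ₑ * ∫⁻ x, ‖F z x‖ₑ ^ (2 : ℝ) ∂ν ∂μ := by
          congr 2
          ext z
          rw [lintegral_const_mul' _ _ enorm_ne_top]
      _ ≤ I * ∫⁻ z, ‖k z‖ₑ * C ^ (2 : ℝ) ∂μ := by
          gcongr with z
          exact hC' z
      _ = (I * C) ^ (2 : ℝ) := by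
          rw [lintegral_mul_const'' _ hkm, ← hIdef, ENNReal.mul_rpow_of_nonneg _ _ zero_le_two,
            ← mul_assoc]
          congr 1
          rw [ENNReal.rpow_two, sq]
  rw [hI]
  calc _ ≤ ((I * C) ^ (2 : ℝ)) ^ (1 / (2 : ℝ)) := ENNReal.rpow_le_rpow hmain (by norm_num)
    _ = I * C := by rw [← ENNReal.rpow_mul]; norm_num

end L2

end CahnHilliard

end

/-! ### The covering homomorphisms of the strip and the damped space-time kernels -/

noncomputable section

set_option linter.unusedSectionVars false

namespace CahnHilliard
open SchwartzMap
open scoped SchwartzMap LineDeriv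

variable {n : ℕ}

instance : (volume : Measure (Cover n)).IsAddHaarMeasure :=
  inferInstanceAs (Measure.IsAddHaarMeasure
    ((volume : Measure (Fin n → ℝ)).prod (volume : Measure ℝ)))

instance : (volume : Measure (ℝ × Cover n)).IsAddHaarMeasure :=
  inferInstanceAs (Measure.IsAddHaarMeasure
    ((volume : Measure ℝ).prod (volume : Measure (Cover n))))

instance : (volume : Measure (Fin n → UnitAddCircle)).IsAddHaarMeasure :=
  inferInstanceAs (Measure.IsAddHaarMeasure
    (Measure.pi fun _ : Fin n => (volume : Measure UnitAddCircle)))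

instance : (volume : Measure (Strip n)).IsAddHaarMeasure :=
  inferInstanceAs (Measure.IsAddHaarMeasure
    ((volume : Measure (Fin n → UnitAddCircle)).prod (volume : Measure ℝ)))

/-- The quotient map `ℝⁿ × ℝ → S` as a homomorphism. -/
def coverHom (n : ℕ) : Cover n →+ Strip n where
  toFun := toStrip n
  map_zero' := rfl
  map_add' _ _ := rfl

lemma coverHom_apply (y : Cover n) : coverHom n y = toStrip n y := rfl

/-- The quotient map `ℝ × (ℝⁿ × ℝ) → ℝ × S` as a homomorphism. -/
def timeCoverHom (n : ℕ) : ℝ × Cover n →+ ℝ × Strip n :=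
  (AddMonoidHom.id ℝ).prodMap (coverHom n)

lemma timeCoverHom_apply (p : ℝ × Cover n) : timeCoverHom n p = (p.1, coverHom n p.2) := rfl

lemma isOpenQuotientMap_coverHom : IsOpenQuotientMap (coverHom n) := by
  have h : IsOpenQuotientMap (Pi.map fun (_ : Fin n) (x : ℝ) => (x : UnitAddCircle)) :=
    IsOpenQuotientMap.piMap fun _ => QuotientAddGroup.isOpenQuotientMap_mk
  exact h.prodMap IsOpenQuotientMap.id

lemma isOpenQuotientMap_timeCoverHom : IsOpenQuotientMap (timeCoverHom n) :=
  IsOpenQuotientMap.id.prodMap isOpenQuotientMap_coverHom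

lemma continuous_coverHom : Continuous (coverHom n) := isOpenQuotientMap_coverHom.continuous

lemma coverHom_smul_basis (i : Option (Fin n)) (s : ℝ) :
    coverHom n (s • coverBasis i) = axis i s := by
  rw [coverHom_apply]
  cases i with
  | none =>
    simp only [toStrip, coverBasis, axis]
    refine Prod.ext ?_ ?_
    · ext j
      simp
    · simp
  | some i =>
    simp only [toStrip, coverBasis, axis]
    refine Prod.ext ?_ ?_
    · ext j
      by_cases h : j = i
      · subst h
        simp
      · simp [h]
    · simp

/-- The displacement along a coordinate axis in space-time. -/
def timeAxis {n : ℕ} (i : Option (Fin n)) (s : ℝ) : ℝ × Strip n := (0, axis i s)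

/-- A coordinate direction of space-time. -/
def timeBasis {n : ℕ} (i : Option (Fin n)) : ℝ × Cover n := (0, coverBasis i)

lemma axis_eq (i : Option (Fin n)) : axis i = fun s : ℝ => coverHom n (s • coverBasis i) := by
  ext1 s
  rw [coverHom_smul_basis]

lemma timeAxis_eq (i : Option (Fin n)) :
    timeAxis i = fun s : ℝ => timeCoverHom n (s • timeBasis i) := by
  ext1 s
  rw [timeAxis, timeCoverHom_apply, timeBasis, Prod.smul_mk, smul_zero, coverHom_smul_basis]

lemma isOneParam_axis (i : Option (Fin n)) : IsOneParam (axis i) := by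
  rw [axis_eq]
  exact isOneParam_map _ _

lemma isOneParam_timeAxis (i : Option (Fin n)) : IsOneParam (timeAxis i) := by
  rw [timeAxis_eq]
  exact isOneParam_map _ _

lemma continuous_axis (i : Option (Fin n)) : Continuous (axis i) := by
  rw [axis_eq]
  exact continuous_coverHom.comp (by fun_prop)

/-! ### Rescaled kernels -/

/-- The rescaled kernel `a ^ (d + k) p (a y)`. -/
def slice (k : ℕ) (p : 𝓢(Cover n, ℝ)) (a : ℝ) (y : Cover n) : ℝ := a ^ (n + 1 + k) * p (a • y)

lemma finrank_cover : Module.finrank ℝ (Cover n) = n + 1 := by simp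

lemma integrable_slice (k : ℕ) (p : 𝓢(Cover n, ℝ)) {a : ℝ} (ha : 0 < a) :
    Integrable (slice k p a) := by
  refine Integrable.const_mul ?_ _
  exact (integrable_comp_smul_iff volume p ha.ne').2 p.integrable

lemma integral_slice_comp (k : ℕ) (p : 𝓢(Cover n, ℝ)) {a : ℝ} (ha : 0 < a) (f : Cover n → ℝ) :
    ∫ y, slice k p a y * f y = a ^ k * ∫ y, p y * f (a⁻¹ • y) := by
  have h := Measure.integral_comp_smul (volume : Measure (Cover n))
    (fun y => p y * f (a⁻¹ • y)) a
  rw [finrank_cover, abs_of_pos (by positivity)] at h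
  simp_rw [inv_smul_smul₀ ha.ne'] at h
  simp only [slice, mul_assoc]
  rw [integral_const_mul, h, smul_eq_mul, pow_add]
  field_simp

/-- The factor `a^{n+1}` cancels the Jacobian, leaving `a^k`. With `a = t^{-1/4}` this is the weight
`t^{-k/4}` attached to `k` derivatives. -/
lemma integral_abs_slice (k : ℕ) (p : 𝓢(Cover n, ℝ)) {a : ℝ} (ha : 0 < a) :
    ∫ y, |slice k p a y| = a ^ k * ∫ y, |p y| := by
  have h := Measure.integral_comp_smul (volume : Measure (Cover n)) (fun y => |p y|) a
  rw [finrank_cover, abs_of_pos (by positivity)] at h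
  simp only [slice, abs_mul]
  rw [integral_const_mul, h, smul_eq_mul, abs_of_pos (by positivity), pow_add]
  field_simp

lemma continuous_slice (k : ℕ) (p : 𝓢(Cover n, ℝ)) (a : ℝ) : Continuous (slice k p a) := by
  unfold slice
  exact continuous_const.mul (p.continuous.comp (by fun_prop))

lemma hasDir_slice (k : ℕ) (p : 𝓢(Cover n, ℝ)) (a : ℝ) (e : Cover n) :
    HasDir (fun s : ℝ => s • e) (slice k p a) (slice (k + 1) (∂_{e} p) a) := by
  intro y
  have h1 : HasDerivAt (fun s : ℝ => a • (y + s • e)) (a • e) 0 := by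
    have := (((hasDerivAt_id (0 : ℝ)).smul_const e).const_add y).const_smul a
    rw [one_smul] at this
    exact this
  have h2 := ((p.hasFDerivAt (a • (y + (0 : ℝ) • e))).comp_hasDerivAt (0 : ℝ) h1).const_mul
    (a ^ (n + 1 + k))
  simp only [slice]
  convert! h2 using 1
  rw [zero_smul, add_zero, lineDerivOp_apply_eq_fderiv, (fderiv ℝ p (a • y)).map_smul, smul_eq_mul]
  ring

/-- The scale `t ^ (-1/4)` of the kernels at time `t`. -/
def scale (t : ℝ) : ℝ := t ^ (-(1 / 4) : ℝ)

lemma scale_pos {t : ℝ} (ht : 0 < t) : 0 < scale t := Real.rpow_pos_of_pos ht _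

lemma scale_pow {t : ℝ} (ht : 0 < t) (k : ℕ) : scale t ^ k = t ^ (-(k / 4) : ℝ) := by
  rw [scale, ← Real.rpow_natCast, ← Real.rpow_mul ht.le]
  congr 1
  ring

lemma inv_scale_pow_four {t : ℝ} (ht : 0 < t) : (scale t ^ 4)⁻¹ = t := by
  rw [scale_pow ht, ← Real.rpow_neg ht.le]
  norm_num

lemma heat_eq_slice (j : ℕ) {t : ℝ} (ht : 0 < t) (y : Cover n) :
    heat n j t y = slice (2 * j) (heat n j 1) (scale t) y := by
  conv_lhs => rw [← inv_scale_pow_four ht]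
  exact heat_scale j (scale_pos ht) y

/-- The damped space-time kernel `e^{-lt} t^{-(d+k)/4} p (t^{-1/4} y)`, extended by zero to
nonpositive times. -/
def ker (l : ℝ) (k : ℕ) (p : 𝓢(Cover n, ℝ)) (q : ℝ × Cover n) : ℝ :=
  if 0 < q.1 then Real.exp (-(l * q.1)) * slice k p (scale q.1) q.2 else 0

lemma measurable_scale : Measurable scale := by
  unfold scale
  fun_prop

lemma measurable_ker (l : ℝ) (k : ℕ) (p : 𝓢(Cover n, ℝ)) : Measurable (ker l k p) := by
  refine Measurable.ite (measurableSet_lt measurable_const measurable_fst) ?_ measurable_const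
  have h1 : Measurable fun q : ℝ × Cover n => scale q.1 • q.2 :=
    (measurable_scale.comp measurable_fst).smul measurable_snd
  have h2 : Measurable fun q : ℝ × Cover n => p (scale q.1 • q.2) :=
    p.continuous.measurable.comp h1
  have h3 : Measurable fun q : ℝ × Cover n => scale q.1 ^ (n + 1 + k) :=
    (measurable_scale.comp measurable_fst).pow_const _
  exact (by fun_prop : Measurable fun q : ℝ × Cover n => Real.exp (-(l * q.1))).mul (h3.mul h2)

lemma integral_abs_ker_slice (l : ℝ) (k : ℕ) (p : 𝓢(Cover n, ℝ)) {t : ℝ} (ht : 0 < t) :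
    ∫ y, |ker l k p (t, y)| = t ^ (-(k / 4) : ℝ) * Real.exp (-(l * t)) * ∫ y, |p y| := by
  simp only [ker, ht, if_true, abs_mul, Real.abs_exp]
  rw [integral_const_mul, integral_abs_slice k p (scale_pos ht), scale_pow ht]
  ring

lemma integrable_ker_slice (l : ℝ) (k : ℕ) (p : 𝓢(Cover n, ℝ)) (t : ℝ) :
    Integrable fun y => ker l k p (t, y) := by
  simp only [ker]
  split_ifs with ht
  · exact (integrable_slice k p (scale_pos ht)).const_mul _
  · exact integrable_zero _ _ _

/-- The mass of the time part of the damped kernel. -/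
lemma integrableOn_time {l : ℝ} (hl : 0 < l) {k : ℕ} (hk : k ≤ 3) :
    IntegrableOn (fun t : ℝ => t ^ (-(k / 4) : ℝ) * Real.exp (-(l * t))) (Ioi 0) := by
  have hk' : (k : ℝ) ≤ 3 := by exact_mod_cast hk
  have h := integrableOn_rpow_mul_exp_neg_mul_rpow (p := 1) (s := -(k / 4)) (b := l)
    (by linarith) one_pos hl
  simpa [neg_mul] using h

/-- The mass at time `t` is a multiple of `t^{-k/4} e^{-lt}`: integrable at zero for `k ≤ 3`, and at
infinity by the damping. Thus `ΔK`, with `k = 2`, can still absorb one derivative. -/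
lemma integrable_ker {l : ℝ} (hl : 0 < l) {k : ℕ} (hk : k ≤ 3) (p : 𝓢(Cover n, ℝ)) :
    Integrable (ker l k p) := by
  change Integrable (ker l k p) ((volume : Measure ℝ).prod (volume : Measure (Cover n)))
  rw [integrable_prod_iff (measurable_ker l k p).aestronglyMeasurable]
  refine ⟨Eventually.of_forall fun t => integrable_ker_slice l k p t, ?_⟩
  have h : (fun t : ℝ => ∫ y, ‖ker l k p (t, y)‖) = (Ioi (0 : ℝ)).indicator
      fun t => t ^ (-(k / 4) : ℝ) * Real.exp (-(l * t)) * ∫ y, |p y| := by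
    ext t
    by_cases ht : 0 < t
    · rw [indicator_of_mem (show t ∈ Ioi (0 : ℝ) from ht), ← integral_abs_ker_slice l k p ht]
      rfl
    · rw [indicator_of_notMem (by simpa using ht)]
      simp [ker, ht]
  rw [h, integrable_indicator_iff measurableSet_Ioi]
  exact (integrableOn_time hl hk).mul_const _

/-- A Gamma integral. The power of `1 / l` makes the mass small for strong damping, which is the
source of every contraction below. -/
lemma integral_abs_ker {l : ℝ} (hl : 0 < l) {k : ℕ} (hk : k ≤ 3) (p : 𝓢(Cover n, ℝ)) :
    ∫ q, |ker l k p q| =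
      (1 / l) ^ (1 - k / 4 : ℝ) * Real.Gamma (1 - k / 4) * ∫ y, |p y| := by
  have hk' : (k : ℝ) ≤ 3 := by exact_mod_cast hk
  have h0 := integral_prod _ (integrable_ker hl hk p).abs
  change ∫ q, |ker l k p q| = _ at h0
  rw [h0]
  have h : (fun t : ℝ => ∫ y, |ker l k p (t, y)|) = (Ioi (0 : ℝ)).indicator
      fun t => t ^ (-(k / 4) : ℝ) * Real.exp (-(l * t)) * ∫ y, |p y| := by
    ext t
    by_cases ht : 0 < t
    · rw [indicator_of_mem (show t ∈ Ioi (0 : ℝ) from ht), ← integral_abs_ker_slice l k p ht]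
    · rw [indicator_of_notMem (by simpa using ht)]
      simp [ker, ht]
  rw [h, integral_indicator measurableSet_Ioi, integral_mul_const]
  have h2 := Real.integral_rpow_mul_exp_neg_mul_Ioi (a := 1 - k / 4) (r := l) (by linarith) hl
  rw [← h2]
  congr 3
  ext t
  congr 2
  ring

/-- Differentiating the rescaled profile brings out one factor `t^{-1/4}`, hence the shift from `k`
to `k + 1`. -/
lemma hasDir_ker (l : ℝ) (k : ℕ) (p : 𝓢(Cover n, ℝ)) (i : Option (Fin n)) :
    HasDir (fun s : ℝ => s • timeBasis i) (ker l k p) (ker l (k + 1) (∂_{coverBasis i} p)) := by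
  rintro ⟨t, y⟩
  simp only [ker, timeBasis, Prod.smul_mk, smul_zero, Prod.mk_add_mk, add_zero]
  split_ifs with ht
  · exact (hasDir_slice k p (scale t) (coverBasis i) y).const_mul _
  · exact hasDerivAt_const _ _

lemma continuous_ker_line (l : ℝ) (k : ℕ) (p : 𝓢(Cover n, ℝ)) (i : Option (Fin n))
    (q : ℝ × Cover n) : Continuous fun s : ℝ => ker l k p (q + s • timeBasis i) := by
  simp only [ker, timeBasis, Prod.smul_mk, smul_zero, Prod.fst_add, Prod.snd_add, add_zero]
  split_ifs with ht
  · exact continuous_const.mul ((continuous_slice k p _).comp (by fun_prop))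
  · exact continuous_const

end CahnHilliard

end

noncomputable section

set_option linter.unusedSectionVars false

namespace CahnHilliard
open SchwartzMap
open scoped SchwartzMap LineDeriv

/-! ### Functions with regular derivatives along a family of directions -/

section Reg

variable {X ι : Type*} [AddCommGroup X] [Fintype ι]

/-- The derivative along the `i`-th one-parameter subgroup. -/
def pd (γ : ι → ℝ → X) (i : ι) (f : X → ℝ) (x : X) : ℝ := deriv (fun s : ℝ => f (x + γ i s)) 0

/-- The Laplacian of a family of directions. -/
def lap (γ : ι → ℝ → X) (f : X → ℝ) : X → ℝ := ∑ i, pd γ i (pd γ i f)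

/-- All derivatives of `f` of order up to `m` along the directions `γ` exist and satisfy `P`. -/
def Reg (γ : ι → ℝ → X) (P : (X → ℝ) → Prop) : ℕ → (X → ℝ) → Prop
  | 0, f => P f
  | m + 1, f => P f ∧ ∀ i, HasDir (γ i) f (pd γ i f) ∧ Reg γ P m (pd γ i f)

variable {γ : ι → ℝ → X} {P Q R : (X → ℝ) → Prop} {f g f' : X → ℝ} {m m' : ℕ}

lemma HasDir.pd_eq {i : ι} (h : HasDir (γ i) f f') : pd γ i f = f' := by
  ext x
  exact (h x).deriv

lemma Reg.base (h : Reg γ P m f) : P f := by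
  cases m with
  | zero => exact h
  | succ m => exact h.1

lemma Reg.hasDir (h : Reg γ P (m + 1) f) (i : ι) : HasDir (γ i) f (pd γ i f) := (h.2 i).1

lemma Reg.pd (h : Reg γ P (m + 1) f) (i : ι) : Reg γ P m (pd γ i f) := (h.2 i).2

lemma Reg.succ_intro (h : P f) {f' : ι → X → ℝ} (hd : ∀ i, HasDir (γ i) f (f' i))
    (hr : ∀ i, Reg γ P m (f' i)) : Reg γ P (m + 1) f :=
  ⟨h, fun i => by rw [(hd i).pd_eq]; exact ⟨hd i, hr i⟩⟩

lemma Reg.of_succ (h : Reg γ P (m + 1) f) : Reg γ P m f := by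
  induction m generalizing f with
  | zero => exact h.1
  | succ m ih => exact ⟨h.1, fun i => ⟨h.hasDir i, ih (h.pd i)⟩⟩

lemma Reg.mono (h : Reg γ P m f) (hm : m' ≤ m) : Reg γ P m' f := by
  induction hm with
  | refl => exact h
  | step _ ih => exact ih h.of_succ

lemma Reg.imp (hPQ : ∀ f, P f → Q f) (h : Reg γ P m f) : Reg γ Q m f := by
  induction m generalizing f with
  | zero => exact hPQ _ h
  | succ m ih => exact ⟨hPQ _ h.1, fun i => ⟨h.hasDir i, ih (h.pd i)⟩⟩

lemma Reg.add (hP : ∀ f g, P f → P g → P (f + g)) (hf : Reg γ P m f) (hg : Reg γ P m g) :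
    Reg γ P m (f + g) := by
  induction m generalizing f g with
  | zero => exact hP _ _ hf hg
  | succ m ih =>
    exact Reg.succ_intro (hP _ _ hf.1 hg.1) (fun i => (hf.hasDir i).add (hg.hasDir i))
      fun i => ih (hf.pd i) (hg.pd i)

/-- The Leibniz rule, with three predicates so that one factor may be only bounded while the other
is also square integrable. -/
lemma Reg.mul (hγ : ∀ i, γ i 0 = 0) (hR : ∀ f g, R f → R g → R (f + g))
    (hPQ : ∀ f g, P f → Q g → R (f * g)) (hf : Reg γ P m f) (hg : Reg γ Q m g) :
    Reg γ R m (f * g) := by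
  induction m generalizing f g with
  | zero => exact hPQ _ _ hf hg
  | succ m ih =>
    exact Reg.succ_intro (hPQ _ _ hf.1 hg.1) (fun i => (hf.hasDir i).mul (hγ i) (hg.hasDir i))
      fun i => Reg.add hR (ih (hf.pd i) hg.of_succ) (ih hf.of_succ (hg.pd i))

lemma Reg.sum (hP : ∀ f g, P f → P g → P (f + g)) (h0 : Reg γ P m 0) {κ : Type*} (s : Finset κ)
    {F : κ → X → ℝ} (hF : ∀ j ∈ s, Reg γ P m (F j)) : Reg γ P m (∑ j ∈ s, F j) :=
  Finset.sum_induction _ (Reg γ P m) (fun _ _ => Reg.add hP) h0 hF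

lemma Reg.zero (h0 : P 0) : Reg γ P m 0 := by
  induction m with
  | zero => exact h0
  | succ m ih => exact Reg.succ_intro h0 (fun i => hasDir_const (γ i) 0) fun _ => ih

lemma Reg.const (h0 : P 0) (c : ℝ) (hc : P fun _ => c) : Reg γ P m fun _ => c := by
  cases m with
  | zero => exact hc
  | succ m => exact Reg.succ_intro hc (fun i => hasDir_const (γ i) c) fun _ => Reg.zero h0

lemma Reg.lap (hP : ∀ f g, P f → P g → P (f + g)) (h0 : P 0) (h : Reg γ P (m + 2) f) :
    Reg γ P m (lap γ f) :=
  Reg.sum hP (Reg.zero h0) _ fun i _ => (h.pd i).pd i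

end Reg

variable {n : ℕ}

/-- Bounded continuous functions. -/
def BC {X : Type*} [TopologicalSpace X] (f : X → ℝ) : Prop := Continuous f ∧ ∃ M, ∀ x, |f x| ≤ M

section BC

variable {X : Type*} [TopologicalSpace X] {f g : X → ℝ}

lemma BC.add (hf : BC f) (hg : BC g) : BC (f + g) := by
  obtain ⟨hf, M, hM⟩ := hf
  obtain ⟨hg, M', hM'⟩ := hg
  exact ⟨hf.add hg, M + M', fun x => (abs_add_le _ _).trans (add_le_add (hM x) (hM' x))⟩

lemma BC.mul (hf : BC f) (hg : BC g) : BC (f * g) := by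
  obtain ⟨hf, M, hM⟩ := hf
  obtain ⟨hg, M', hM'⟩ := hg
  refine ⟨hf.mul hg, M * M', fun x => ?_⟩
  rw [Pi.mul_apply, abs_mul]
  exact mul_le_mul (hM x) (hM' x) (abs_nonneg _) ((abs_nonneg _).trans (hM x))

lemma BC.const (c : ℝ) : BC fun _ : X => c := ⟨continuous_const, |c|, fun _ => le_rfl⟩

lemma BC.zero : BC (0 : X → ℝ) := BC.const 0

lemma BC.bddMeas [MeasurableSpace X] [BorelSpace X] (hf : BC f) : ∃ M, BddMeas f M :=
  hf.2.imp fun _ hM => ⟨hf.1.measurable, hM⟩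

end BC

/-! ### Moving derivatives from kernels to functions -/

lemma conv_lineDeriv (p : 𝓢(Cover n, ℝ)) (i : Option (Fin n)) {f : Strip n → ℝ}
    (hf : Reg axis BC 1 f) :
    conv (coverHom n) (∂_{coverBasis i} p : 𝓢(Cover n, ℝ)) f = conv (coverHom n) p (pd axis i f) := by
  obtain ⟨M, hM⟩ := hf.base.bddMeas
  obtain ⟨M', hM'⟩ := (hf.pd i).base.bddMeas
  refine conv_deriv_comm isOpenQuotientMap_coverHom (e := coverBasis i) p.integrable
    (∂_{coverBasis i} p).integrable ?_ ?_ (∂_{coverBasis i} p).continuous.measurable hM hM' ?_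
  · have := hasDir_slice 0 p 1 (coverBasis i)
    have h1 : ∀ (k : ℕ) (q : 𝓢(Cover n, ℝ)), slice k q 1 = q := by
      intro k q
      ext y
      simp [slice]
    rwa [h1, h1] at this
  · intro y
    exact (∂_{coverBasis i} p).continuous.comp (by fun_prop)
  · rw [← axis_eq]
    exact hf.hasDir i

lemma conv_finset_sum_kernel {V X : Type*} [NormedAddCommGroup V] [NormedSpace ℝ V]
    [MeasureSpace V] [BorelSpace V] [FiniteDimensional ℝ V] [(volume : Measure V).IsAddHaarMeasure]
    [AddCommGroup X] [TopologicalSpace X] [IsTopologicalAddGroup X] [MeasurableSpace X]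
    [BorelSpace X] [SecondCountableTopology X] {π : V →+ X} (hπ : Continuous π) {ι : Type*}
    (s : Finset ι) {k : ι → V → ℝ} (hk : ∀ i ∈ s, Integrable (k i)) {f : X → ℝ} {M : ℝ}
    (hf : BddMeas f M) (x : X) :
    conv π (fun y => ∑ i ∈ s, k i y) f x = ∑ i ∈ s, conv π (k i) f x := by
  simp only [conv]
  rw [← integral_finsetSum s fun i hi => integrable_conv hπ (hk i hi) hf x]
  simp_rw [Finset.sum_mul]

lemma conv_finset_sum_right {V X : Type*} [NormedAddCommGroup V] [NormedSpace ℝ V]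
    [MeasureSpace V] [BorelSpace V] [FiniteDimensional ℝ V] [(volume : Measure V).IsAddHaarMeasure]
    [AddCommGroup X] [TopologicalSpace X] [IsTopologicalAddGroup X] [MeasurableSpace X]
    [BorelSpace X] [SecondCountableTopology X] {π : V →+ X} (hπ : Continuous π) {ι : Type*}
    (s : Finset ι) {k : V → ℝ} (hk : Integrable k) {f : ι → X → ℝ}
    (hf : ∀ i ∈ s, ∃ M, BddMeas (f i) M) (x : X) :
    conv π k (∑ i ∈ s, f i) x = ∑ i ∈ s, conv π k (f i) x := by
  simp only [conv]
  rw [← integral_finsetSum s fun i hi => integrable_conv hπ hk (hf i hi).choose_spec x]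
  simp_rw [Finset.sum_apply, Finset.mul_sum]

lemma conv_schwartzLaplacian (p : 𝓢(Cover n, ℝ)) {f : Strip n → ℝ} (hf : Reg axis BC 2 f) :
    conv (coverHom n) (schwartzLaplacian p) f = conv (coverHom n) p (lap axis f) := by
  ext x
  obtain ⟨M, hM⟩ := hf.base.bddMeas
  have h1 : (⇑(schwartzLaplacian p) : Cover n → ℝ) =
      fun y => ∑ i : Option (Fin n), (∂_{coverBasis i} (∂_{coverBasis i} p)) y := by
    ext y
    rw [schwartzLaplacian, _root_.sum_apply]
  rw [h1, conv_finset_sum_kernel continuous_coverHom _ (fun i _ => SchwartzMap.integrable _) hM,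
    lap, conv_finset_sum_right continuous_coverHom _ p.integrable
      fun i _ => ((hf.pd i).pd i).base.bddMeas]
  refine Finset.sum_congr rfl fun i _ => ?_
  rw [conv_lineDeriv _ i hf.of_succ, conv_lineDeriv _ i (hf.pd i)]

lemma conv_heat_succ (j : ℕ) (s : ℝ) {f : Strip n → ℝ} (hf : Reg axis BC 2 f) :
    conv (coverHom n) (heat n (j + 1) s) f = conv (coverHom n) (heat n j s) (lap axis f) := by
  rw [← schwartzLaplacian_heat, conv_schwartzLaplacian _ hf]

lemma conv_ker_lineDeriv {l : ℝ} (hl : 0 < l) {k : ℕ} (hk : k + 1 ≤ 3) (p : 𝓢(Cover n, ℝ))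
    (i : Option (Fin n)) {f : ℝ × Strip n → ℝ} (hf : Reg timeAxis BC 1 f) :
    conv (timeCoverHom n) (ker l (k + 1) (∂_{coverBasis i} p)) f =
      conv (timeCoverHom n) (ker l k p) (pd timeAxis i f) := by
  obtain ⟨M, hM⟩ := hf.base.bddMeas
  obtain ⟨M', hM'⟩ := (hf.pd i).base.bddMeas
  refine conv_deriv_comm isOpenQuotientMap_timeCoverHom (e := timeBasis i)
    (integrable_ker hl (by omega) p) (integrable_ker hl hk _) (hasDir_ker l k p i)
    (continuous_ker_line l _ _ i) (measurable_ker _ _ _) hM hM' ?_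
  rw [← timeAxis_eq]
  exact hf.hasDir i

/-- The damped space-time kernels `e^{-lt} Δʲ K_t`. -/
def heatKer (n : ℕ) (l : ℝ) (j : ℕ) : ℝ × Cover n → ℝ := ker l (2 * j) (heat n j 1)

lemma heatKer_of_pos (l : ℝ) (j : ℕ) {t : ℝ} (ht : 0 < t) (y : Cover n) :
    heatKer n l j (t, y) = Real.exp (-(l * t)) * heat n j t y := by
  rw [heatKer, ker, heat_eq_slice j ht]
  simp [ht]

lemma heatKer_of_nonpos (l : ℝ) (j : ℕ) {t : ℝ} (ht : t ≤ 0) (y : Cover n) :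
    heatKer n l j (t, y) = 0 := by
  simp [heatKer, ker, ht]

/-- Two integrations by parts, through kernels with `k = 2` and `k = 1`. Once the forcing is
regular, the singular kernel `ΔK` is replaced by `K`. -/
lemma conv_heatKer_one {l : ℝ} (hl : 0 < l) {f : ℝ × Strip n → ℝ} (hf : Reg timeAxis BC 2 f) :
    conv (timeCoverHom n) (heatKer n l 1) f =
      conv (timeCoverHom n) (heatKer n l 0) (lap timeAxis f) := by
  ext x
  obtain ⟨M, hM⟩ := hf.base.bddMeas
  have h1 : heatKer n l 1 = fun q => ∑ i : Option (Fin n),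
      ker l 2 (∂_{coverBasis i} (∂_{coverBasis i} (heat n 0 1))) q := by
    ext q
    rw [heatKer, ← schwartzLaplacian_heat]
    simp only [ker, slice, schwartzLaplacian, _root_.sum_apply]
    split_ifs
    · rw [Finset.mul_sum, Finset.mul_sum]
    · simp
  rw [h1, conv_finset_sum_kernel isOpenQuotientMap_timeCoverHom.continuous _
      (fun i _ => integrable_ker hl (by norm_num) _) hM,
    lap, show heatKer n l 0 = ker l 0 (heat n 0 1) from rfl,
    conv_finset_sum_right isOpenQuotientMap_timeCoverHom.continuous _
      (integrable_ker hl (by norm_num) _) fun i _ =>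
        ((hf.pd i).pd i).base.bddMeas]
  refine Finset.sum_congr rfl fun i _ => ?_
  rw [conv_ker_lineDeriv hl (by norm_num) _ i hf.of_succ,
    conv_ker_lineDeriv hl (by norm_num) _ i (hf.pd i)]

end CahnHilliard

end

/-! ### Evolution operators and their localisation in time -/

noncomputable section

set_option linter.unusedSectionVars false

namespace CahnHilliard

variable {n : ℕ}

lemma measurable_heatKer (l : ℝ) (j : ℕ) : Measurable (heatKer n l j) := measurable_ker _ _ _

lemma integrable_heatKer {l : ℝ} (hl : 0 < l) {j : ℕ} (hj : j ≤ 1) : Integrable (heatKer n l j) :=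
  integrable_ker hl (by omega) _

lemma integrable_heatKer_slice (l : ℝ) (j : ℕ) (t : ℝ) : Integrable fun y => heatKer n l j (t, y) :=
  integrable_ker_slice _ _ _ _

/-- The mass of `Δʲ K_1`. -/
def heatMass (n j : ℕ) : ℝ := ∫ y, |heat n j 1 y|

lemma heatMass_nonneg (n j : ℕ) : 0 ≤ heatMass n j := integral_nonneg fun _ => abs_nonneg _

lemma integral_abs_heatKer_slice (l : ℝ) (j : ℕ) {t : ℝ} (ht : 0 < t) :
    ∫ y, |heatKer n l j (t, y)| = t ^ (-(j / 2) : ℝ) * Real.exp (-(l * t)) * heatMass n j := by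
  rw [heatKer, integral_abs_ker_slice _ _ _ ht, heatMass]
  congr 3
  push_cast
  ring

lemma integral_abs_heatKer_zero_le {l : ℝ} (hl : 0 ≤ l) (t : ℝ) :
    ∫ y, |heatKer n l 0 (t, y)| ≤ heatMass n 0 := by
  rcases lt_or_ge 0 t with ht | ht
  · rw [integral_abs_heatKer_slice l 0 ht]
    have h1 : Real.exp (-(l * t)) ≤ 1 := Real.exp_le_one_iff.2 (by nlinarith)
    have h2 := heatMass_nonneg n 0
    simp only [CharP.cast_eq_zero, zero_div, neg_zero, Real.rpow_zero, one_mul]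
    nlinarith
  · simp only [heatKer_of_nonpos l 0 ht, abs_zero, integral_zero]
    exact heatMass_nonneg n 0

lemma integral_heatKer_mul_heatKer (l : ℝ) (i j : ℕ) {s r : ℝ} (hs : 0 < s) (hr : 0 < r)
    (y : Cover n) :
    ∫ z, heatKer n l i (s, z) * heatKer n l j (r, y - z) = heatKer n l (i + j) (s + r, y) := by
  simp_rw [heatKer_of_pos l _ hs, heatKer_of_pos l _ hr, heatKer_of_pos l _ (add_pos hs hr)]
  rw [← integral_heat_mul_heat i j hs hr, ← integral_const_mul]
  congr 1
  ext z
  rw [mul_add, neg_add, Real.exp_add]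
  ring

/-- The damped evolution `e^{-lt} K_t ⋆ f` of the datum `f`. -/
def freeEvolution (l : ℝ) (f : Strip n → ℝ) (q : ℝ × Strip n) : ℝ :=
  conv (coverHom n) (fun y => heatKer n l 0 (q.1, y)) f q.2

lemma measurable_conv_param {Z : Type*} [MeasurableSpace Z] {k : Z × Cover n → ℝ}
    (hk : Measurable k) {F : Z × Strip n → ℝ} (hF : Measurable F) :
    Measurable fun q : Z × Strip n =>
      conv (coverHom n) (fun y => k (q.1, y)) (fun x => F (q.1, x)) q.2 := by
  have h : Measurable fun p : (Z × Strip n) × Cover n =>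
      k (p.1.1, p.2) * F (p.1.1, p.1.2 - coverHom n p.2) := by
    refine (hk.comp (by fun_prop)).mul (hF.comp ?_)
    have := continuous_coverHom (n := n) |>.measurable
    fun_prop
  exact h.stronglyMeasurable.integral_prod_right'.measurable

lemma bddMeas_freeEvolution {l : ℝ} (hl : 0 ≤ l) {f : Strip n → ℝ} {M : ℝ} (hf : BddMeas f M) :
    BddMeas (freeEvolution l f) (heatMass n 0 * M) := by
  refine ⟨measurable_conv_param (measurable_heatKer l 0) (hf.meas.comp measurable_snd), fun q => ?_⟩
  refine (abs_conv_le hf.bdd (integrable_heatKer_slice l 0 q.1) q.2).trans ?_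
  have := hf.nonneg 0
  gcongr
  exact integral_abs_heatKer_zero_le hl q.1

lemma freeEvolution_of_nonpos (l : ℝ) (f : Strip n → ℝ) {t : ℝ} (ht : t ≤ 0) (x : Strip n) :
    freeEvolution l f (t, x) = 0 := by
  simp [freeEvolution, conv, heatKer_of_nonpos l 0 ht]

lemma conv_time_eq {k : ℝ × Cover n → ℝ} (hk : Integrable k) {f : ℝ × Strip n → ℝ} {M : ℝ}
    (hf : BddMeas f M) (t : ℝ) (x : Strip n) :
    conv (timeCoverHom n) k f (t, x) =
      ∫ s, conv (coverHom n) (fun y => k (s, y)) (fun x => f (t - s, x)) x :=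
  integral_prod _ (integrable_conv isOpenQuotientMap_timeCoverHom.continuous hk hf (t, x))

lemma indicator_integral_deriv {θ θ' : ℝ → ℝ} (hθ : ∀ t, HasDerivAt θ (θ' t) t)
    (hθ' : Continuous θ') (t : ℝ) {a : ℝ} (ha : 0 ≤ a) :
    ∫ s in Ioo 0 a, θ' (t - s) = θ t - θ (t - a) := by
  rw [← integral_Ioc_eq_integral_Ioo, ← intervalIntegral.integral_of_le ha,
    intervalIntegral.integral_comp_sub_left,
    intervalIntegral.integral_eq_sub_of_hasDerivAt (fun s _ => hθ s)
      (hθ'.intervalIntegrable _ _), sub_zero]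

/-- Localisation in time of the free evolution. -/
lemma conv_heatKer_deriv_mul_freeEvolution {l : ℝ} (hl : 0 < l) {θ θ' : ℝ → ℝ}
    (hθ : ∀ t, HasDerivAt θ (θ' t) t) (hθ' : Continuous θ') {C : ℝ} (hC : ∀ t, |θ' t| ≤ C)
    (h0 : θ 0 = 0) {f : Strip n → ℝ} {M : ℝ} (hf : BddMeas f M) (t : ℝ) (x : Strip n) :
    conv (timeCoverHom n) (heatKer n l 0) (fun q => θ' q.1 * freeEvolution l f q) (t, x) =
      θ t * freeEvolution l f (t, x) := by
  have hA := bddMeas_freeEvolution hl.le hf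
  have hB : BddMeas (fun q : ℝ × Strip n => θ' q.1 * freeEvolution l f q)
      (C * (heatMass n 0 * M)) := by
    refine ⟨(hθ'.measurable.comp measurable_fst).mul hA.meas, fun q => ?_⟩
    rw [abs_mul]
    exact mul_le_mul (hC _) (hA.bdd _) (abs_nonneg _) ((abs_nonneg _).trans (hC 0))
  rw [conv_time_eq (integrable_heatKer hl zero_le_one) hB]
  -- For `0 < s < t` the semigroup law reproduces the free evolution at time `t`, whatever `s` is.
  -- Only `∫ θ'(t - s) ds = θ(t) - θ(0)` remains.
  have hkey : ∀ s, conv (coverHom n) (fun y => heatKer n l 0 (s, y))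
      (fun x => θ' (t - s) * freeEvolution l f (t - s, x)) x =
      (Ioo 0 t).indicator (fun s => θ' (t - s)) s * freeEvolution l f (t, x) := by
    intro s
    by_cases hs : 0 < s ∧ s < t
    · rw [indicator_of_mem (mem_Ioo.2 hs)]
      have h1 : conv (coverHom n) (fun y => heatKer n l 0 (s, y))
          (fun x => θ' (t - s) * freeEvolution l f (t - s, x)) x = θ' (t - s) *
          conv (coverHom n) (fun y => heatKer n l 0 (s, y))
            (conv (coverHom n) (fun y => heatKer n l 0 (t - s, y)) f) x := by
        rw [conv, conv, ← integral_const_mul]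
        congr 1
        ext y
        rw [freeEvolution]
        ring
      rw [h1, conv_conv continuous_coverHom (integrable_heatKer_slice l 0 s)
        (integrable_heatKer_slice l 0 (t - s)) hf]
      simp_rw [integral_heatKer_mul_heatKer l 0 0 hs.1 (sub_pos.2 hs.2), add_sub_cancel]
      rfl
    · rw [indicator_of_notMem (by simpa using hs), zero_mul]
      rcases not_and_or.1 hs with h | h
      · simp [conv, heatKer_of_nonpos l 0 (not_lt.1 h)]
      · simp [conv, freeEvolution_of_nonpos l f (sub_nonpos.2 (not_lt.1 h))]
  simp_rw [hkey]
  rw [integral_mul_const, integral_indicator measurableSet_Ioo]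
  rcases lt_or_ge 0 t with ht | ht
  · rw [indicator_integral_deriv hθ hθ' t ht.le, sub_self, h0, sub_zero]
  · simp [freeEvolution_of_nonpos l f ht]

/-- Localisation in time of the forced evolution. -/
lemma conv_heatKer_deriv_mul_conv {l : ℝ} (hl : 0 < l) {θ θ' : ℝ → ℝ}
    (hθ : ∀ t, HasDerivAt θ (θ' t) t) (hθ' : Continuous θ') {C : ℝ} (hC : ∀ t, |θ' t| ≤ C)
    {C' : ℝ} (hC' : ∀ t, |θ t| ≤ C')
    {N : ℝ × Strip n → ℝ} {M : ℝ} (hN : BddMeas N M) (t : ℝ) (x : Strip n) :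
    conv (timeCoverHom n) (heatKer n l 0)
        (fun q => θ' q.1 * conv (timeCoverHom n) (heatKer n l 1) N q) (t, x) =
      θ t * conv (timeCoverHom n) (heatKer n l 1) N (t, x) -
        conv (timeCoverHom n) (heatKer n l 1) (fun q => θ q.1 * N q) (t, x) := by
  have hπ := (isOpenQuotientMap_timeCoverHom (n := n)).continuous
  have hk0 := integrable_heatKer (n := n) hl zero_le_one
  have hk1 := integrable_heatKer (n := n) hl le_rfl
  have hk0θ : Integrable fun q : ℝ × Cover n => θ' (t - q.1) * heatKer n l 0 q := by
    refine hk0.bdd_mul (c := C) ?_ (Eventually.of_forall fun q => hC _)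
    exact (hθ'.comp (by fun_prop)).aestronglyMeasurable
  -- At a fixed final time `t` the weight can be attached to the kernel, so that associativity of
  -- convolution applies.
  have h1 : conv (timeCoverHom n) (heatKer n l 0)
        (fun q => θ' q.1 * conv (timeCoverHom n) (heatKer n l 1) N q) (t, x) =
      conv (timeCoverHom n) (fun q => θ' (t - q.1) * heatKer n l 0 q)
        (conv (timeCoverHom n) (heatKer n l 1) N) (t, x) := by
    rw [conv, conv]
    congr 1
    ext q
    rw [timeCoverHom_apply, Prod.mk_sub_mk]
    ring
  have hθN : BddMeas (fun q : ℝ × Strip n => θ q.1 * N q) (C' * M) := by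
    have hθc : Continuous θ := continuous_iff_continuousAt.2 fun t => (hθ t).continuousAt
    refine ⟨(hθc.measurable.comp measurable_fst).mul hN.meas, fun q => ?_⟩
    rw [abs_mul]
    exact mul_le_mul (hC' _) (hN.bdd _) (abs_nonneg _) ((abs_nonneg _).trans (hC' 0))
  rw [h1, conv_conv hπ hk0θ hk1 hN]
  have h2 : Integrable (fun p : (ℝ × Cover n) × (ℝ × Cover n) =>
      (θ' (t - p.1.1) * heatKer n l 0 p.1) * heatKer n l 1 (p.2 - p.1)) :=
    (hk0θ.convolution_integrand (ContinuousLinearMap.mul ℝ ℝ) hk1).swap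
  -- At time `σ` the composed kernel is `ΔK_σ` times `∫_0^σ θ'(t - s) ds = θ(t) - θ(t - σ)`. This
  -- holds almost everywhere, since integrability of the sections comes from Fubini.
  have h3 : (fun q => ∫ z, θ' (t - z.1) * heatKer n l 0 z * heatKer n l 1 (q - z)) =ᵐ[volume]
      fun q => (θ t - θ (t - q.1)) * heatKer n l 1 q := by
    filter_upwards [h2.prod_left_ae] with q hq
    have hq' := integral_prod _ hq
    refine Eq.trans hq' ?_
    obtain ⟨σ, ζ⟩ := q
    have h4 : ∀ s, ∫ z, θ' (t - s) * heatKer n l 0 (s, z) * heatKer n l 1 ((σ, ζ) - (s, z)) =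
        (Ioo 0 σ).indicator (fun s => θ' (t - s)) s * heatKer n l 1 (σ, ζ) := by
      intro s
      by_cases hs : 0 < s ∧ s < σ
      · rw [indicator_of_mem (mem_Ioo.2 hs)]
        simp_rw [Prod.mk_sub_mk, mul_assoc]
        rw [integral_const_mul, integral_heatKer_mul_heatKer l 0 1 hs.1 (sub_pos.2 hs.2),
          add_sub_cancel, zero_add]
      · rw [indicator_of_notMem (by simpa using hs), zero_mul]
        rcases not_and_or.1 hs with h | h
        · simp [heatKer_of_nonpos l 0 (not_lt.1 h)]
        · simp [heatKer_of_nonpos l 1 (sub_nonpos.2 (not_lt.1 h))]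
    simp only [h4]
    rw [integral_mul_const, integral_indicator measurableSet_Ioo]
    rcases lt_or_ge 0 σ with hσ | hσ
    · rw [indicator_integral_deriv hθ hθ' t hσ.le]
    · simp [heatKer_of_nonpos l 1 hσ]
  have h5 : conv (timeCoverHom n)
      (fun q => ∫ z, θ' (t - z.1) * heatKer n l 0 z * heatKer n l 1 (q - z)) N (t, x) =
      ∫ q, (θ t * (heatKer n l 1 q * N ((t, x) - timeCoverHom n q)) -
        heatKer n l 1 q * (θ (t - q.1) * N ((t, x) - timeCoverHom n q))) := by
    rw [conv]
    refine integral_congr_ae ?_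
    filter_upwards [h3] with q hq
    rw [hq]
    ring
  rw [h5]
  refine (integral_sub ((integrable_conv hπ hk1 hN _).const_mul _)
    (integrable_conv hπ hk1 hθN (t, x))).trans ?_
  rw [integral_const_mul]
  rfl

end CahnHilliard

end

/-! ### The approximate identity and the damped biharmonic heat equation -/

noncomputable section

set_option linter.unusedSectionVars false

namespace CahnHilliard

variable {n : ℕ}

lemma tendsto_inv_scale : Tendsto (fun t : ℝ => (scale t)⁻¹) (𝓝[>] 0) (𝓝 0) := by
  have h1 : Tendsto (fun t : ℝ => t ^ (1 / 4 : ℝ)) (𝓝[>] 0) (𝓝 0) := by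
    have := (Real.continuousAt_rpow_const 0 (1 / 4 : ℝ) (Or.inr (by norm_num))).tendsto
    rw [Real.zero_rpow (by norm_num)] at this
    exact this.mono_left nhdsWithin_le_nhds
  refine h1.congr' ?_
  filter_upwards [self_mem_nhdsWithin] with t ht
  rw [scale, Real.rpow_neg (le_of_lt ht), inv_inv]

/-- Rescaling moves `t` from the kernel into the argument of `f`; dominated convergence with the
fixed kernel at time one then applies. -/
lemma tendsto_conv_heatKer_zero (l : ℝ) {f : Strip n → ℝ} (hf : BC f) (x : Strip n) :
    Tendsto (fun t => conv (coverHom n) (fun y => heatKer n l 0 (t, y)) f x) (𝓝[>] 0)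
      (𝓝 (f x)) := by
  obtain ⟨hc, M, hM⟩ := hf
  have hsc := tendsto_inv_scale
  have hexp : Tendsto (fun t : ℝ => Real.exp (-(l * t))) (𝓝[>] 0) (𝓝 1) := by
    have : Tendsto (fun t : ℝ => Real.exp (-(l * t))) (𝓝 0) (𝓝 (Real.exp (-(l * 0)))) :=
      (by fun_prop : Continuous fun t : ℝ => Real.exp (-(l * t))).tendsto 0
    simp only [mul_zero, neg_zero, Real.exp_zero] at this
    exact this.mono_left nhdsWithin_le_nhds
  have h_int : Tendsto (fun t : ℝ => ∫ y, heat n 0 1 y * f (x - coverHom n ((scale t)⁻¹ • y)))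
      (𝓝[>] 0) (𝓝 (∫ y, heat n 0 1 y * f x)) := by
    refine tendsto_integral_filter_of_dominated_convergence (fun y => |heat n 0 1 y| * M) ?_ ?_
      ((heat n 0 1).integrable.abs.mul_const M) ?_
    · refine Eventually.of_forall fun t => Continuous.aestronglyMeasurable ?_
      have := continuous_coverHom (n := n)
      exact (heat n 0 1).continuous.mul (hc.comp (by fun_prop))
    · refine Eventually.of_forall fun t => Eventually.of_forall fun y => ?_
      rw [norm_mul, Real.norm_eq_abs, Real.norm_eq_abs]
      gcongr
      exact hM _
    · refine Eventually.of_forall fun y => Tendsto.const_mul _ ?_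
      have h1 : Tendsto (fun t : ℝ => x - coverHom n ((scale t)⁻¹ • y)) (𝓝[>] 0)
          (𝓝 (x - coverHom n ((0 : ℝ) • y))) :=
        tendsto_const_nhds.sub ((continuous_coverHom.tendsto _).comp (hsc.smul_const y))
      rw [zero_smul, map_zero, sub_zero] at h1
      exact (hc.tendsto x).comp h1
  rw [integral_mul_const, integral_heat one_pos, one_mul] at h_int
  have h := hexp.mul h_int
  rw [one_mul] at h
  refine h.congr' ?_
  filter_upwards [self_mem_nhdsWithin] with t ht
  have ht' : 0 < t := ht
  rw [conv]
  simp_rw [heatKer_of_pos l 0 ht', heat_eq_slice 0 ht', mul_assoc]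
  rw [integral_const_mul,
    integral_slice_comp _ _ (scale_pos ht') (fun y => f (x - coverHom n y))]
  simp

lemma hasDerivAt_heatKer_zero (l : ℝ) {t : ℝ} (ht : 0 < t) (y : Cover n) :
    HasDerivAt (fun t => heatKer n l 0 (t, y))
      (-(heatKer n l 2 (t, y) + l * heatKer n l 0 (t, y))) t := by
  have h1 : HasDerivAt (fun t => Real.exp (-(l * t)) * heat n 0 t y)
      (Real.exp (-(l * t)) * (-(l * 1)) * heat n 0 t y +
        Real.exp (-(l * t)) * (-heat n 2 t y)) t :=
    (((hasDerivAt_id t).const_mul l).neg.exp).mul (hasDerivAt_heat 0 ht y)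
  refine (h1.congr_of_eventuallyEq ?_).congr_deriv ?_
  · filter_upwards [lt_mem_nhds ht] with r hr
    exact heatKer_of_pos l 0 hr y
  · rw [heatKer_of_pos l _ ht, heatKer_of_pos l _ ht]
    ring

lemma continuousOn_heatKer (l : ℝ) (j : ℕ) (y : Cover n) :
    ContinuousOn (fun t => heatKer n l j (t, y)) (Ioi 0) := by
  have h : ContinuousOn (fun t => Real.exp (-(l * t)) * heat n j t y) (Ioi 0) := by
    refine ContinuousOn.mul (by fun_prop) fun t ht => ?_
    exact (hasDerivAt_heat j ht y).continuousAt.continuousWithinAt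
  exact h.congr fun t ht => heatKer_of_pos l j ht y

lemma conv_heatKer_two (l t : ℝ) {f : Strip n → ℝ} (hf : Reg axis BC 4 f) :
    conv (coverHom n) (fun y => heatKer n l 2 (t, y)) f =
      conv (coverHom n) (fun y => heatKer n l 0 (t, y)) (lap axis (lap axis f)) := by
  rcases lt_or_ge 0 t with ht | ht
  · have h1 : ∀ (j : ℕ) (g : Strip n → ℝ), conv (coverHom n) (fun y => heatKer n l j (t, y)) g =
        fun x => Real.exp (-(l * t)) * conv (coverHom n) (heat n j t) g x := by
      intro j g
      ext x
      simp only [conv, heatKer_of_pos l j ht, mul_assoc, integral_const_mul]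
    rw [h1, h1, conv_heat_succ 1 t (hf.mono (by norm_num)), conv_heat_succ 0 t
      (Reg.lap (fun _ _ => BC.add) BC.zero hf)]
  · ext x
    simp [conv, heatKer_of_nonpos l _ ht]

/-- The bi-Laplacian plus `l`. -/
def damped {X ι : Type*} [AddCommGroup X] [Fintype ι] (γ : ι → ℝ → X) (l : ℝ) (f : X → ℝ) :
    X → ℝ := lap γ (lap γ f) + (fun _ => l) * f

lemma BC_damped {X ι : Type*} [AddCommGroup X] [TopologicalSpace X] [Fintype ι] {γ : ι → ℝ → X}
    (l : ℝ) {f : X → ℝ} (hf : Reg γ BC 4 f) : BC (damped γ l f) :=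
  (Reg.lap (m := 0) (fun _ _ => BC.add) BC.zero
    (Reg.lap (fun _ _ => BC.add) BC.zero hf)).base.add ((BC.const l).mul hf.base)

lemma abs_conv_heatKer_le {l : ℝ} (hl : 0 ≤ l) {f : Strip n → ℝ} {M : ℝ} (hM : ∀ x, |f x| ≤ M)
    (t : ℝ) (x : Strip n) :
    |conv (coverHom n) (fun y => heatKer n l 0 (t, y)) f x| ≤ heatMass n 0 * M := by
  refine (abs_conv_le hM (integrable_heatKer_slice l 0 t) x).trans ?_
  have := (abs_nonneg _).trans (hM x)
  gcongr
  exact integral_abs_heatKer_zero_le hl t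

lemma intervalIntegrable_conv_heatKer {l : ℝ} (hl : 0 ≤ l) {f : Strip n → ℝ} (hf : BC f)
    (x : Strip n) (a b : ℝ) :
    IntervalIntegrable (fun r => conv (coverHom n) (fun y => heatKer n l 0 (r, y)) f x)
      volume a b := by
  obtain ⟨M, hM⟩ := hf.bddMeas
  have hmeas : Measurable fun r => conv (coverHom n) (fun y => heatKer n l 0 (r, y)) f x :=
    (measurable_conv_param (measurable_heatKer l 0) (hM.meas.comp measurable_snd)).comp
      (measurable_id.prodMk measurable_const)
  have h : IntervalIntegrable (fun _ : ℝ => heatMass n 0 * M) volume a b :=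
    intervalIntegrable_const
  refine h.mono_fun hmeas.aestronglyMeasurable (Eventually.of_forall fun r => ?_)
  rw [Real.norm_eq_abs]
  exact (abs_conv_heatKer_le hl hM.bdd r x).trans (le_abs_self _)

/-- The kernel's equation `∂_t = -(Δ² + l)` is integrated over `[a, b]`, and the operator is then
moved to `f`. The start `a > 0` is needed because `Δ²K_t` has mass of order `1 / t`, not integrable
at zero. -/
lemma conv_heatKer_sub {l : ℝ} (hl : 0 ≤ l) {f : Strip n → ℝ} (hf : Reg axis BC 4 f) (x : Strip n)
    {a b : ℝ} (ha : 0 < a) (hab : a ≤ b) :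
    conv (coverHom n) (fun y => heatKer n l 0 (b, y)) f x -
      conv (coverHom n) (fun y => heatKer n l 0 (a, y)) f x =
    -∫ r in a..b, conv (coverHom n) (fun y => heatKer n l 0 (r, y)) (damped axis l f) x := by
  obtain ⟨M, hM⟩ := hf.base.bddMeas
  have hLL : BC (lap axis (lap axis f)) := (Reg.lap (m := 0) (fun _ _ => BC.add) BC.zero
    (Reg.lap (fun _ _ => BC.add) BC.zero hf)).base
  obtain ⟨M', hM'⟩ := hLL.bddMeas
  have hd : ∀ r, conv (coverHom n) (fun y => heatKer n l 0 (r, y)) (damped axis l f) x =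
      conv (coverHom n) (fun y => heatKer n l 2 (r, y) + l * heatKer n l 0 (r, y)) f x := by
    intro r
    have hI0 := integrable_heatKer_slice (n := n) l 0 r
    have hI2 := integrable_heatKer_slice (n := n) l 2 r
    have e1 : conv (coverHom n) (fun y => heatKer n l 0 (r, y)) (damped axis l f) x =
        conv (coverHom n) (fun y => heatKer n l 0 (r, y)) (lap axis (lap axis f)) x +
          l * conv (coverHom n) (fun y => heatKer n l 0 (r, y)) f x := by
      simp only [conv]
      rw [← integral_const_mul, ← integral_add (integrable_conv continuous_coverHom hI0 hM' x)
        ((integrable_conv continuous_coverHom hI0 hM x).const_mul l)]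
      congr 1
      ext y
      simp only [damped, Pi.add_apply, Pi.mul_apply]
      ring
    have e2 : conv (coverHom n) (fun y => heatKer n l 2 (r, y) + l * heatKer n l 0 (r, y)) f x =
        conv (coverHom n) (fun y => heatKer n l 2 (r, y)) f x +
          l * conv (coverHom n) (fun y => heatKer n l 0 (r, y)) f x := by
      simp only [conv]
      rw [← integral_const_mul, ← integral_add (integrable_conv continuous_coverHom hI2 hM x)
        ((integrable_conv continuous_coverHom hI0 hM x).const_mul l)]
      congr 1
      ext y
      ring
    rw [e1, e2, conv_heatKer_two l r hf]
  simp_rw [hd]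
  rw [conv_sub_kernel continuous_coverHom (integrable_heatKer_slice l 0 b)
    (integrable_heatKer_slice l 0 a) hM]
  have hft : ∀ y, heatKer n l 0 (b, y) - heatKer n l 0 (a, y) =
      ∫ r in a..b, -(heatKer n l 2 (r, y) + l * heatKer n l 0 (r, y)) := by
    intro y
    have hsub : uIcc a b ⊆ Ioi 0 := by
      rw [uIcc_of_le hab]
      exact fun r hr => ha.trans_le hr.1
    rw [intervalIntegral.integral_eq_sub_of_hasDerivAt
      (fun r hr => hasDerivAt_heatKer_zero l (hsub hr) y)]
    refine ContinuousOn.intervalIntegrable (ContinuousOn.mono ?_ hsub)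
    exact ((continuousOn_heatKer l 2 y).add
      (continuousOn_const.mul (continuousOn_heatKer l 0 y))).neg
  simp_rw [hft]
  rw [← intervalIntegral.integral_neg]
  simp only [conv]
  have hmeasK : Measurable fun p : ℝ × Cover n =>
      heatKer n l 2 (p.1, p.2) + l * heatKer n l 0 (p.1, p.2) :=
    (measurable_heatKer l 2).add ((measurable_heatKer l 0).const_mul l)
  have hsw := intervalIntegral_integral_swap (μ := (volume : Measure (Cover n))) (a := a) (b := b)
    (f := fun r y => -(heatKer n l 2 (r, y) + l * heatKer n l 0 (r, y)) * f (x - coverHom n y)) ?_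
  · simp_rw [intervalIntegral.integral_mul_const] at hsw
    rw [← hsw]
    congr 1
    ext r
    rw [← integral_neg]
    congr 1
    ext y
    ring
  · have hsm : Measurable fun p : ℝ × Cover n =>
        -(heatKer n l 2 (p.1, p.2) + l * heatKer n l 0 (p.1, p.2)) * f (x - coverHom n p.2) :=
      hmeasK.neg.mul ((measurable_comp_sub continuous_coverHom hM.meas x).comp measurable_snd)
    have hI : ∀ r, Integrable fun y => -(heatKer n l 2 (r, y) + l * heatKer n l 0 (r, y)) :=
      fun r => ((integrable_heatKer_slice l 2 r).add
        ((integrable_heatKer_slice l 0 r).const_mul l)).neg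
    rw [Function.uncurry_def, integrable_prod_iff hsm.aestronglyMeasurable]
    refine ⟨Eventually.of_forall fun r => integrable_conv continuous_coverHom (hI r) hM x, ?_⟩
    have : IsFiniteMeasure (volume.restrict (uIoc a b)) := by
      rw [uIoc]
      infer_instance
    have hM0 : 0 ≤ M := hM.nonneg x
    refine Integrable.of_bound (C := (a⁻¹ * heatMass n 2 + l * heatMass n 0) * M)
      hsm.norm.stronglyMeasurable.integral_prod_right.aestronglyMeasurable ?_
    refine ae_restrict_of_forall_mem measurableSet_uIoc fun r hr => ?_
    rw [uIoc_of_le hab] at hr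
    have hr0 : 0 < r := ha.trans hr.1
    rw [Real.norm_of_nonneg (integral_nonneg fun _ => norm_nonneg _)]
    have h2 : ∫ y, |heatKer n l 2 (r, y)| ≤ a⁻¹ * heatMass n 2 := by
      rw [integral_abs_heatKer_slice l 2 hr0]
      have e1 : r ^ (-((2 : ℕ) / 2) : ℝ) ≤ a⁻¹ := by
        have : (-((2 : ℕ) / 2) : ℝ) = -1 := by norm_num
        rw [this, Real.rpow_neg_one]
        exact inv_anti₀ ha hr.1.le
      have e2 : Real.exp (-(l * r)) ≤ 1 := Real.exp_le_one_iff.2 (by nlinarith)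
      have := heatMass_nonneg n 2
      have e3 : r ^ (-((2 : ℕ) / 2) : ℝ) * Real.exp (-(l * r)) ≤ a⁻¹ * 1 :=
        mul_le_mul e1 e2 (Real.exp_nonneg _) (by positivity)
      rw [mul_one] at e3
      gcongr
    have h0 := integral_abs_heatKer_zero_le (n := n) hl r
    calc _ ≤ ∫ y, (|heatKer n l 2 (r, y)| + l * |heatKer n l 0 (r, y)|) * M := by
          refine integral_mono_of_nonneg (Eventually.of_forall fun _ => norm_nonneg _)
            (((integrable_heatKer_slice l 2 r).abs.add
              ((integrable_heatKer_slice l 0 r).abs.const_mul l)).mul_const M)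
            (Eventually.of_forall fun y => ?_)
          simp only [norm_mul, norm_neg, Real.norm_eq_abs]
          gcongr
          · refine (abs_add_le _ _).trans (le_of_eq ?_)
            rw [abs_mul, abs_of_nonneg hl]
          · exact hM.bdd _
      _ = ((∫ y, |heatKer n l 2 (r, y)|) + l * ∫ y, |heatKer n l 0 (r, y)|) * M := by
          rw [integral_mul_const, integral_add (integrable_heatKer_slice l 2 r).abs
            ((integrable_heatKer_slice l 0 r).abs.const_mul l), integral_const_mul]
      _ ≤ _ := by gcongr

/-- The limit `a → 0` of `conv_heatKer_sub`: with the operator acting on `f`, the integrand is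
bounded down to time zero. -/
lemma conv_heatKer_eq {l : ℝ} (hl : 0 ≤ l) {f : Strip n → ℝ} (hf : Reg axis BC 4 f) (x : Strip n)
    {t : ℝ} (ht : 0 < t) :
    conv (coverHom n) (fun y => heatKer n l 0 (t, y)) f x = f x -
      ∫ r in 0..t, conv (coverHom n) (fun y => heatKer n l 0 (r, y)) (damped axis l f) x := by
  set ψ : ℝ → ℝ := fun r =>
    conv (coverHom n) (fun y => heatKer n l 0 (r, y)) (damped axis l f) x with hψ
  have h_int := fun a b => intervalIntegrable_conv_heatKer hl (BC_damped l hf) x a b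
  have h1 : Tendsto (fun a => ∫ r in a..t, ψ r) (𝓝[>] 0) (𝓝 (∫ r in 0..t, ψ r)) := by
    have hc : Continuous fun a => ∫ r in t..a, ψ r :=
      intervalIntegral.continuous_primitive h_int t
    have h2 := (hc.tendsto 0).neg
    simp only [← intervalIntegral.integral_symm] at h2
    exact h2.mono_left nhdsWithin_le_nhds
  have h2 := (tendsto_conv_heatKer_zero l hf.base x).sub h1
  refine tendsto_nhds_unique (tendsto_const_nhds.congr' ?_) h2
  filter_upwards [Ioc_mem_nhdsGT ht] with a ha
  have := conv_heatKer_sub hl hf x ha.1 ha.2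
  linarith

lemma pd_timeAxis (i : Option (Fin n)) (f : ℝ × Strip n → ℝ) (t : ℝ) :
    (fun x => pd timeAxis i f (t, x)) = pd axis i fun x => f (t, x) := by
  ext x
  simp [pd, timeAxis]

lemma lap_timeAxis (f : ℝ × Strip n → ℝ) (t : ℝ) :
    (fun x => lap timeAxis f (t, x)) = lap axis fun x => f (t, x) := by
  ext x
  simp only [lap, Finset.sum_apply]
  refine Finset.sum_congr rfl fun i _ => ?_
  rw [← pd_timeAxis i f t, ← pd_timeAxis]

lemma Reg.slice {P : (ℝ × Strip n → ℝ) → Prop} {Q : (Strip n → ℝ) → Prop} {t : ℝ}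
    (hPQ : ∀ f, P f → Q fun x => f (t, x)) {m : ℕ} {f : ℝ × Strip n → ℝ}
    (hf : Reg timeAxis P m f) : Reg axis Q m fun x => f (t, x) := by
  induction m generalizing f with
  | zero => exact hPQ _ hf
  | succ m ih =>
    refine Reg.succ_intro (hPQ _ hf.1) (f' := fun i x => CahnHilliard.pd timeAxis i f (t, x)) (fun i x => ?_)
      fun i => ih (hf.pd i)
    simpa [timeAxis] using hf.hasDir i (t, x)

lemma BC.slice {f : ℝ × Strip n → ℝ} (hf : BC f) (t : ℝ) : BC fun x => f (t, x) :=
  ⟨hf.1.comp (by fun_prop), hf.2.imp fun _ h x => h (t, x)⟩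

lemma damped_timeAxis (l : ℝ) (f : ℝ × Strip n → ℝ) (t : ℝ) :
    (fun x => damped timeAxis l f (t, x)) = damped axis l fun x => f (t, x) := by
  ext x
  simp only [damped, Pi.add_apply, Pi.mul_apply]
  rw [← lap_timeAxis f t, ← lap_timeAxis]

lemma damped_zero {X ι : Type*} [AddCommGroup X] [Fintype ι] (γ : ι → ℝ → X) (l : ℝ) :
    damped γ l (fun _ => 0) = 0 := by
  have h : ∀ i, pd γ i (fun _ => (0 : ℝ)) = fun _ => 0 := fun i => (hasDir_const (γ i) 0).pd_eq
  have h2 : lap γ (fun _ => (0 : ℝ)) = fun _ => 0 := by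
    ext x
    simp [lap, h]
  ext x
  simp [damped, h2]

lemma damped_of_nonpos {l : ℝ} {G : ℝ × Strip n → ℝ} (h0 : ∀ t ≤ 0, ∀ x, G (t, x) = 0) {t : ℝ}
    (ht : t ≤ 0) (x : Strip n) : damped timeAxis l G (t, x) = 0 := by
  have h1 := congrFun (damped_timeAxis l G t) x
  have h2 : (fun x => G (t, x)) = fun _ => 0 := funext fun x => h0 t ht x
  rw [h2, damped_zero] at h1
  exact h1

lemma conv_heatKer_of_nonpos {l : ℝ} {j : ℕ} {G : ℝ × Strip n → ℝ}
    (h0 : ∀ t ≤ 0, ∀ x, G (t, x) = 0) {t : ℝ} (ht : t ≤ 0) (x : Strip n) :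
    conv (timeCoverHom n) (heatKer n l j) G (t, x) = 0 := by
  rw [conv]
  refine integral_eq_zero_of_ae (Eventually.of_forall fun q => ?_)
  obtain ⟨s, y⟩ := q
  simp only [timeCoverHom_apply, Prod.mk_sub_mk, Pi.zero_apply]
  rcases lt_or_ge 0 s with hs | hs
  · rw [h0 _ (by linarith), mul_zero]
  · rw [heatKer_of_nonpos l j hs, zero_mul]

lemma integrable_of_square {F : ℝ × ℝ → ℝ} (hF : Measurable F) {B t : ℝ} (hB : ∀ p, |F p| ≤ B)
    (h0 : ∀ p, p ∉ Icc 0 t ×ˢ Icc 0 t → F p = 0) : Integrable F := by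
  have hs : MeasurableSet (Icc 0 t ×ˢ Icc 0 t) := measurableSet_Icc.prod measurableSet_Icc
  rw [← integrableOn_iff_integrable_of_support_subset (s := Icc 0 t ×ˢ Icc 0 t)]
  · refine IntegrableOn.of_bound ?_ hF.aestronglyMeasurable B (Eventually.of_forall hB)
    exact (isCompact_Icc.prod isCompact_Icc).measure_lt_top
  · intro p hp
    by_contra h
    exact hp (h0 p h)

/-- A forced evolution with regular forcing solves the integrated equation. -/
lemma conv_heatKer_zero_eq_integral {l : ℝ} (hl : 0 < l) {G : ℝ × Strip n → ℝ}
    (hG : Reg timeAxis BC 4 G) (h0 : ∀ t ≤ 0, ∀ x, G (t, x) = 0) (t : ℝ) (x : Strip n) :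
    conv (timeCoverHom n) (heatKer n l 0) G (t, x) =
      ∫ s in 0..t, (G (s, x) -
        conv (timeCoverHom n) (heatKer n l 0) (damped timeAxis l G) (s, x)) := by
  set Q := damped timeAxis l G with hQdef
  have hQ : BC Q := BC_damped l hG
  have hQ0 : ∀ t ≤ 0, ∀ x, Q (t, x) = 0 := fun t ht x => damped_of_nonpos h0 ht x
  obtain ⟨M, hM⟩ := hG.base.bddMeas
  obtain ⟨M', hM'⟩ := hQ.bddMeas
  have hk := integrable_heatKer (n := n) hl zero_le_one
  rcases le_or_gt t 0 with ht | ht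
  · rw [conv_heatKer_of_nonpos h0 ht, intervalIntegral.integral_congr (g := fun _ => 0)]
    · simp
    · intro s hs
      rw [uIcc_of_ge ht] at hs
      simp only
      rw [h0 s hs.2, conv_heatKer_of_nonpos hQ0 hs.2, sub_zero]
  -- `Ψ r σ` is the kernel at age `r` applied to the forcing `Q` of time `σ`. The contributions of
  -- `Q` to both sides are its integral over the triangle `r, σ > 0`, `r + σ < t`, which `F`
  -- encodes.
  set Ψ : ℝ → ℝ → ℝ := fun r σ =>
    conv (coverHom n) (fun y => heatKer n l 0 (r, y)) (fun x => Q (σ, x)) x with hΨ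
  have hΨ1 : ∀ r ≤ 0, ∀ σ, Ψ r σ = 0 := fun r hr σ => by
    simp [hΨ, conv, heatKer_of_nonpos l 0 hr]
  have hΨ2 : ∀ r, ∀ σ ≤ 0, Ψ r σ = 0 := fun r σ hσ => by
    simp [hΨ, conv, hQ0 σ hσ]
  have hΨb : ∀ r σ, |Ψ r σ| ≤ heatMass n 0 * M' := fun r σ =>
    abs_conv_heatKer_le hl.le (fun x => hM'.bdd (σ, x)) r x
  have hΨm : Measurable fun p : ℝ × ℝ => Ψ p.1 p.2 := by
    have h1 := measurable_conv_param (Z := ℝ × ℝ) (n := n)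
      (k := fun z => heatKer n l 0 (z.1.1, z.2)) (F := fun z => Q (z.1.2, z.2))
      ((measurable_heatKer l 0).comp (by fun_prop)) (hM'.meas.comp (by fun_prop))
    exact h1.comp (measurable_id.prodMk measurable_const)
  set F : ℝ × ℝ → ℝ := fun p => if p.1 + p.2 < t then Ψ p.1 p.2 else 0 with hF
  have hFm : Measurable F :=
    Measurable.ite (measurableSet_lt (by fun_prop) measurable_const) hΨm measurable_const
  have hFb : ∀ p, |F p| ≤ heatMass n 0 * M' := by
    intro p
    simp only [hF]
    split_ifs
    · exact hΨb _ _
    · rw [abs_zero]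
      exact (abs_nonneg _).trans (hΨb 0 0)
  have hF0 : ∀ r σ, (r ≤ 0 ∨ σ ≤ 0 ∨ t ≤ r + σ) → F (r, σ) = 0 := by
    intro r σ h
    simp only [hF]
    split_ifs with h1
    · rcases h with h | h | h
      · exact hΨ1 r h σ
      · exact hΨ2 r σ h
      · exact absurd h1 (not_lt.2 h)
    · rfl
  have hFI : Integrable F := by
    refine integrable_of_square (t := t) hFm hFb fun p hp => hF0 p.1 p.2 ?_
    by_contra hcon
    push Not at hcon
    exact hp ⟨⟨hcon.1.le, by linarith⟩, ⟨hcon.2.1.le, by linarith⟩⟩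
  have hFI' : Integrable fun p : ℝ × ℝ => F (p.2, p.1 - p.2) := by
    refine integrable_of_square (t := t) (hFm.comp (by fun_prop)) (fun p => hFb _)
      fun p hp => hF0 _ _ ?_
    by_contra hcon
    push Not at hcon
    exact hp ⟨⟨by linarith, by linarith⟩, ⟨hcon.1.le, by linarith⟩⟩
  have hGc : Continuous fun s => G (s, x) := hG.base.1.comp (by fun_prop)
  have hconvc : Continuous fun s => conv (timeCoverHom n) (heatKer n l 0) Q (s, x) :=
    (continuous_conv isOpenQuotientMap_timeCoverHom hk hM').comp (by fun_prop)
  -- Here the triangle is sliced along `r + σ = ρ`.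
  have hR : ∫ s in 0..t, conv (timeCoverHom n) (heatKer n l 0) Q (s, x) =
      ∫ r, ∫ σ, F (r, σ) := by
    have h1 : ∀ ρ, (Ioo 0 t).indicator
        (fun s => conv (timeCoverHom n) (heatKer n l 0) Q (s, x)) ρ = ∫ r, F (r, ρ - r) := by
      intro ρ
      by_cases hρ : ρ ∈ Ioo 0 t
      · rw [indicator_of_mem hρ, conv_time_eq hk hM']
        congr 1
        ext r
        simp only [hF]
        rw [if_pos (by linarith [hρ.2])]
      · rw [indicator_of_notMem hρ, eq_comm]
        refine integral_eq_zero_of_ae (Eventually.of_forall fun r => hF0 _ _ ?_)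
        by_contra hcon
        push Not at hcon
        exact hρ ⟨by linarith, by linarith⟩
    rw [intervalIntegral.integral_of_le ht.le, integral_Ioc_eq_integral_Ioo,
      ← integral_indicator measurableSet_Ioo]
    simp_rw [h1]
    rw [integral_integral_swap hFI']
    congr 1
    ext r
    exact integral_sub_right_eq_self (fun σ => F (r, σ)) r
  -- Here it is sliced along `σ = t - s`, after `conv_heatKer_eq` is applied to each time slice of
  -- `G`.
  have hL : conv (timeCoverHom n) (heatKer n l 0) G (t, x) =
      ∫ s, ((Ioo 0 t).indicator (fun s => G (t - s, x)) s - ∫ r, F (r, t - s)) := by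
    rw [conv_time_eq hk hM]
    congr 1
    ext s
    by_cases hs : s ∈ Ioo 0 t
    · rw [indicator_of_mem hs, conv_heatKer_eq hl.le
        (hG.slice (Q := BC) fun f hf => hf.slice (t - s)) x hs.1, ← damped_timeAxis]
      congr 1
      rw [intervalIntegral.integral_of_le hs.1.le, integral_Ioc_eq_integral_Ioo,
        ← integral_indicator measurableSet_Ioo]
      congr 1
      ext r
      by_cases hr : r ∈ Ioo 0 s
      · rw [indicator_of_mem hr]
        simp only [hF]
        rw [if_pos (by linarith [hr.2])]
      · rw [indicator_of_notMem hr, hF0]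
        by_contra hcon
        push Not at hcon
        exact hr ⟨hcon.1, by linarith⟩
    · rw [indicator_of_notMem hs, zero_sub]
      have h2 : ∫ r, F (r, t - s) = 0 := by
        refine integral_eq_zero_of_ae (Eventually.of_forall fun r => hF0 _ _ ?_)
        by_contra hcon
        push Not at hcon
        exact hs ⟨by linarith, by linarith⟩
      rw [h2, neg_zero]
      rcases not_and_or.1 hs with h | h
      · simp [conv, heatKer_of_nonpos l 0 (not_lt.1 h)]
      · simp [conv, h0 (t - s) (by linarith)]
  have hGint : Integrable ((Ioo 0 t).indicator fun s => G (t - s, x)) := by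
    rw [integrable_indicator_iff measurableSet_Ioo]
    exact ((hGc.comp (by fun_prop : Continuous fun s => t - s)).integrableOn_Icc
      (a := 0) (b := t)).mono_set Ioo_subset_Icc_self
  have hFint : Integrable fun σ => ∫ r, F (r, σ) := hFI.integral_prod_right
  rw [hL, integral_sub hGint (hFint.comp_sub_left t),
    integral_sub_left_eq_self (fun σ => ∫ r, F (r, σ)),
    intervalIntegral.integral_sub (hGc.intervalIntegrable _ _) (hconvc.intervalIntegrable _ _), hR,
    integral_indicator measurableSet_Ioo, ← integral_Ioc_eq_integral_Ioo,
    ← intervalIntegral.integral_of_le ht.le,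
    intervalIntegral.integral_comp_sub_left (fun s => G (s, x)), sub_self, sub_zero,
    integral_integral_swap (f := fun r σ => F (r, σ)) hFI]

/-- The displacement in time. -/
def timeShift (n : ℕ) (s : ℝ) : ℝ × Strip n := (s, 0)

/-- A forced evolution with regular forcing solves the equation. -/
lemma hasDir_time_conv_heatKer {l : ℝ} (hl : 0 < l) {G : ℝ × Strip n → ℝ}
    (hG : Reg timeAxis BC 4 G) (h0 : ∀ t ≤ 0, ∀ x, G (t, x) = 0) :
    HasDir (timeShift n) (conv (timeCoverHom n) (heatKer n l 0) G)
      (G - conv (timeCoverHom n) (heatKer n l 0) (damped timeAxis l G)) := by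
  rintro ⟨t, x⟩
  obtain ⟨M', hM'⟩ := (BC_damped l hG).bddMeas
  have hc : Continuous fun s => G (s, x) -
      conv (timeCoverHom n) (heatKer n l 0) (damped timeAxis l G) (s, x) := by
    refine (hG.base.1.comp (by fun_prop)).sub ?_
    exact (continuous_conv isOpenQuotientMap_timeCoverHom (integrable_heatKer hl zero_le_one)
      hM').comp (by fun_prop)
  have h1 := intervalIntegral.integral_hasDerivAt_right (hc.intervalIntegrable 0 t)
    (hc.stronglyMeasurableAtFilter _ _) hc.continuousAt
  have h2 : HasDerivAt (fun s => ∫ r in 0..s, (G (r, x) -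
      conv (timeCoverHom n) (heatKer n l 0) (damped timeAxis l G) (r, x))) (G (t, x) -
      conv (timeCoverHom n) (heatKer n l 0) (damped timeAxis l G) (t, x)) (t + 0) := by
    rwa [add_zero]
  refine (h2.comp_const_add t 0).congr_of_eventuallyEq (Eventually.of_forall fun s => ?_)
  simp only [timeShift, Prod.mk_add_mk, add_zero]
  exact conv_heatKer_zero_eq_integral hl hG h0 (t + s) x

end CahnHilliard

end

/-! ### Bounds in `L²`, the gain of a derivative, and joint differentiability -/

noncomputable section

set_option linter.unusedSectionVars false

namespace CahnHilliard
open SchwartzMap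
open scoped SchwartzMap LineDeriv

variable {n : ℕ}

/-- The time slices of `f` are bounded in `L²`. -/
def L2Bdd (f : ℝ × Strip n → ℝ) : Prop :=
  ∃ C : ℝ≥0∞, C ≠ ⊤ ∧ ∀ t, eLpNorm (fun x => f (t, x)) 2 volume ≤ C

/-- Bounded continuous functions with time slices bounded in `L²`. -/
def BL (f : ℝ × Strip n → ℝ) : Prop := BC f ∧ L2Bdd f

lemma L2Bdd.add {f g : ℝ × Strip n → ℝ} (hfm : Measurable f) (hgm : Measurable g) (hf : L2Bdd f)
    (hg : L2Bdd g) : L2Bdd (f + g) := by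
  obtain ⟨C, hC, hf⟩ := hf
  obtain ⟨D, hD, hg⟩ := hg
  refine ⟨C + D, ENNReal.add_ne_top.2 ⟨hC, hD⟩, fun t => ?_⟩
  refine (eLpNorm_add_le (f := fun x => f (t, x)) (g := fun x => g (t, x)) ?_ ?_
    (by norm_num)).trans (add_le_add (hf t) (hg t))
  · exact (hfm.comp measurable_prodMk_left).aestronglyMeasurable
  · exact (hgm.comp measurable_prodMk_left).aestronglyMeasurable

lemma BL.add {f g : ℝ × Strip n → ℝ} (hf : BL f) (hg : BL g) : BL (f + g) :=
  ⟨hf.1.add hg.1, hf.2.add hf.1.1.measurable hg.1.1.measurable hg.2⟩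

lemma L2Bdd.bdd_mul {f g : ℝ × Strip n → ℝ} {M : ℝ} (hf : ∀ q, |f q| ≤ M) (hg : L2Bdd g) :
    L2Bdd (f * g) := by
  obtain ⟨C, hC, hg⟩ := hg
  refine ⟨ENNReal.ofReal M * C, ENNReal.mul_ne_top ENNReal.ofReal_ne_top hC, fun t => ?_⟩
  refine (eLpNorm_le_mul_eLpNorm_of_ae_le_mul (c := M) (g := fun x => g (t, x))
    (Eventually.of_forall fun x => ?_) 2).trans (by gcongr; exact hg t)
  rw [Pi.mul_apply, norm_mul]
  gcongr
  exact hf _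

lemma BC.mul_BL {f g : ℝ × Strip n → ℝ} (hf : BC f) (hg : BL g) : BL (f * g) :=
  ⟨hf.mul hg.1, L2Bdd.bdd_mul hf.2.choose_spec hg.2⟩

lemma eLpNorm_conv_time_le {k : ℝ × Cover n → ℝ} (hk : Integrable k) {f : ℝ × Strip n → ℝ}
    (hf : Measurable f) {C : ℝ≥0∞} (hC : ∀ t, eLpNorm (fun x => f (t, x)) 2 volume ≤ C) (t : ℝ) :
    eLpNorm (fun x => conv (timeCoverHom n) k f (t, x)) 2 volume ≤
      ENNReal.ofReal (∫ q, |k q|) * C := by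
  have hm := (isOpenQuotientMap_timeCoverHom (n := n)).continuous.measurable
  refine eLpNorm_integral_le (F := fun q x => f ((t, x) - timeCoverHom n q)) hk ?_ fun q => ?_
  · refine hf.comp ?_
    have : Measurable fun p : (ℝ × Cover n) × Strip n => (t, p.2) := by fun_prop
    exact this.sub (hm.comp measurable_fst)
  · have h := eLpNorm_comp_measurePreserving (p := 2) (g := fun x => f (t - q.1, x))
      (f := fun x => x - coverHom n q.2) (hf.comp measurable_prodMk_left).aestronglyMeasurable
      (measurePreserving_sub_right (volume : Measure (Strip n)) (coverHom n q.2))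
    exact h.trans_le (hC _)

lemma eLpNorm_conv_le {k : Cover n → ℝ} (hk : Integrable k) {f : Strip n → ℝ}
    (hf : Measurable f) :
    eLpNorm (conv (coverHom n) k f) 2 volume ≤
      ENNReal.ofReal (∫ q, |k q|) * eLpNorm f 2 volume := by
  have hm := continuous_coverHom (n := n) |>.measurable
  refine eLpNorm_integral_le (F := fun q x => f (x - coverHom n q)) hk ?_ fun q => ?_
  · exact hf.comp (measurable_snd.sub (hm.comp measurable_fst))
  · have h := eLpNorm_comp_measurePreserving (p := 2) (g := f)
      (f := fun x => x - coverHom n q) hf.aestronglyMeasurable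
      (measurePreserving_sub_right (volume : Measure (Strip n)) (coverHom n q))
    exact h.le

lemma BL_conv {k : ℝ × Cover n → ℝ} (hk : Integrable k) {f : ℝ × Strip n → ℝ} {M : ℝ}
    (hf : BddMeas f M) (h2 : L2Bdd f) : BL (conv (timeCoverHom n) k f) := by
  refine ⟨⟨continuous_conv isOpenQuotientMap_timeCoverHom hk hf, _,
    fun x => abs_conv_le hf.bdd hk x⟩, ?_⟩
  obtain ⟨C, hC, h2⟩ := h2
  exact ⟨_, ENNReal.mul_ne_top ENNReal.ofReal_ne_top hC,
    fun t => eLpNorm_conv_time_le hk hf.meas h2 t⟩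

lemma hasDir_conv_ker {l : ℝ} (hl : 0 < l) {k : ℕ} (hk : k + 1 ≤ 3) (p : 𝓢(Cover n, ℝ))
    (i : Option (Fin n)) {f : ℝ × Strip n → ℝ} {M : ℝ} (hf : BddMeas f M) :
    HasDir (timeAxis i) (conv (timeCoverHom n) (ker l k p) f)
      (conv (timeCoverHom n) (ker l (k + 1) (∂_{coverBasis i} p)) f) := by
  rw [timeAxis_eq]
  exact hasDir_conv_kernel isOpenQuotientMap_timeCoverHom (e := timeBasis i)
    (integrable_ker hl (by omega) p) (integrable_ker hl hk _) (hasDir_ker l k p i)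
    (continuous_ker_line l _ _ i) (measurable_ker _ _ _) hf

lemma hasDir_conv_time {k : ℝ × Cover n → ℝ} (hk : Integrable k) {P : (ℝ × Strip n → ℝ) → Prop}
    (hP : ∀ f, P f → BC f) {m : ℕ} {f : ℝ × Strip n → ℝ} (hf : Reg timeAxis P (m + 1) f)
    (i : Option (Fin n)) : HasDir (timeAxis i) (conv (timeCoverHom n) k f)
      (conv (timeCoverHom n) k (pd timeAxis i f)) := by
  obtain ⟨M, hM⟩ := (hP _ hf.base).bddMeas
  obtain ⟨M', hM'⟩ := (hP _ (hf.pd i).base).bddMeas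
  exact hasDir_conv_right isOpenQuotientMap_timeCoverHom.continuous (isOneParam_timeAxis i) hk
    hM hM' (hf.hasDir i)

/-- Convolution with a space-time kernel gains one derivative. -/
lemma Reg_conv_ker_one {l : ℝ} (hl : 0 < l) {k : ℕ} (hk : k + 1 ≤ 3) (p : 𝓢(Cover n, ℝ))
    {f : ℝ × Strip n → ℝ} {M : ℝ} (hf : BddMeas f M) (h2 : L2Bdd f) :
    Reg timeAxis BL 1 (conv (timeCoverHom n) (ker l k p) f) :=
  Reg.succ_intro (BL_conv (integrable_ker hl (by omega) p) hf h2)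
    (fun i => hasDir_conv_ker hl hk p i hf) fun _ => BL_conv (integrable_ker hl hk _) hf h2

/-- All available derivatives fall on `f`, and the one extra derivative falls on the kernel. -/
lemma Reg_conv_ker {l : ℝ} (hl : 0 < l) {k : ℕ} (hk : k + 1 ≤ 3) (p : 𝓢(Cover n, ℝ)) {m : ℕ}
    {f : ℝ × Strip n → ℝ} (hf : Reg timeAxis BL m f) :
    Reg timeAxis BL (m + 1) (conv (timeCoverHom n) (ker l k p) f) := by
  induction m generalizing f with
  | zero =>
    obtain ⟨M, hM⟩ := hf.base.1.bddMeas
    exact Reg_conv_ker_one hl hk p hM hf.base.2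
  | succ m ih =>
    obtain ⟨M, hM⟩ := hf.base.1.bddMeas
    exact Reg.succ_intro (BL_conv (integrable_ker hl (by omega) p) hM hf.base.2)
      (fun i => hasDir_conv_time (integrable_ker hl (by omega) p) (fun _ h => h.1) hf i)
      fun i => ih (hf.pd i)

lemma pd_conv {k : ℝ × Cover n → ℝ} (hk : Integrable k) {m : ℕ} {f : ℝ × Strip n → ℝ}
    (hf : Reg timeAxis BC (m + 1) f) (i : Option (Fin n)) :
    pd timeAxis i (conv (timeCoverHom n) k f) = conv (timeCoverHom n) k (pd timeAxis i f) :=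
  (hasDir_conv_time hk (fun _ h => h) hf i).pd_eq

lemma lap_conv {k : ℝ × Cover n → ℝ} (hk : Integrable k) {f : ℝ × Strip n → ℝ}
    (hf : Reg timeAxis BC 2 f) :
    lap timeAxis (conv (timeCoverHom n) k f) = conv (timeCoverHom n) k (lap timeAxis f) := by
  ext q
  rw [lap, lap, conv_finset_sum_right isOpenQuotientMap_timeCoverHom.continuous _ hk
    fun i _ => ((hf.pd i).pd i).base.bddMeas, Finset.sum_apply]
  refine Finset.sum_congr rfl fun i _ => ?_
  rw [pd_conv hk hf, pd_conv hk (hf.pd i)]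

lemma conv_add_fun {V X : Type*} [NormedAddCommGroup V] [NormedSpace ℝ V]
    [MeasureSpace V] [BorelSpace V] [FiniteDimensional ℝ V] [(volume : Measure V).IsAddHaarMeasure]
    [AddCommGroup X] [TopologicalSpace X] [IsTopologicalAddGroup X] [MeasurableSpace X]
    [BorelSpace X] [SecondCountableTopology X] {π : V →+ X} (hπ : Continuous π)
    {k : V → ℝ} (hk : Integrable k) {f g : X → ℝ} {M M' : ℝ}
    (hf : BddMeas f M) (hg : BddMeas g M') :
    conv π k (f + g) = conv π k f + conv π k g := by
  ext x
  rw [Pi.add_apply, conv, conv, conv,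
    ← integral_add (integrable_conv hπ hk hf x) (integrable_conv hπ hk hg x)]
  congr 1
  ext y
  rw [Pi.add_apply]
  ring

lemma damped_conv {k : ℝ × Cover n → ℝ} (hk : Integrable k) (l : ℝ) {f : ℝ × Strip n → ℝ}
    (hf : Reg timeAxis BC 4 f) :
    damped timeAxis l (conv (timeCoverHom n) k f) =
      conv (timeCoverHom n) k (damped timeAxis l f) := by
  have h1 := Reg.lap (m := 2) (fun _ _ => BC.add) BC.zero hf
  have h2 := Reg.lap (m := 0) (fun _ _ => BC.add) BC.zero h1
  obtain ⟨M, hM⟩ := h2.base.bddMeas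
  obtain ⟨M', hM'⟩ := ((BC.const l).mul hf.base).bddMeas
  rw [damped, damped, lap_conv hk (hf.mono (by norm_num)), lap_conv hk h1,
    conv_add_fun isOpenQuotientMap_timeCoverHom.continuous hk hM hM']
  congr 1
  ext q
  simp only [conv, Pi.mul_apply]
  rw [← integral_const_mul]
  congr 1
  ext y
  ring

/-! ### Joint smoothness -/

/-- Continuous partial derivatives give a Fréchet derivative. -/
lemma hasFDerivAt_of_partials {V ι : Type*} [NormedAddCommGroup V] [NormedSpace ℝ V] [Fintype ι]
    {e : ι → V} {c : ι → V →L[ℝ] ℝ} (hsum : ∀ v, ∑ i, c i v • e i = v) {f : V → ℝ}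
    {f' : ι → V → ℝ} (hd : ∀ i, HasDir (fun s : ℝ => s • e i) f (f' i))
    (hc : ∀ i, Continuous (f' i)) (x : V) : HasFDerivAt f (∑ i, f' i x • c i) x := by
  classical
  -- The coordinates are displaced one at a time, and the increments are summed by induction on the
  -- set of displaced coordinates.
  have key : ∀ s : Finset ι, (fun h => f (x + ∑ i ∈ s, c i h • e i) - f x -
      ∑ i ∈ s, f' i x * c i h) =o[𝓝 0] fun h : V => h := by
    intro s
    induction s using Finset.induction_on with
    | empty => simp
    | insert j s hj ih =>
      have hstep : (fun h => f (x + ∑ i ∈ s, c i h • e i + c j h • e j) -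
          f (x + ∑ i ∈ s, c i h • e i) - f' j x * c j h) =o[𝓝 0] fun h : V => h := by
        have hO : (fun h => c j h) =O[𝓝 0] fun h : V => h := (c j).isBigO_id _
        refine Asymptotics.IsLittleO.trans_isBigO ?_ hO
        rw [Asymptotics.isLittleO_iff]
        intro ε hε
        have hcj := Metric.continuousAt_iff.1 ((hc j).continuousAt (x := x)) ε hε
        obtain ⟨δ, hδ, hball⟩ := hcj
        have hy : Tendsto (fun h : V => x + ∑ i ∈ s, c i h • e i) (𝓝 0) (𝓝 x) := by
          have : Continuous fun h : V => x + ∑ i ∈ s, c i h • e i := by fun_prop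
          simpa using this.tendsto 0
        have hy2 : Tendsto (fun h : V => x + ∑ i ∈ s, c i h • e i + c j h • e j) (𝓝 0) (𝓝 x) := by
          have : Continuous fun h : V => x + ∑ i ∈ s, c i h • e i + c j h • e j := by fun_prop
          simpa using this.tendsto 0
        filter_upwards [hy (Metric.ball_mem_nhds x hδ), hy2 (Metric.ball_mem_nhds x hδ)]
          with h h1 h2
        set y := x + ∑ i ∈ s, c i h • e i with hydef
        have hone : IsOneParam fun s : ℝ => s • e j := fun s t => add_smul s t (e j)
        have hseg : ∀ r ∈ uIcc 0 (c j h), y + r • e j ∈ Metric.ball x δ := by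
          intro r hr
          have hmem : r ∈ segment ℝ 0 (c j h) := by rwa [segment_eq_uIcc]
          obtain ⟨a, b, ha, hb, hab, rfl⟩ := hmem
          have := (convex_ball x δ) h1 h2 ha hb hab
          have heq : ∀ y : V, a • y + b • (y + c j h • e j) =
              y + (a • (0 : ℝ) + b • c j h) • e j := fun y => by
            rw [smul_add, ← add_assoc, ← add_smul, hab, one_smul, smul_zero, zero_add, smul_smul,
              smul_eq_mul]
          rw [← heq y]
          exact this
        -- The mean value inequality for `r ↦ f(y + r e_j) - r f'_j(x)`, whose derivative is at most
        -- `ε` on a segment that stays in the ball.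
        have hmv := Convex.norm_image_sub_le_of_norm_hasDerivWithin_le (𝕜 := ℝ)
          (f := fun r => f (y + r • e j) - r * f' j x) (f' := fun r => f' j (y + r • e j) - f' j x)
          (s := uIcc 0 (c j h)) (x := 0) (y := c j h) (C := ε)
          (fun r _ => ((HasDir.hasDerivAt hone (hd j) y r).sub
            ((hasDerivAt_id r).mul_const (f' j x) |>.congr_deriv (one_mul _))).hasDerivWithinAt)
          (fun r hr => (hball (hseg r hr)).le) (convex_uIcc 0 (c j h)) left_mem_uIcc right_mem_uIcc
        simp only [zero_smul, add_zero, zero_mul, sub_zero] at hmv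
        refine le_trans (le_of_eq ?_) hmv
        congr 1
        ring
      refine (hstep.add ih).congr_left fun h => ?_
      rw [Finset.sum_insert hj, Finset.sum_insert hj, add_comm (c j h • e j), ← add_assoc]
      ring
  have h := key Finset.univ
  rw [hasFDerivAt_iff_isLittleO_nhds_zero]
  refine h.congr_left fun h => ?_
  rw [hsum, _root_.sum_apply]
  rfl

end CahnHilliard

end

/-! ### Joint regularity in time and space of forced evolutions and kinks -/

noncomputable section

set_option linter.unusedSectionVars false

namespace CahnHilliard

variable {n : ℕ}

/-- A predicate on functions that defines an algebra. -/
structure IsAlg {X : Type*} (P : (X → ℝ) → Prop) : Prop where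
  add : ∀ f g, P f → P g → P (f + g)
  mul : ∀ f g, P f → P g → P (f * g)
  const : ∀ c : ℝ, P fun _ => c

lemma IsAlg.zero {X : Type*} {P : (X → ℝ) → Prop} (h : IsAlg P) : P 0 := h.const 0

lemma isAlg_BC {X : Type*} [TopologicalSpace X] : IsAlg (BC : (X → ℝ) → Prop) :=
  ⟨fun _ _ => BC.add, fun _ _ => BC.mul, BC.const⟩

/-- Functions on space-time with lift of class `C^k`. -/
def CK (k : ℕ) (f : ℝ × Strip n → ℝ) : Prop := ContDiff ℝ k fun p => f (timeCoverHom n p)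

lemma isAlg_CK (k : ℕ) : IsAlg (CK (n := n) k) :=
  ⟨fun _ _ hf hg => ContDiff.add hf hg, fun _ _ hf hg => ContDiff.mul hf hg,
    fun _ => contDiff_const⟩

lemma CK_zero_of_continuous {f : ℝ × Strip n → ℝ} (hf : Continuous f) : CK 0 f := by
  rw [CK, Nat.cast_zero, contDiff_zero]
  exact hf.comp isOpenQuotientMap_timeCoverHom.continuous

/-- The coordinate directions of space-time, including time. -/
def jointBasis : Option (Option (Fin n)) → ℝ × Cover n
  | none => (1, 0)
  | some i => timeBasis i

/-- The coordinates of space-time. -/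
def jointCoord : Option (Option (Fin n)) → (ℝ × Cover n →L[ℝ] ℝ)
  | none => ContinuousLinearMap.fst ℝ ℝ (Cover n)
  | some none => (ContinuousLinearMap.snd ℝ (Fin n → ℝ) ℝ).comp
      (ContinuousLinearMap.snd ℝ ℝ (Cover n))
  | some (some i) => (ContinuousLinearMap.proj i).comp ((ContinuousLinearMap.fst ℝ (Fin n → ℝ) ℝ).comp
      (ContinuousLinearMap.snd ℝ ℝ (Cover n)))

lemma sum_jointCoord_smul (v : ℝ × Cover n) : ∑ i, jointCoord i v • jointBasis i = v := by
  obtain ⟨t, y, z⟩ := v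
  simp only [Fintype.sum_option, jointCoord, jointBasis, timeBasis, coverBasis]
  refine Prod.ext ?_ (Prod.ext ?_ ?_)
  · simp [Prod.fst_sum]
  · ext j
    simp [Prod.fst_sum, Prod.snd_sum, Pi.single_apply]
  · simp [Prod.snd_sum]

lemma CK_succ {k : ℕ} {f ft : ℝ × Strip n → ℝ} {f' : Option (Fin n) → ℝ × Strip n → ℝ}
    (hx : ∀ i, HasDir (timeAxis i) f (f' i)) (hx' : ∀ i, CK k (f' i))
    (ht : HasDir (timeShift n) f ft) (ht' : CK k ft) : CK (k + 1) f := by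
  let F' : Option (Option (Fin n)) → ℝ × Cover n → ℝ := fun i p =>
    (i.elim ft f') (timeCoverHom n p)
  have hF' : ∀ i, ContDiff ℝ k (F' i) := by
    rintro (_ | i)
    · exact ht'
    · exact hx' i
  have hd : ∀ i, HasDir (fun s : ℝ => s • jointBasis i) (fun p => f (timeCoverHom n p)) (F' i) := by
    rintro (_ | i) p
    · have h := ht (timeCoverHom n p)
      refine h.congr_of_eventuallyEq (Eventually.of_forall fun s => ?_)
      simp only [jointBasis, map_add]
      congr 2
      simp [timeCoverHom_apply, timeShift]
    · have h := hx i (timeCoverHom n p)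
      refine h.congr_of_eventuallyEq (Eventually.of_forall fun s => ?_)
      simp only [jointBasis, map_add, timeAxis_eq]
  rw [CK, Nat.cast_add, Nat.cast_one, contDiff_succ_iff_hasFDerivAt]
  refine ⟨fun p => ∑ i, F' i p • jointCoord i, ?_, fun p =>
    hasFDerivAt_of_partials sum_jointCoord_smul hd (fun i => (hF' i).continuous) p⟩
  exact ContDiff.sum fun i _ => (hF' i).smul contDiff_const

lemma IsAlg.reg_lap {P : (ℝ × Strip n → ℝ) → Prop} (hP : IsAlg P) {m : ℕ} {f : ℝ × Strip n → ℝ}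
    (h : Reg timeAxis P (m + 2) f) : Reg timeAxis P m (lap timeAxis f) :=
  Reg.lap hP.add hP.zero h

lemma IsAlg.damped {P : (ℝ × Strip n → ℝ) → Prop} (hP : IsAlg P) {f : ℝ × Strip n → ℝ} (l : ℝ)
    (h : Reg timeAxis P 4 f) : P (damped timeAxis l f) :=
  hP.add _ _ (hP.reg_lap (m := 0) (hP.reg_lap h)).base (hP.mul _ _ (hP.const l) h.base)

/-- The equation expresses the time derivative through the forcing and at most four spatial
derivatives; if all of these are `C^k`, the evolution is `C^{k+1}`. -/
lemma CK_conv {l : ℝ} (hl : 0 < l) {k : ℕ} {G : ℝ × Strip n → ℝ} (hBC : Reg timeAxis BC 4 G)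
    (h0 : ∀ t ≤ 0, ∀ x, G (t, x) = 0) (hG : CK k G)
    (hg : Reg timeAxis (CK k) 4 (conv (timeCoverHom n) (heatKer n l 0) G)) :
    CK (k + 1) (conv (timeCoverHom n) (heatKer n l 0) G) := by
  refine CK_succ (fun i => hg.hasDir i) (fun i => (hg.pd i).base)
    (hasDir_time_conv_heatKer hl hBC h0) ?_
  rw [← damped_conv (integrable_heatKer (n := n) hl zero_le_one) l hBC]
  exact ContDiff.sub hG ((isAlg_CK k).damped l hg)

/-- Spatial derivatives commute with the convolution, so `CK_conv` applies to each of them.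
Hypotheses at every order are needed since each time derivative costs four spatial ones. -/
lemma Reg_CK_conv {l : ℝ} (hl : 0 < l) {k : ℕ} (m : ℕ) {G : ℝ × Strip n → ℝ}
    (hBC : ∀ m, Reg timeAxis BC m G) (h0 : ∀ t ≤ 0, ∀ x, G (t, x) = 0)
    (hG : ∀ m, Reg timeAxis (CK k) m G)
    (hg : ∀ m, Reg timeAxis (CK k) m (conv (timeCoverHom n) (heatKer n l 0) G)) :
    Reg timeAxis (CK (k + 1)) m (conv (timeCoverHom n) (heatKer n l 0) G) := by
  have hk := integrable_heatKer (n := n) hl zero_le_one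
  induction m generalizing G with
  | zero => exact CK_conv hl (hBC 4) h0 (hG 0).base (hg 4)
  | succ m ih =>
    refine ⟨CK_conv hl (hBC 4) h0 (hG 0).base (hg 4), fun i => ⟨(hg 1).hasDir i, ?_⟩⟩
    rw [pd_conv hk (hBC 1)]
    refine ih (fun m => (hBC (m + 1)).pd i) (fun t ht x => ?_) (fun m => (hG (m + 1)).pd i)
      fun m => ?_
    · rw [congrFun (pd_timeAxis i G t) x, funext fun x => h0 t ht x,
        (hasDir_const (axis i) 0).pd_eq]
      rfl
    · rw [← pd_conv hk (hBC 1)]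
      exact (hg (m + 1)).pd i

lemma hasDerivAt_tanh (x : ℝ) : HasDerivAt Real.tanh (1 - Real.tanh x ^ 2) x := by
  have h := (Real.hasDerivAt_sinh x).div (Real.hasDerivAt_cosh x) (Real.cosh_pos x).ne'
  have e : Real.tanh = fun x => Real.sinh x / Real.cosh x := funext Real.tanh_eq_sinh_div_cosh
  rw [e]
  refine h.congr_deriv ?_
  have := (Real.cosh_pos x).ne'
  field_simp

lemma hasDir_kink (b : ℝ) (i : Option (Fin n)) : HasDir (axis i) (kink b)
    (fun x => i.elim ((1 - kink b x ^ 2) / √2) fun _ => 0) := by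
  intro x
  cases i with
  | none =>
    have h1 : HasDerivAt (fun s : ℝ => (x.2 + s - b) / √2) (1 / √2) 0 :=
      (((hasDerivAt_id (0 : ℝ)).const_add x.2).sub_const b).div_const _
    have h2 := (hasDerivAt_tanh ((x.2 + 0 - b) / √2)).comp (0 : ℝ) h1
    simpa [kink, axis, Function.comp_def, div_eq_mul_inv] using h2
  | some i => simpa [kink, axis] using hasDerivAt_const (0 : ℝ) _

lemma abs_kink_le (b : ℝ) (x : Strip n) : |kink b x| ≤ 1 := (Real.abs_tanh_lt_one _).le

lemma continuous_tanh : Continuous Real.tanh :=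
  continuous_iff_continuousAt.2 fun x => (hasDerivAt_tanh x).continuousAt

lemma continuous_kink (b : ℝ) : Continuous (kink (n := n) b) :=
  continuous_tanh.comp (by fun_prop)

lemma BC_kink (b : ℝ) : BC (kink (n := n) b) := ⟨continuous_kink b, 1, abs_kink_le b⟩

/-- The kink is regular in every algebra of functions containing it. -/
lemma Reg_kink {P : (Strip n → ℝ) → Prop} (hP : IsAlg P) {b : ℝ} (hb : P (kink b)) (m : ℕ) :
    Reg axis P m (kink b) := by
  induction m with
  | zero => exact hb
  | succ m ih =>
    refine Reg.succ_intro hb (hasDir_kink b) fun i => ?_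
    cases i with
    | none =>
      -- The profile equation `v' = (1 - v²) / √2` makes every derivative a polynomial in `v`.
      have h1 : Reg axis P m ((fun _ => 1 / √2) + ((fun _ => -(1 / √2)) * (kink b * kink b))) :=
        Reg.add hP.add (Reg.const hP.zero _ (hP.const _)) (Reg.mul (fun i => (isOneParam_axis i).zero)
          hP.add hP.mul (Reg.const hP.zero _ (hP.const _))
          (Reg.mul (fun i => (isOneParam_axis i).zero) hP.add hP.mul ih ih))
      convert! h1 using 1
      ext x
      simp only [Option.elim, Pi.add_apply, Pi.mul_apply]
      ring
    | some i => exact Reg.zero hP.zero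

lemma Reg_space {P : (ℝ × Strip n → ℝ) → Prop} {f : Strip n → ℝ} {m : ℕ}
    (h : Reg axis (fun f => P fun q => f q.2) m f) : Reg timeAxis P m fun q => f q.2 := by
  induction m generalizing f with
  | zero => exact h
  | succ m ih =>
    refine Reg.succ_intro h.1 (f' := fun i q => pd axis i f q.2) (fun i q => ?_) fun i => ih (h.pd i)
    simpa [timeAxis] using h.hasDir i q.2

lemma Reg_time_kink {P : (ℝ × Strip n → ℝ) → Prop} (hP : IsAlg P) {b : ℝ}
    (hb : P fun q => kink b q.2) (m : ℕ) : Reg timeAxis P m fun q => kink b q.2 :=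
  Reg_space (Reg_kink (P := fun f => P fun q => f q.2)
    ⟨fun _ _ => hP.add _ _, fun _ _ => hP.mul _ _, fun c => hP.const c⟩ hb m)

lemma CK_kink (k : ℕ) (b : ℝ) : CK k fun q : ℝ × Strip n => kink b q.2 := by
  have h : ContDiff ℝ k Real.tanh := by
    have e : Real.tanh = fun x => Real.sinh x / Real.cosh x := funext Real.tanh_eq_sinh_div_cosh
    rw [e]
    exact Real.contDiff_sinh.div Real.contDiff_cosh fun x => (Real.cosh_pos x).ne'
  refine h.comp (g := Real.tanh) (f := fun p : ℝ × Cover n => (p.2.2 - b) / √2) ?_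
  exact (contDiff_snd.snd.sub contDiff_const).div_const _

end CahnHilliard

end

noncomputable section

set_option linter.unusedSectionVars false

namespace CahnHilliard

open scoped BoundedContinuousFunction

variable {n : ℕ}

/-! ### The mild solution -/

/-- The increment `G'(v + w) - G'(v)` of the derivative of the double-well potential. -/
def increment (v w : ℝ) : ℝ := ((v + w) ^ 3 - (v + w)) - (v ^ 3 - v)

/-- The projection of `ℝ` onto `[-1, 1]`. -/
def clamp (x : ℝ) : ℝ := max (-1) (min 1 x)

lemma abs_clamp_le (x : ℝ) : |clamp x| ≤ 1 :=
  abs_le.2 ⟨le_max_left _ _, max_le (by norm_num) (min_le_left _ _)⟩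

lemma clamp_eq {x : ℝ} (hx : |x| ≤ 1) : clamp x = x := by
  obtain ⟨h1, h2⟩ := abs_le.1 hx
  rw [clamp, min_eq_right h2, max_eq_right h1]

lemma abs_clamp_sub_le (x y : ℝ) : |clamp x - clamp y| ≤ |x - y| :=
  (abs_max_sub_max_le_max _ _ _ _).trans (by
    rw [sub_self, abs_zero]
    exact max_le (abs_nonneg _) ((abs_min_sub_min_le_max _ _ _ _).trans (by simp)))

lemma continuous_clamp : Continuous clamp := by
  unfold clamp
  fun_prop

/-- Factor the difference of cubes in `v + w` and `v + w'`. -/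
lemma abs_increment_sub_le {v w w' R : ℝ} (hw : |v + w| ≤ R) (hw' : |v + w'| ≤ R) :
    |increment v w - increment v w'| ≤ (3 * R ^ 2 + 1) * |w - w'| := by
  have h : increment v w - increment v w' =
      ((v + w) ^ 2 + (v + w) * (v + w') + (v + w') ^ 2 - 1) * (w - w') := by
    unfold increment
    ring
  rw [h, abs_mul]
  gcongr
  have h1 : |v + w| ^ 2 ≤ R ^ 2 := by gcongr
  have h2 : |v + w'| ^ 2 ≤ R ^ 2 := by gcongr
  rw [sq_abs] at h1 h2
  rw [abs_le]
  constructor <;> nlinarith [sq_nonneg ((v + w) - (v + w')), sq_nonneg (w' + 2 * v + w)]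

/-- The truncated forcing term. -/
def forcing (l b : ℝ) (W : ℝ × Strip n → ℝ) (q : ℝ × Strip n) : ℝ :=
  if 0 < q.1 then Real.exp (-(l * q.1)) *
    increment (kink b q.2) (clamp (Real.exp (l * q.1) * W q)) else 0

/-- The factors `e^{±lt}` cancel and the truncation is 1-Lipschitz. A kink plus a truncated value
lies in `[-2, 2]`, whence the constant `3 · 2² + 1 = 13`. -/
lemma abs_forcing_sub_le (l b : ℝ) (W W' : ℝ × Strip n → ℝ) (q : ℝ × Strip n) :
    |forcing l b W q - forcing l b W' q| ≤ 13 * |W q - W' q| := by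
  unfold forcing
  split_ifs with h
  · rw [← mul_sub, abs_mul, Real.abs_exp]
    have h1 : ∀ x, |kink b q.2 + clamp x| ≤ 2 := fun x =>
      (abs_add_le _ _).trans (by linarith [abs_kink_le b q.2, abs_clamp_le x])
    calc _ ≤ Real.exp (-(l * q.1)) * ((3 * 2 ^ 2 + 1) *
          |clamp (Real.exp (l * q.1) * W q) - clamp (Real.exp (l * q.1) * W' q)|) := by
          gcongr
          exact abs_increment_sub_le (h1 _) (h1 _)
      _ ≤ Real.exp (-(l * q.1)) * ((3 * 2 ^ 2 + 1) * (Real.exp (l * q.1) * |W q - W' q|)) := by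
          gcongr
          refine (abs_clamp_sub_le _ _).trans ?_
          rw [← mul_sub, abs_mul, Real.abs_exp]
      _ = (Real.exp (-(l * q.1)) * Real.exp (l * q.1)) * (13 * |W q - W' q|) := by ring
      _ = _ := by rw [← Real.exp_add, neg_add_cancel, Real.exp_zero, one_mul]
  · simp

lemma forcing_zero (l b : ℝ) : forcing l b (0 : ℝ × Strip n → ℝ) = 0 := by
  ext q
  simp [forcing, increment, clamp]

lemma abs_forcing_le (l b : ℝ) (W : ℝ × Strip n → ℝ) (q : ℝ × Strip n) :
    |forcing l b W q| ≤ 13 * |W q| := by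
  simpa [forcing_zero] using abs_forcing_sub_le l b W 0 q

lemma measurable_forcing (l b : ℝ) {W : ℝ × Strip n → ℝ} (hW : Measurable W) :
    Measurable (forcing l b W) := by
  refine Measurable.ite (measurableSet_lt measurable_const measurable_fst) ?_ measurable_const
  have h1 : Measurable fun q : ℝ × Strip n => kink b q.2 :=
    (continuous_kink b).measurable.comp measurable_snd
  have h2 : Measurable fun q : ℝ × Strip n => clamp (Real.exp (l * q.1) * W q) :=
    continuous_clamp.measurable.comp (by fun_prop)
  unfold increment
  fun_prop

lemma BddMeas.forcing (l b : ℝ) {W : ℝ × Strip n → ℝ} {M : ℝ} (hW : BddMeas W M) :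
    BddMeas (forcing l b W) (13 * M) :=
  ⟨measurable_forcing l b hW.meas, fun q => (abs_forcing_le l b W q).trans (by
    gcongr
    exact hW.bdd q)⟩

lemma BddMeas.add {X : Type*} [MeasurableSpace X] {f g : X → ℝ} {M M' : ℝ} (hf : BddMeas f M)
    (hg : BddMeas g M') : BddMeas (f + g) (M + M') :=
  ⟨hf.meas.add hg.meas, fun x => (abs_add_le _ _).trans (add_le_add (hf.bdd x) (hg.bdd x))⟩

lemma bddMeas_boundedContinuous (B : (ℝ × Strip n) →ᵇ ℝ) : BddMeas (⇑B) ‖B‖ :=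
  ⟨B.continuous.measurable, fun q => B.norm_coe_le_norm q⟩

/-- The damping rates that make the mild formulation contractive. -/
lemma exists_damping (n : ℕ) {L : ℝ} (hL : 0 ≤ L) :
    ∃ l : ℝ, 0 < l ∧ (∫ q, |heatKer n l 1 q|) * L ≤ 1 / 2 := by
  set C := Real.Gamma (1 / 2) * heatMass n 1 with hC
  have hC0 : 0 ≤ C := mul_nonneg (Real.Gamma_pos_of_pos (by norm_num)).le (heatMass_nonneg n 1)
  have hpos : 0 < 2 * L * C + 1 := by positivity
  -- The kernel mass is `C l^{-1/2}`, so this `l` gives `CL / (2LC + 1) ≤ 1/2`.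
  refine ⟨(2 * L * C + 1) ^ 2, by positivity, ?_⟩
  have h := integral_abs_ker (n := n) (l := (2 * L * C + 1) ^ 2) (by positivity) (k := 2)
    (by norm_num) (heat n 1 1)
  have h2 : (1 / (2 * L * C + 1) ^ 2 : ℝ) ^ (1 / 2 : ℝ) = 1 / (2 * L * C + 1) := by
    rw [← Real.sqrt_eq_rpow, ← one_div_pow, Real.sqrt_sq (by positivity)]
  have h3 : (1 - ((2 : ℕ) : ℝ) / 4) = 1 / 2 := by norm_num
  rw [h3, h2] at h
  change (∫ q, |ker _ 2 (heat n 1 1) q|) * L ≤ 1 / 2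
  rw [h, mul_assoc (1 / (2 * L * C + 1))]
  change 1 / (2 * L * C + 1) * C * L ≤ 1 / 2
  rw [div_mul_eq_mul_div, div_mul_eq_mul_div, div_le_iff₀ hpos]
  linarith

/-- The map whose fixed point is the forced part of the mild solution. -/
def mildMap (l b : ℝ) (hl : 0 < l) {A : ℝ × Strip n → ℝ} {M : ℝ} (hA : BddMeas A M)
    (B : (ℝ × Strip n) →ᵇ ℝ) : (ℝ × Strip n) →ᵇ ℝ :=
  BoundedContinuousFunction.ofNormedAddCommGroup
    (conv (timeCoverHom n) (heatKer n l 1) (forcing l b (A + B)))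
    (continuous_conv isOpenQuotientMap_timeCoverHom (integrable_heatKer hl le_rfl)
      ((hA.add (bddMeas_boundedContinuous B)).forcing l b)) _
    fun q => abs_conv_le ((hA.add (bddMeas_boundedContinuous B)).forcing l b).bdd
      (integrable_heatKer hl le_rfl) q

lemma contractingWith_mildMap (l b : ℝ) (hl : 0 < l)
    (hl' : (∫ q, |heatKer n l 1 q|) * 13 ≤ 1 / 2) {A : ℝ × Strip n → ℝ} {M : ℝ}
    (hA : BddMeas A M) : ContractingWith (1 / 2) (mildMap l b hl hA) := by
  refine ⟨by norm_num, LipschitzWith.of_dist_le_mul fun B B' => ?_⟩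
  rw [BoundedContinuousFunction.dist_le (by positivity)]
  intro q
  have hk := integrable_heatKer (n := n) hl (j := 1) le_rfl
  have hB := (hA.add (bddMeas_boundedContinuous B)).forcing l b
  have hB' := (hA.add (bddMeas_boundedContinuous B')).forcing l b
  have h1 : mildMap l b hl hA B q - mildMap l b hl hA B' q = conv (timeCoverHom n) (heatKer n l 1)
      (fun q => forcing l b (A + ⇑B) q - forcing l b (A + ⇑B') q) q := by
    change conv _ _ _ q - conv _ _ _ q = _
    rw [conv, conv, conv, ← integral_sub
      (integrable_conv isOpenQuotientMap_timeCoverHom.continuous hk hB q)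
      (integrable_conv isOpenQuotientMap_timeCoverHom.continuous hk hB' q)]
    simp_rw [mul_sub]
  rw [Real.dist_eq, h1]
  refine (abs_conv_le (M := 13 * dist B B') (fun q => ?_) hk q).trans ?_
  · refine (abs_forcing_sub_le l b _ _ q).trans ?_
    gcongr
    have := BoundedContinuousFunction.dist_coe_le_dist (f := B) (g := B') q
    simpa [Real.dist_eq] using this
  · have := mul_le_mul_of_nonneg_right hl' (dist_nonneg (x := B) (y := B'))
    simpa [mul_assoc] using this

lemma eLpNorm_forcing_le (l b : ℝ) (W : ℝ × Strip n → ℝ) (t : ℝ) :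
    eLpNorm (fun x => forcing l b W (t, x)) 2 volume ≤
      ENNReal.ofReal 13 * eLpNorm (fun x => W (t, x)) 2 volume :=
  eLpNorm_le_mul_eLpNorm_of_ae_le_mul (Eventually.of_forall fun x => abs_forcing_le l b W (t, x)) 2

lemma eLpNorm_freeEvolution_le {l : ℝ} (hl : 0 ≤ l) {f : Strip n → ℝ} (hf : Measurable f) (t : ℝ) :
    eLpNorm (fun x => freeEvolution l f (t, x)) 2 volume ≤
      ENNReal.ofReal (heatMass n 0) * eLpNorm f 2 volume := by
  refine (eLpNorm_conv_le (integrable_heatKer_slice l 0 t) hf).trans ?_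
  gcongr
  exact integral_abs_heatKer_zero_le hl t

/-- The `L²` ball of radius `a` is invariant because `½(a + a) = a`. -/
lemma eLpNorm_mildMap_le {l b : ℝ} (hl : 0 < l)
    (hl' : (∫ q, |heatKer n l 1 q|) * 13 ≤ 1 / 2) {A : ℝ × Strip n → ℝ} {M : ℝ}
    (hA : BddMeas A M) {a : ℝ≥0∞} (ha : ∀ t, eLpNorm (fun x => A (t, x)) 2 volume ≤ a)
    {B : (ℝ × Strip n) →ᵇ ℝ} (hB : ∀ t, eLpNorm (fun x => B (t, x)) 2 volume ≤ a) (t : ℝ) :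
    eLpNorm (fun x => mildMap l b hl hA B (t, x)) 2 volume ≤ a := by
  have hk := integrable_heatKer (n := n) hl (j := 1) le_rfl
  have hBm := bddMeas_boundedContinuous B
  have h := eLpNorm_conv_time_le hk (((hA.add hBm).forcing l b).meas)
    (C := ENNReal.ofReal 13 * (a + a)) (fun t => ?_) t
  · refine h.trans ?_
    rw [← mul_assoc, ← ENNReal.ofReal_mul (integral_nonneg fun _ => abs_nonneg _)]
    calc _ ≤ ENNReal.ofReal (1 / 2) * (a + a) := by gcongr
      _ = a := by
        rw [← two_mul, ← mul_assoc, ENNReal.ofReal_div_of_pos (by norm_num), ENNReal.ofReal_one,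
          ENNReal.ofReal_ofNat, one_div, ENNReal.inv_mul_cancel (by norm_num) (by norm_num), one_mul]
  · refine (eLpNorm_forcing_le l b _ t).trans ?_
    gcongr
    refine (eLpNorm_add_le (f := fun x => A (t, x)) (g := fun x => B (t, x)) ?_ ?_
      (by norm_num)).trans (add_le_add (ha t) (hB t))
    · exact (hA.meas.comp measurable_prodMk_left).aestronglyMeasurable
    · exact (hBm.meas.comp measurable_prodMk_left).aestronglyMeasurable

/-- Existence of the forced part of the mild solution. -/
theorem exists_mild {l b : ℝ} (hl : 0 < l)
    (hl' : (∫ q, |heatKer n l 1 q|) * 13 ≤ 1 / 2) {A : ℝ × Strip n → ℝ} {M : ℝ}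
    (hA : BddMeas A M) {a : ℝ≥0∞} (ha : ∀ t, eLpNorm (fun x => A (t, x)) 2 volume ≤ a) :
    ∃ B : ℝ × Strip n → ℝ, Continuous B ∧ BddMeas B M ∧
      B = conv (timeCoverHom n) (heatKer n l 1) (forcing l b (A + B)) ∧
      ∀ t, eLpNorm (fun x => B (t, x)) 2 volume ≤ a := by
  have hcon := contractingWith_mildMap l b hl hl' hA
  set Φ := mildMap l b hl hA with hΦ
  set B := hcon.fixedPoint Φ with hBdef
  have hfix : Φ B = B := hcon.fixedPoint_isFixedPt
  have hBeq : ⇑B = conv (timeCoverHom n) (heatKer n l 1) (forcing l b (A + ⇑B)) := by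
    conv_lhs => rw [← hfix]
    rfl
  have hM : 0 ≤ M := hA.nonneg 0
  refine ⟨B, B.continuous, ⟨B.continuous.measurable, fun q => ?_⟩, hBeq, fun t => ?_⟩
  · have hW := (hA.add (bddMeas_boundedContinuous B)).forcing l b
    have hk := integrable_heatKer (n := n) hl (j := 1) le_rfl
    -- The fixed-point equation yields `‖B‖ ≤ ½(M + ‖B‖)`, hence `‖B‖ ≤ M`.
    have h1 : ‖B‖ ≤ (∫ q, |heatKer n l 1 q|) * (13 * (M + ‖B‖)) := by
      rw [BoundedContinuousFunction.norm_le
        (mul_nonneg (integral_nonneg fun _ => abs_nonneg _) (by positivity))]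
      intro q
      rw [Real.norm_eq_abs, hBeq]
      exact abs_conv_le hW.bdd hk q
    have h2 : ‖B‖ ≤ 1 / 2 * (M + ‖B‖) := by
      refine h1.trans ?_
      rw [← mul_assoc]
      gcongr
    exact (B.norm_coe_le_norm q).trans (by linarith)
  -- The Picard iterates from zero stay in the invariant `L²` ball, and lower semicontinuity of the
  -- norm passes the bound to their uniform limit.
  · have hit : ∀ k : ℕ, ∀ t, eLpNorm (fun x => (Φ^[k] 0) (t, x)) 2 volume ≤ a := by
      intro k
      induction k with
      | zero =>
        intro t
        have : (fun x : Strip n => ((Φ^[0] 0 : (ℝ × Strip n) →ᵇ ℝ)) (t, x)) = 0 := rfl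
        rw [this, eLpNorm_zero]
        exact zero_le
      | succ k ih =>
        intro t
        rw [Function.iterate_succ_apply']
        exact eLpNorm_mildMap_le hl hl' hA ha ih t
    have htend := hcon.tendsto_iterate_fixedPoint 0
    have hF := Lp.eLpNorm_lim_le_liminf_eLpNorm (p := 2) (μ := (volume : Measure (Strip n)))
      (f := fun k x => (Φ^[k] 0) (t, x))
      (fun k => ((Φ^[k] 0).continuous.comp (by fun_prop)).aestronglyMeasurable)
      (fun x => B (t, x)) (Eventually.of_forall fun x => ?_)
    · refine hF.trans ?_
      refine (liminf_le_liminf (v := fun _ => a) (Eventually.of_forall fun k => hit k t)).trans ?_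
      simp
    · exact ((BoundedContinuousFunction.tendsto_iff_tendstoUniformly.1 htend).tendsto_at (t, x))

end CahnHilliard

end

noncomputable section

set_option linter.unusedSectionVars false

namespace CahnHilliard

variable {n : ℕ}

/-! ### Regularity of the mild solution -/

/-- Smooth functions of time supported in the open interval `(0, T)`. -/
structure IsCutoff (T : ℝ) (θ : ℝ → ℝ) : Prop where
  smooth : ContDiff ℝ ∞ θ
  support : tsupport θ ⊆ Ioo 0 T

section Cutoff

variable {T : ℝ} {θ : ℝ → ℝ}

lemma IsCutoff.deriv (h : IsCutoff T θ) : IsCutoff T (deriv θ) :=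
  ⟨(contDiff_infty_iff_deriv.1 h.smooth).2, fun _ h' => h.support (tsupport_deriv_subset h')⟩

lemma IsCutoff.smooth_mul (h : IsCutoff T θ) {a : ℝ → ℝ} (ha : ContDiff ℝ ∞ a) :
    IsCutoff T fun t => a t * θ t :=
  ⟨ha.mul h.smooth, (closure_mono fun _ ht => right_ne_zero_of_mul ht).trans h.support⟩

lemma IsCutoff.hasCompactSupport (h : IsCutoff T θ) : HasCompactSupport θ :=
  isCompact_Icc.of_isClosed_subset (isClosed_tsupport θ) (h.support.trans Ioo_subset_Icc_self)

lemma IsCutoff.bound (h : IsCutoff T θ) : ∃ C, ∀ t, |θ t| ≤ C :=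
  h.hasCompactSupport.exists_bound_of_continuous h.smooth.continuous

lemma IsCutoff.eq_zero (h : IsCutoff T θ) {t : ℝ} (ht : t ∉ Ioo 0 T) : θ t = 0 :=
  image_eq_zero_of_notMem_tsupport fun h' => ht (h.support h')

lemma IsCutoff.hasDerivAt (h : IsCutoff T θ) (t : ℝ) : HasDerivAt θ (_root_.deriv θ t) t :=
  (h.smooth.differentiable (by simp) t).hasDerivAt

/-- A cutoff equal to one near a given compact subset of the interval. -/
lemma exists_cutoff {K : Set ℝ} (hK : IsCompact K) (hKT : K ⊆ Ioo 0 T) :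
    ∃ θ, IsCutoff T θ ∧ ∀ t ∈ K, θ =ᶠ[𝓝 t] 1 := by
  rcases K.eq_empty_or_nonempty with rfl | hne
  · refine ⟨0, ⟨contDiff_const, ?_⟩, by simp⟩
    have : tsupport (0 : ℝ → ℝ) = ∅ := tsupport_eq_empty_iff.2 rfl
    rw [this]
    exact empty_subset _
  obtain ⟨t₀, ht₀, hmax⟩ := hK.exists_isMaxOn hne (continuous_abs.comp
    (continuous_sub_right (T / 2))).continuousOn
  set r := |t₀ - T / 2| with hr
  have hrT : r < T / 2 := by
    obtain ⟨h1, h2⟩ := hKT ht₀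
    rw [hr, abs_lt]
    constructor <;> linarith
  have hr0 : 0 ≤ r := abs_nonneg _
  -- The two radii divide the gap between `r` and `T / 2` into thirds.
  let φ : ContDiffBump (T / 2) := ⟨(2 * r + T / 2) / 3, (r + T) / 3, by linarith, by linarith⟩
  refine ⟨φ, ⟨φ.contDiff, ?_⟩, fun t ht => ?_⟩
  · rw [φ.tsupport_eq, Real.closedBall_eq_Icc]
    intro t ht
    have h1 : φ.rOut = (r + T) / 3 := rfl
    rw [h1] at ht
    constructor <;> [linarith [ht.1]; linarith [ht.2]]
  · refine φ.eventuallyEq_one_of_mem_ball ?_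
    rw [Metric.mem_ball, Real.dist_eq]
    have h1 : φ.rIn = (2 * r + T / 2) / 3 := rfl
    rw [h1]
    have : |t - T / 2| ≤ r := hmax ht
    linarith

end Cutoff

/-- `W` is a damped mild solution with datum `w`, untruncated on the time interval `(0, T)`. -/
structure IsMild (l b T : ℝ) (w : Strip n → ℝ) (W : ℝ × Strip n → ℝ) : Prop where
  pos : 0 < l
  datum : ∃ M, BddMeas w M
  bdd : ∃ M, BddMeas W M
  l2 : L2Bdd W
  eq : W = freeEvolution l w + conv (timeCoverHom n) (heatKer n l 1) (forcing l b W)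
  small : ∀ t ∈ Ioo 0 T, ∀ x, |Real.exp (l * t) * W (t, x)| ≤ 1

lemma BC.comp_snd {X Y : Type*} [TopologicalSpace X] [TopologicalSpace Y] {f : Y → ℝ} (hf : BC f) :
    BC fun q : X × Y => f q.2 :=
  ⟨hf.1.comp continuous_snd, hf.2.imp fun _ h q => h q.2⟩

section Mild

variable {l b T : ℝ} {w : Strip n → ℝ} {W : ℝ × Strip n → ℝ} {θ : ℝ → ℝ}

/-- Multiplication by a function of time. -/
def timeMul (θ : ℝ → ℝ) (f : ℝ × Strip n → ℝ) (q : ℝ × Strip n) : ℝ := θ q.1 * f q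

lemma IsCutoff.bddMeas_timeMul (h : IsCutoff T θ) {f : ℝ × Strip n → ℝ} {M : ℝ}
    (hf : BddMeas f M) : ∃ M', BddMeas (timeMul θ f) M' := by
  obtain ⟨C, hC⟩ := h.bound
  refine ⟨C * M, (h.smooth.continuous.measurable.comp measurable_fst).mul hf.meas, fun q => ?_⟩
  rw [timeMul, abs_mul]
  exact mul_le_mul (hC _) (hf.bdd _) (abs_nonneg _) ((abs_nonneg _).trans (hC 0))

lemma IsCutoff.L2Bdd_timeMul (h : IsCutoff T θ) {f : ℝ × Strip n → ℝ} (hf : L2Bdd f) :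
    L2Bdd (timeMul θ f) := by
  obtain ⟨C, hC⟩ := h.bound
  exact L2Bdd.bdd_mul (fun q => hC q.1) hf

lemma L2Bdd.forcing (l b : ℝ) (hW : L2Bdd W) : L2Bdd (forcing l b W) := by
  obtain ⟨C, hC, h⟩ := hW
  exact ⟨_, ENNReal.mul_ne_top ENNReal.ofReal_ne_top hC, fun t =>
    (eLpNorm_forcing_le l b W t).trans (by gcongr; exact h t)⟩

/-- Localisation in time of the mild formulation. -/
lemma IsMild.timeMul_eq (hW : IsMild l b T w W) (hθ : IsCutoff T θ) :
    timeMul θ W = conv (timeCoverHom n) (heatKer n l 0) (timeMul (deriv θ) W) +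
      conv (timeCoverHom n) (heatKer n l 1) (timeMul θ (forcing l b W)) := by
  obtain ⟨M, hM⟩ := hW.bdd
  obtain ⟨M₀, hM₀⟩ := hW.datum
  obtain ⟨C, hC⟩ := hθ.bound
  obtain ⟨C', hC'⟩ := hθ.deriv.bound
  have hN := hM.forcing l b
  have hA := bddMeas_freeEvolution hW.pos.le hM₀
  have hk1 := integrable_heatKer (n := n) hW.pos (j := 1) le_rfl
  have hk0 := integrable_heatKer (n := n) hW.pos zero_le_one
  have hB : BddMeas (conv (timeCoverHom n) (heatKer n l 1) (forcing l b W)) _ :=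
    ⟨(continuous_conv isOpenQuotientMap_timeCoverHom hk1 hN).measurable,
      fun x => abs_conv_le hN.bdd hk1 x⟩
  obtain ⟨M₁, hA'⟩ := hθ.deriv.bddMeas_timeMul hA
  obtain ⟨M₂, hB'⟩ := hθ.deriv.bddMeas_timeMul hB
  have hsplit : timeMul (deriv θ) W = timeMul (deriv θ) (freeEvolution l w) +
      timeMul (deriv θ) (conv (timeCoverHom n) (heatKer n l 1) (forcing l b W)) := by
    ext q
    rw [Pi.add_apply, timeMul, timeMul, timeMul, ← mul_add]
    conv_lhs => rw [hW.eq]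
    rfl
  rw [hsplit, conv_add_fun isOpenQuotientMap_timeCoverHom.continuous hk0 hA' hB']
  ext ⟨t, x⟩
  have h1 := conv_heatKer_deriv_mul_freeEvolution hW.pos hθ.hasDerivAt
    hθ.deriv.smooth.continuous hC' (hθ.eq_zero (by simp)) hM₀ t x
  have h2 := conv_heatKer_deriv_mul_conv hW.pos hθ.hasDerivAt hθ.deriv.smooth.continuous hC' hC
    hN t x
  simp only [Pi.add_apply]
  unfold timeMul at *
  rw [h1, h2]
  conv_lhs => rw [hW.eq]
  rw [Pi.add_apply]
  ring

/-- Where the truncation is inactive the forcing is a cubic polynomial in `W`, so it inherits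
regularity through products. -/
lemma forcing_eq {q : ℝ × Strip n} (hq : 0 < q.1) (hs : |Real.exp (l * q.1) * W q| ≤ 1) :
    forcing l b W q = (3 * kink b q.2 ^ 2 - 1) * W q +
      3 * kink b q.2 * Real.exp (l * q.1) * W q ^ 2 + Real.exp (l * q.1) ^ 2 * W q ^ 3 := by
  have h : Real.exp (-(l * q.1)) * Real.exp (l * q.1) = 1 := by
    rw [← Real.exp_add, neg_add_cancel, Real.exp_zero]
  rw [forcing, if_pos hq, clamp_eq hs, increment]
  linear_combination ((3 * kink b q.2 ^ 2 - 1) * W q + 3 * kink b q.2 * Real.exp (l * q.1) * W q ^ 2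
    + Real.exp (l * q.1) ^ 2 * W q ^ 3) * h

/-- The localised forcing is as regular as the localised solution. -/
lemma IsMild.reg_forcing (hW : IsMild l b T w W) {P Q : (ℝ × Strip n → ℝ) → Prop} (hP : IsAlg P)
    (hQ : ∀ f g, Q f → Q g → Q (f + g)) (hQP : ∀ f, Q f → P f)
    (hPQ : ∀ f g, P f → Q g → Q (f * g)) (hkink : P fun q => kink b q.2) {m : ℕ}
    (H : ∀ θ, IsCutoff T θ → Reg timeAxis Q m (timeMul θ W)) (hθ : IsCutoff T θ) :
    Reg timeAxis Q m (timeMul θ (forcing l b W)) := by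
  -- As `θ₁ = 1` on the support of `θ`, every factor of a monomial in `W` can be localised although
  -- `θ` occurs only once.
  obtain ⟨θ₁, hθ₁, h1⟩ := exists_cutoff hθ.hasCompactSupport hθ.support
  have hγ : ∀ i : Option (Fin n), timeAxis i 0 = 0 := fun i => (isOneParam_timeAxis i).zero
  have hE : ContDiff ℝ ∞ fun t : ℝ => Real.exp (l * t) := by fun_prop
  have hE2 : ContDiff ℝ ∞ fun t : ℝ => Real.exp (l * t) ^ 2 := by fun_prop
  have hV : Reg timeAxis P m fun q => kink b q.2 := Reg_time_kink hP hkink m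
  have hc : ∀ c : ℝ, Reg timeAxis P m fun _ => c := fun c => Reg.const hP.zero c (hP.const c)
  have h₁ : Reg timeAxis P m (timeMul θ₁ W) := (H θ₁ hθ₁).imp hQP
  have hmulP : ∀ {f g}, Reg timeAxis P m f → Reg timeAxis P m g → Reg timeAxis P m (f * g) :=
    fun hf hg => Reg.mul hγ hP.add hP.mul hf hg
  have hmulQ : ∀ {f g}, Reg timeAxis P m f → Reg timeAxis Q m g → Reg timeAxis Q m (f * g) :=
    fun hf hg => Reg.mul hγ hQ hPQ hf hg
  have hcoef : Reg timeAxis P m ((fun _ => 3) * ((fun q => kink b q.2) * fun q => kink b q.2) +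
      fun _ => -1) := Reg.add hP.add (hmulP (hc 3) (hmulP hV hV)) (hc (-1))
  have key := Reg.add hQ (Reg.add hQ (hmulQ hcoef (H θ hθ))
    (hmulQ (hmulP (hmulP (hc 3) hV) h₁) (H _ (hθ.smooth_mul hE))))
    (hmulQ (hmulP h₁ h₁) (H _ (hθ.smooth_mul hE2)))
  convert! key using 1
  ext q
  simp only [timeMul, Pi.add_apply, Pi.mul_apply]
  by_cases h0 : θ q.1 = 0
  · simp [h0]
  · have hmem : q.1 ∈ tsupport θ := subset_tsupport θ h0
    have hq := hθ.support hmem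
    have h2 : θ₁ q.1 = 1 := (h1 _ hmem).self_of_nhds
    rw [forcing_eq hq.1 (hW.small q.1 hq q.2), h2]
    ring

/-- The bootstrap: the kernels `K` and `ΔK` each gain a derivative. The induction is over all
cutoffs at once, since the localised equation involves `θ'` and the forcing uses further cutoffs. -/
lemma IsMild.reg_BL (hW : IsMild l b T w W) (m : ℕ) (hθ : IsCutoff T θ) :
    Reg timeAxis BL m (timeMul θ W) := by
  induction m generalizing θ with
  | zero =>
    obtain ⟨M, hM⟩ := hW.bdd
    obtain ⟨M₁, h1⟩ := hθ.deriv.bddMeas_timeMul hM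
    obtain ⟨M₂, h2⟩ := hθ.bddMeas_timeMul (hM.forcing l b)
    rw [hW.timeMul_eq hθ]
    exact (BL_conv (integrable_heatKer hW.pos zero_le_one) h1 (hθ.deriv.L2Bdd_timeMul hW.l2)).add
      (BL_conv (integrable_heatKer hW.pos le_rfl) h2 (hθ.L2Bdd_timeMul (hW.l2.forcing l b)))
  | succ m ih =>
    rw [hW.timeMul_eq hθ]
    refine Reg.add (fun _ _ => BL.add) (Reg_conv_ker hW.pos (by norm_num) _ (ih hθ.deriv))
      (Reg_conv_ker hW.pos (by norm_num) _ ?_)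
    exact hW.reg_forcing isAlg_BC (fun _ _ => BL.add) (fun _ h => h.1) (fun _ _ => BC.mul_BL)
      ((BC_kink b).comp_snd) (fun θ hθ => ih hθ) hθ

/-- The localised forcing of the localised solution. -/
def localForcing (l b : ℝ) (θ : ℝ → ℝ) (W : ℝ × Strip n → ℝ) : ℝ × Strip n → ℝ :=
  timeMul (deriv θ) W + lap timeAxis (timeMul θ (forcing l b W))

lemma IsMild.reg_forcing_BC (hW : IsMild l b T w W) (m : ℕ) (hθ : IsCutoff T θ) :
    Reg timeAxis BC m (timeMul θ (forcing l b W)) :=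
  hW.reg_forcing isAlg_BC (fun _ _ => BC.add) (fun _ h => h) (fun _ _ => BC.mul)
    ((BC_kink b).comp_snd) (fun _ hθ => (hW.reg_BL m hθ).imp fun _ h => h.1) hθ

lemma IsMild.reg_localForcing (hW : IsMild l b T w W) (m : ℕ) (hθ : IsCutoff T θ) :
    Reg timeAxis BC m (localForcing l b θ W) :=
  Reg.add isAlg_BC.add ((hW.reg_BL m hθ.deriv).imp fun _ h => h.1)
    (isAlg_BC.reg_lap (hW.reg_forcing_BC (m + 2) hθ))

/-- With spatial regularity known, the Laplacian moves from the kernel to the forcing. Only `K`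
remains, for which the forced equation is available. -/
lemma IsMild.timeMul_eq_conv (hW : IsMild l b T w W) (hθ : IsCutoff T θ) :
    timeMul θ W = conv (timeCoverHom n) (heatKer n l 0) (localForcing l b θ W) := by
  obtain ⟨M₁, h1⟩ := (hW.reg_BL 0 hθ.deriv).base.1.bddMeas
  obtain ⟨M₂, h2⟩ := (isAlg_BC.reg_lap (m := 0) (hW.reg_forcing_BC 2 hθ)).base.bddMeas
  rw [localForcing, conv_add_fun isOpenQuotientMap_timeCoverHom.continuous
    (integrable_heatKer hW.pos zero_le_one) h1 h2,
    ← conv_heatKer_one hW.pos (hW.reg_forcing_BC 2 hθ)]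
  exact hW.timeMul_eq hθ

lemma lap_const_zero {X ι : Type*} [AddCommGroup X] [Fintype ι] (γ : ι → ℝ → X) :
    lap γ (fun _ => 0) = 0 := by
  have h : ∀ i, pd γ i (fun _ => (0 : ℝ)) = fun _ => 0 := fun i => (hasDir_const (γ i) 0).pd_eq
  ext x
  simp [lap, h]

lemma localForcing_of_nonpos (hθ : IsCutoff T θ) {t : ℝ} (ht : t ≤ 0) (x : Strip n) :
    localForcing l b θ W (t, x) = 0 := by
  have hn : t ∉ Ioo 0 T := fun h => absurd h.1 (not_lt.2 ht)
  have h1 := congrFun (lap_timeAxis (timeMul θ (forcing l b W)) t) x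
  have h2 : (fun x => timeMul θ (forcing l b W) (t, x)) = fun _ => 0 :=
    funext fun x => by simp [timeMul, hθ.eq_zero hn]
  rw [h2, lap_const_zero] at h1
  rw [localForcing, Pi.add_apply, timeMul, hθ.deriv.eq_zero hn, zero_mul, zero_add, h1]
  rfl

/-- Induction on the joint order: forcing of class `C^k`, with all spatial derivatives, produces a
solution of class `C^{k+1}`. Order zero is `IsMild.reg_BL`. -/
lemma IsMild.reg_CK (hW : IsMild l b T w W) (k m : ℕ) (hθ : IsCutoff T θ) :
    Reg timeAxis (CK k) m (timeMul θ W) := by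
  induction k generalizing m θ with
  | zero => exact (hW.reg_BL m hθ).imp fun _ h => CK_zero_of_continuous h.1.1
  | succ k ih =>
    have hA := isAlg_CK (n := n) k
    rw [hW.timeMul_eq_conv hθ]
    refine Reg_CK_conv hW.pos m (fun m => hW.reg_localForcing m hθ)
      (fun t ht x => localForcing_of_nonpos hθ ht x) (fun m => ?_) fun m => ?_
    · exact Reg.add hA.add (ih m hθ.deriv) (hA.reg_lap (hW.reg_forcing hA hA.add (fun _ h => h)
        hA.mul (CK_kink k b) (fun θ hθ => ih (m + 2) hθ) hθ))
    · rw [← hW.timeMul_eq_conv hθ]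
      exact ih m hθ

/-- The localised equation. -/
lemma IsMild.hasDir_timeMul (hW : IsMild l b T w W) (hθ : IsCutoff T θ) :
    HasDir (timeShift n) (timeMul θ W)
      (localForcing l b θ W - damped timeAxis l (timeMul θ W)) := by
  have h := hasDir_time_conv_heatKer hW.pos (hW.reg_localForcing 4 hθ)
    (fun t ht x => localForcing_of_nonpos hθ ht x)
  rwa [← damped_conv (integrable_heatKer hW.pos zero_le_one) l (hW.reg_localForcing 4 hθ),
    ← hW.timeMul_eq_conv hθ] at h

lemma exists_cutoff_point {t : ℝ} (ht : t ∈ Ioo 0 T) :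
    ∃ θ, IsCutoff T θ ∧ θ =ᶠ[𝓝 t] 1 := by
  obtain ⟨θ, h1, h2⟩ := exists_cutoff (isCompact_singleton (x := t)) (singleton_subset_iff.2 ht)
  exact ⟨θ, h1, h2 t rfl⟩

lemma slice_timeMul {f : ℝ × Strip n → ℝ} {t : ℝ} (h : θ t = 1) :
    (fun x => timeMul θ f (t, x)) = fun x => f (t, x) := by
  ext x
  rw [timeMul, h, one_mul]

lemma IsMild.reg_slice (hW : IsMild l b T w W) (m : ℕ) {t : ℝ} (ht : t ∈ Ioo 0 T) :
    Reg axis (fun f => BC f ∧ MemLp f 2 volume) m fun x => W (t, x) := by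
  obtain ⟨θ, hθ, h1⟩ := exists_cutoff_point ht
  rw [← slice_timeMul h1.self_of_nhds]
  refine (hW.reg_BL m hθ).slice fun f hf => ⟨hf.1.slice t, ?_⟩
  obtain ⟨C, hC, h⟩ := hf.2
  exact ⟨(hf.1.slice t).1.aestronglyMeasurable, (h t).trans_lt hC.lt_top⟩

lemma IsMild.reg_forcing_slice (hW : IsMild l b T w W) (m : ℕ) {t : ℝ} (ht : t ∈ Ioo 0 T) :
    Reg axis BC m fun x => forcing l b W (t, x) := by
  obtain ⟨θ, hθ, h1⟩ := exists_cutoff_point ht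
  rw [← slice_timeMul h1.self_of_nhds]
  exact (hW.reg_forcing_BC m hθ).slice fun f hf => hf.slice t

lemma IsMild.contDiffAt (hW : IsMild l b T w W) (p : ℝ × Cover n) (hp : p.1 ∈ Ioo 0 T) :
    ContDiffAt ℝ ∞ (fun p => W (timeCoverHom n p)) p := by
  obtain ⟨θ, hθ, h1⟩ := exists_cutoff_point hp
  have h2 : ContDiff ℝ ∞ fun p => timeMul θ W (timeCoverHom n p) :=
    contDiff_infty.2 fun k => (hW.reg_CK k 0 hθ).base
  refine h2.contDiffAt.congr_of_eventuallyEq ?_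
  filter_upwards [continuous_fst.continuousAt.eventually h1] with p' hp'
  rw [timeMul]
  exact ((congrArg (· * _) hp').trans (one_mul _)).symm

/-- The damped equation. -/
lemma IsMild.hasDerivAt (hW : IsMild l b T w W) {t : ℝ} (ht : t ∈ Ioo 0 T) (x : Strip n) :
    HasDerivAt (fun s => W (s, x)) (lap axis (fun x => forcing l b W (t, x)) x -
      damped axis l (fun x => W (t, x)) x) t := by
  obtain ⟨θ, hθ, h1⟩ := exists_cutoff_point ht
  have hone : IsOneParam (timeShift n) := fun s r => by simp [timeShift]
  have h2 := (hW.hasDir_timeMul hθ).hasDerivAt hone (0, x) t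
  have h3 : ∀ s, ((0, x) : ℝ × Strip n) + timeShift n s = (s, x) := fun s => by simp [timeShift]
  simp only [h3] at h2
  refine (h2.congr_of_eventuallyEq ?_).congr_deriv ?_
  · filter_upwards [h1] with s hs
    rw [timeMul]
    exact ((congrArg (· * _) hs).trans (one_mul _)).symm
  · have h4 : deriv θ t = 0 := by
      rw [h1.deriv_eq]
      exact deriv_const t (1 : ℝ)
    rw [Pi.sub_apply, localForcing, Pi.add_apply, timeMul, h4, zero_mul, zero_add,
      congrFun (lap_timeAxis _ t) x, congrFun (damped_timeAxis l _ t) x,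
      slice_timeMul h1.self_of_nhds, slice_timeMul h1.self_of_nhds]

end Mild

end CahnHilliard

end

noncomputable section

set_option linter.unusedSectionVars false

namespace CahnHilliard

variable {n : ℕ}

/-! ### Attainment of the initial datum -/

lemma measurable_eLpNorm_two {Z Y : Type*} [MeasurableSpace Z] [MeasurableSpace Y]
    {ν : Measure Y} [SFinite ν] {F : Z → Y → ℝ} (hF : Measurable (Function.uncurry F)) :
    Measurable fun z => eLpNorm (F z) 2 ν := by
  simp_rw [eLpNorm_eq_lintegral_rpow_enorm_toReal (two_ne_zero) (ENNReal.ofNat_ne_top),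
    ENNReal.toReal_ofNat]
  exact (Measurable.lintegral_prod_right' (hF.enorm.pow_const _)).pow_const _

/-- Minkowski's inequality for superpositions, with variable norms. -/
lemma eLpNorm_integral_le_integral {Z Y : Type*} [MeasurableSpace Z] [MeasurableSpace Y]
    {μ : Measure Z} {ν : Measure Y} [SFinite μ] [SFinite ν] {k : Z → ℝ} {F : Z → Y → ℝ}
    {g : Z → ℝ} (hk : Integrable k μ) (hF : Measurable (Function.uncurry F)) (hg : Measurable g)
    (hg0 : ∀ z, 0 < g z) {M : ℝ} (hgM : ∀ z, g z ≤ M)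
    (hFg : ∀ z, eLpNorm (F z) 2 ν ≤ ENNReal.ofReal (g z)) :
    eLpNorm (fun x => ∫ z, k z * F z x ∂μ) 2 ν ≤ ENNReal.ofReal (∫ z, |k z| * g z ∂μ) := by
  have hkg : Integrable (fun z => k z * g z) μ :=
    hk.mul_bdd (c := M) hg.aestronglyMeasurable (Eventually.of_forall fun z => by
      rw [Real.norm_of_nonneg (hg0 z).le]
      exact hgM z)
  -- Normalising `F` by the positive bound `g` and moving `g` into the kernel reduces to the case of
  -- a uniform bound.
  have h := eLpNorm_integral_le (ν := ν) (F := fun z x => (g z)⁻¹ * F z x) (C := 1) hkg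
    ((hg.comp measurable_fst).inv.mul hF) fun z => ?_
  · have h1 : ∀ z, |k z * g z| = |k z| * g z := fun z => by rw [abs_mul, abs_of_pos (hg0 z)]
    simp_rw [h1, mul_one] at h
    refine le_of_eq_of_le ?_ h
    congr 1
    ext x
    congr 1
    ext z
    have := (hg0 z).ne'
    field_simp
  · refine (eLpNorm_le_mul_eLpNorm_of_ae_le_mul (c := (g z)⁻¹) (g := F z)
      (Eventually.of_forall fun x => ?_) 2).trans ?_
    · rw [norm_mul, norm_inv, Real.norm_of_nonneg (hg0 z).le]
    · calc _ ≤ ENNReal.ofReal (g z)⁻¹ * ENNReal.ofReal (g z) := by gcongr; exact hFg z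
        _ = 1 := by
          rw [← ENNReal.ofReal_mul (inv_nonneg.2 (hg0 z).le), inv_mul_cancel₀ (hg0 z).ne',
            ENNReal.ofReal_one]

lemma conv_heat_sub (f : Strip n → ℝ) {M : ℝ} (hf : BddMeas f M) {t : ℝ} (ht : 0 < t)
    (x : Strip n) : conv (coverHom n) (heat n 0 t) f x - f x =
      ∫ y, heat n 0 1 y * (f (x - coverHom n ((scale t)⁻¹ • y)) - f x) := by
  rw [conv]
  simp_rw [heat_eq_slice 0 ht]
  rw [integral_slice_comp _ _ (scale_pos ht) (fun y => f (x - coverHom n y))]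
  simp_rw [mul_sub]
  rw [integral_sub _ ((heat n 0 1).integrable.mul_const _), integral_mul_const,
    integral_heat one_pos]
  · simp
  · refine (heat n 0 1).integrable.mul_bdd (c := M) ?_ (Eventually.of_forall fun _ => hf.bdd _)
    exact ((measurable_comp_sub continuous_coverHom hf.meas x).comp
      (measurable_const_smul _)).aestronglyMeasurable

/-- The heat kernels are an approximate identity in `L²`. -/
lemma tendsto_eLpNorm_conv_heat {f : Strip n → ℝ} {M : ℝ} (hf : BddMeas f M)
    (h2 : MemLp f 2 volume) :
    Tendsto (fun t => eLpNorm (fun x => conv (coverHom n) (heat n 0 t) f x - f x) 2 volume)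
      (𝓝[>] 0) (𝓝 0) := by
  have hm := continuous_coverHom (n := n) |>.measurable
  let N : Strip n → ℝ≥0∞ := fun h => eLpNorm (fun x => f (x + h) - f x) 2 volume
  have hNm : Measurable N := by
    refine measurable_eLpNorm_two ?_
    exact (hf.meas.comp (measurable_snd.add measurable_fst)).sub (hf.meas.comp measurable_snd)
  have hNle : ∀ h, N h ≤ eLpNorm f 2 volume + eLpNorm f 2 volume := fun h => by
    have hmp := measurePreserving_add_right (volume : Measure (Strip n)) h
    have h3 := eLpNorm_comp_measurePreserving (p := 2) h2.1 hmp
    refine (eLpNorm_sub_le (f := fun x => f (x + h)) (g := f) ?_ h2.1 (by norm_num)).trans ?_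
    · exact h2.1.comp_measurePreserving hmp
    · exact add_le_add h3.le le_rfl
  have hNfin : ∀ h, N h ≠ ⊤ := fun h =>
    ((hNle h).trans_lt (ENNReal.add_lt_top.2 ⟨h2.2, h2.2⟩)).ne
  have hN0 : Tendsto (fun h => (N h).toReal) (𝓝 0) (𝓝 0) := by
    have := tendsto_eLpNorm_translate (p := 2) ENNReal.ofNat_ne_top h2
    exact (ENNReal.tendsto_toReal ENNReal.zero_ne_top).comp this
  set D : ℝ := (eLpNorm f 2 volume + eLpNorm f 2 volume).toReal with hD
  have hND : ∀ h, (N h).toReal ≤ D := fun h =>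
    ENNReal.toReal_mono (ENNReal.add_lt_top.2 ⟨h2.2, h2.2⟩).ne (hNle h)
  -- The summand `t` makes the majorant strictly positive, as the preceding Minkowski inequality
  -- requires, and vanishes in the limit.
  let g : ℝ → Cover n → ℝ := fun t y => (N (-coverHom n ((scale t)⁻¹ • y))).toReal + t
  have hgm : ∀ t, Measurable (g t) := fun t =>
    (hNm.comp ((hm.comp (measurable_const_smul _)).neg)).ennreal_toReal.add_const t
  have hlim : Tendsto (fun t => ∫ y, |heat n 0 1 y| * g t y) (𝓝[>] 0)
      (𝓝 (∫ y : Cover n, |heat n 0 1 y| * 0)) := by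
    refine tendsto_integral_filter_of_dominated_convergence
      (fun y => |heat n 0 1 y| * (D + 1)) ?_ ?_ ((heat n 0 1).integrable.abs.mul_const _) ?_
    · exact Eventually.of_forall fun t =>
        ((heat n 0 1).continuous.measurable.abs.mul (hgm t)).aestronglyMeasurable
    · filter_upwards [Ioo_mem_nhdsGT (zero_lt_one' ℝ)] with t ht
      refine Eventually.of_forall fun y => ?_
      rw [norm_mul, Real.norm_eq_abs, abs_abs]
      gcongr
      rw [Real.norm_of_nonneg (add_nonneg ENNReal.toReal_nonneg ht.1.le)]
      exact add_le_add (hND _) ht.2.le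
    · refine Eventually.of_forall fun y => Tendsto.const_mul _ ?_
      have h1 : Tendsto (fun t : ℝ => -coverHom n ((scale t)⁻¹ • y)) (𝓝[>] 0)
          (𝓝 (-coverHom n ((0 : ℝ) • y))) :=
        ((continuous_coverHom.tendsto _).comp (tendsto_inv_scale.smul_const y)).neg
      rw [zero_smul, map_zero, neg_zero] at h1
      have h4 := (hN0.comp h1).add (tendsto_nhdsWithin_of_tendsto_nhds (s := Ioi 0)
        (tendsto_id (α := ℝ) (x := 𝓝 0)))
      rw [add_zero] at h4
      exact h4
  simp only [mul_zero, integral_zero] at hlim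
  have hlim' := ENNReal.tendsto_ofReal hlim
  rw [ENNReal.ofReal_zero] at hlim'
  refine tendsto_of_tendsto_of_tendsto_of_le_of_le' tendsto_const_nhds hlim'
    (Eventually.of_forall fun _ => zero_le) ?_
  filter_upwards [Ioo_mem_nhdsGT (zero_lt_one' ℝ)] with t ht
  simp_rw [conv_heat_sub f hf ht.1]
  refine eLpNorm_integral_le_integral (M := D + 1) (heat n 0 1).integrable ?_ (hgm t)
    (fun y => add_pos_of_nonneg_of_pos ENNReal.toReal_nonneg ht.1)
    (fun y => add_le_add (hND _) ht.2.le) fun y => ?_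
  · refine Measurable.sub (hf.meas.comp ?_) (hf.meas.comp measurable_snd)
    exact measurable_snd.sub (hm.comp ((measurable_const_smul _).comp measurable_fst))
  · have h5 : N (-coverHom n ((scale t)⁻¹ • y)) ≤ ENNReal.ofReal (g t y) := by
      rw [← ENNReal.ofReal_toReal (hNfin (-coverHom n ((scale t)⁻¹ • y)))]
      exact ENNReal.ofReal_le_ofReal (le_add_of_nonneg_right ht.1.le)
    simpa only [N, ← sub_eq_add_neg] using h5

lemma exp_mul_freeEvolution (l : ℝ) (f : Strip n → ℝ) {t : ℝ} (ht : 0 < t) (x : Strip n) :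
    Real.exp (l * t) * freeEvolution l f (t, x) = conv (coverHom n) (heat n 0 t) f x := by
  rw [freeEvolution, conv, conv, ← integral_const_mul]
  congr 1
  ext y
  rw [heatKer_of_pos l 0 ht, ← mul_assoc, ← mul_assoc, ← Real.exp_add, add_neg_cancel,
    Real.exp_zero, one_mul]

/-- The forced part vanishes in `L²` as `t → 0`. -/
lemma tendsto_eLpNorm_conv_zero {k : ℝ × Cover n → ℝ} (hk : Integrable k)
    (hk0 : ∀ t ≤ 0, ∀ y, k (t, y) = 0) {N : ℝ × Strip n → ℝ} (hN : Measurable N)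
    (h2 : L2Bdd N) (hN0 : ∀ t ≤ 0, ∀ x, N (t, x) = 0) :
    Tendsto (fun t => eLpNorm (fun x => conv (timeCoverHom n) k N (t, x)) 2 volume) (𝓝[>] 0)
      (𝓝 0) := by
  obtain ⟨C, hC, h2⟩ := h2
  -- Since `N` vanishes at nonpositive times, only kernel ages below `t` contribute at time `t`.
  let S : ℝ → Set (ℝ × Cover n) := fun t => {q | q.1 < t}
  have hS : ∀ t, MeasurableSet (S t) := fun t => measurableSet_lt measurable_fst measurable_const
  have hle : ∀ t, eLpNorm (fun x => conv (timeCoverHom n) k N (t, x)) 2 volume ≤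
      ENNReal.ofReal (∫ q, |(S t).indicator k q|) * C := by
    intro t
    refine le_of_eq_of_le ?_ (eLpNorm_conv_time_le (hk.indicator (hS t)) hN h2 t)
    congr 1
    ext x
    rw [conv, conv]
    congr 1
    ext q
    by_cases hq : q.1 < t
    · rw [indicator_of_mem (show q ∈ S t from hq)]
    · rw [indicator_of_notMem (show q ∉ S t from hq), timeCoverHom_apply, Prod.mk_sub_mk,
        hN0 _ (sub_nonpos.2 (not_lt.1 hq)), mul_zero, zero_mul]
  have hlim : Tendsto (fun t => ∫ q, |(S t).indicator k q|) (𝓝[>] 0)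
      (𝓝 (∫ _ : ℝ × Cover n, (0 : ℝ))) := by
    refine tendsto_integral_filter_of_dominated_convergence (fun q => |k q|)
      (Eventually.of_forall fun t => (hk.indicator (hS t)).abs.1)
      (Eventually.of_forall fun t => Eventually.of_forall fun q => ?_) hk.abs
      (Eventually.of_forall fun q => ?_)
    · rw [Real.norm_eq_abs, abs_abs]
      exact norm_indicator_le_norm_self k q
    · rcases le_or_gt q.1 0 with h | h
      · refine tendsto_const_nhds.congr fun t => ?_
        obtain ⟨s, y⟩ := q
        rw [eq_comm, abs_eq_zero]
        exact indicator_apply_eq_zero.2 fun _ => hk0 s h y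
      · refine tendsto_const_nhds.congr' ?_
        filter_upwards [Ioo_mem_nhdsGT h] with t ht
        rw [indicator_of_notMem (show q ∉ S t from not_lt.2 ht.2.le), abs_zero]
  rw [integral_zero] at hlim
  have h3 := ENNReal.Tendsto.mul_const (b := C) (ENNReal.tendsto_ofReal hlim) (Or.inr hC)
  rw [ENNReal.ofReal_zero, zero_mul] at h3
  exact tendsto_of_tendsto_of_tendsto_of_le_of_le tendsto_const_nhds h3 (fun _ => zero_le) hle

/-- For `t > 0` the free part is `K_t * w`, an approximate identity in `L²`; the forced part sees
only a vanishing portion of the kernel mass. -/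
lemma IsMild.tendsto_eLpNorm {l b T : ℝ} {w : Strip n → ℝ} {W : ℝ × Strip n → ℝ}
    (hW : IsMild l b T w W) (hw : MemLp w 2 volume) :
    Tendsto (fun t => eLpNorm (fun x => Real.exp (l * t) * W (t, x) - w x) 2 volume) (𝓝[>] 0)
      (𝓝 0) := by
  obtain ⟨M, hM⟩ := hW.bdd
  obtain ⟨M₀, hM₀⟩ := hW.datum
  have hk := integrable_heatKer (n := n) hW.pos (j := 1) le_rfl
  have hN := hM.forcing l b
  have h1 := tendsto_eLpNorm_conv_heat hM₀ hw
  have h2 := tendsto_eLpNorm_conv_zero hk (fun t ht y => heatKer_of_nonpos l 1 ht y) hN.meas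
    (hW.l2.forcing l b) (fun t ht x => by simp [CahnHilliard.forcing, not_lt.2 ht])
  have h3 : Tendsto (fun t : ℝ => ENNReal.ofReal (Real.exp (l * t))) (𝓝[>] 0) (𝓝 1) := by
    have h := (by fun_prop : Continuous fun t : ℝ => Real.exp (l * t)).tendsto 0
    have := ENNReal.tendsto_ofReal (h.mono_left (nhdsWithin_le_nhds (s := Ioi 0)))
    simpa using this
  have h4 := h1.add (ENNReal.Tendsto.mul h3 (Or.inl one_ne_zero) h2 (Or.inr ENNReal.one_ne_top))
  rw [mul_zero, add_zero] at h4
  refine tendsto_of_tendsto_of_tendsto_of_le_of_le' tendsto_const_nhds h4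
    (Eventually.of_forall fun _ => zero_le) ?_
  filter_upwards [self_mem_nhdsWithin] with t ht
  set Bt : Strip n → ℝ := fun x =>
    conv (timeCoverHom n) (heatKer n l 1) (CahnHilliard.forcing l b W) (t, x) with hBt
  have hBc : Continuous Bt :=
    (continuous_conv isOpenQuotientMap_timeCoverHom hk hN).comp (by fun_prop)
  have h5 : (fun x => Real.exp (l * t) * W (t, x) - w x) =
      (fun x => conv (coverHom n) (heat n 0 t) w x - w x) + fun x => Real.exp (l * t) * Bt x := by
    ext x
    rw [Pi.add_apply, ← exp_mul_freeEvolution l w ht]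
    conv_lhs => rw [hW.eq]
    rw [Pi.add_apply]
    ring
  rw [h5]
  refine (eLpNorm_add_le ?_ ?_ (by norm_num)).trans (add_le_add le_rfl ?_)
  · refine AEStronglyMeasurable.sub ?_ hw.1
    exact (continuous_conv isOpenQuotientMap_coverHom (heat n 0 t).integrable
      hM₀).aestronglyMeasurable
  · exact (continuous_const.mul hBc).aestronglyMeasurable
  · refine eLpNorm_le_mul_eLpNorm_of_ae_le_mul (Eventually.of_forall fun x => ?_) 2
    rw [norm_mul, Real.norm_eq_abs, Real.abs_exp]

end CahnHilliard

end

noncomputable section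

set_option linter.unusedSectionVars false

namespace CahnHilliard

variable {n : ℕ}

/-! ### The solution -/

lemma laplacian_eq (f : Strip n → ℝ) : laplacian f = lap axis f := by
  ext x
  rw [laplacian, lap, Finset.sum_apply]
  rfl

section Lap

variable {X ι : Type*} [AddCommGroup X] [Fintype ι] {γ : ι → ℝ → X} {P Q : (X → ℝ) → Prop}
  {f g : X → ℝ}

lemma lap_add_of_reg (hf : Reg γ P 2 f) (hg : Reg γ Q 2 g) : lap γ (f + g) = lap γ f + lap γ g := by
  simp only [lap, ← Finset.sum_add_distrib]
  refine Finset.sum_congr rfl fun i _ => ?_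
  rw [((hf.hasDir i).add (hg.hasDir i)).pd_eq, (((hf.pd i).hasDir i).add ((hg.pd i).hasDir i)).pd_eq]

lemma HasDir.const_mul {γ : ℝ → X} {f f' : X → ℝ} (h : HasDir γ f f') (c : ℝ) :
    HasDir γ (fun x => c * f x) fun x => c * f' x := fun x => (h x).const_mul c

lemma lap_const_mul_of_reg (hf : Reg γ P 2 f) (c : ℝ) :
    lap γ (fun x => c * f x) = fun x => c * lap γ f x := by
  ext x
  simp only [lap, Finset.sum_apply, Finset.mul_sum]
  refine Finset.sum_congr rfl fun i _ => ?_
  rw [((hf.hasDir i).const_mul c).pd_eq, (((hf.pd i).hasDir i).const_mul c).pd_eq]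

lemma Reg.const_mul (hP : ∀ c : ℝ, ∀ f, P f → P fun x => c * f x) {m : ℕ} (hf : Reg γ P m f)
    (c : ℝ) : Reg γ P m fun x => c * f x := by
  induction m generalizing f with
  | zero => exact hP c f hf
  | succ m ih =>
    exact Reg.succ_intro (hP c f hf.1) (fun i => (hf.hasDir i).const_mul c) fun i => ih (hf.pd i)

end Lap

lemma BC.const_mul {X : Type*} [TopologicalSpace X] (c : ℝ) (f : X → ℝ) (hf : BC f) :
    BC fun x => c * f x := (BC.const c).mul hf

/-- The stationarity of kinks: differentiating the profile equation gives `Δv = v³ - v = G'(v)`. -/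
lemma lap_kink (b : ℝ) : lap axis (kink (n := n) b) = fun x => kink b x ^ 3 - kink b x := by
  have h1 : ∀ i : Option (Fin n), pd axis i (kink b) =
      fun x => i.elim ((1 - kink b x ^ 2) / √2) fun _ => 0 := fun i => (hasDir_kink b i).pd_eq
  ext x
  simp only [lap, Finset.sum_apply]
  rw [Fintype.sum_option]
  have hsome : ∀ i : Fin n, pd axis (some i) (pd axis (some i) (kink (n := n) b)) x = 0 := by
    intro i
    rw [h1]
    exact congrFun ((hasDir_const (axis (some i)) 0).pd_eq) x
  have hnone : HasDir (axis none) (fun x : Strip n => (1 - kink b x ^ 2) / √2)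
      (fun x => kink b x ^ 3 - kink b x) := by
    intro x
    have h2 := (((hasDir_kink b none x).pow 2).const_sub 1).div_const √2
    refine h2.congr_deriv ?_
    have h4 : (√2 : ℝ) ≠ 0 := by positivity
    simp only [Option.elim, (isOneParam_axis (none : Option (Fin n))).zero, add_zero]
    field_simp
    rw [Real.sq_sqrt zero_le_two]
    push_cast
    ring
  rw [h1 none]
  simp only [hsome, Finset.sum_const_zero, add_zero]
  exact congrFun hnone.pd_eq x

lemma hasDerivAt_doubleWell (s : ℝ) : HasDerivAt doubleWell (s ^ 3 - s) s := by
  have h := ((((hasDerivAt_id s).pow 2).const_sub 1).pow 2).div_const 4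
  refine h.congr_deriv ?_
  simp
  ring

lemma deriv_doubleWell (s : ℝ) : deriv doubleWell s = s ^ 3 - s := (hasDerivAt_doubleWell s).deriv

/-- The function `v_b + e^{lt} W` with initial value `u₀`. -/
def evolution (l b : ℝ) (u₀ : Strip n → ℝ) (W : ℝ × Strip n → ℝ) (t : ℝ) (x : Strip n) : ℝ :=
  if 0 < t then kink b x + Real.exp (l * t) * W (t, x) else u₀ x

lemma evolution_of_pos {l b : ℝ} {u₀ : Strip n → ℝ} {W : ℝ × Strip n → ℝ} {t : ℝ} (ht : 0 < t) :
    evolution l b u₀ W t = kink b + fun x => Real.exp (l * t) * W (t, x) := by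
  ext x
  simp [evolution, ht]

lemma continuous_of_lift {f : Strip n → ℝ} (hf : Continuous fun y => f (toStrip n y)) :
    Continuous f :=
  isOpenQuotientMap_coverHom.isQuotientMap.continuous_iff.2 hf

lemma IsTestFunction.continuous {φ : Strip n → ℝ} (hφ : IsTestFunction φ) : Continuous φ :=
  continuous_of_lift hφ.1.continuous

section Evolution

variable {l b T T' : ℝ} {w u₀ : Strip n → ℝ} {W : ℝ × Strip n → ℝ}

/-- The kink contributes nothing to the chemical potential, and the truncation is inactive on `(0,
T)`. -/
lemma IsMild.chemical_eq (hW : IsMild l b T w W) {t : ℝ} (ht : t ∈ Ioo 0 T) (y : Strip n) :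
    deriv doubleWell (evolution l b u₀ W t y) - laplacian (evolution l b u₀ W t) y =
      Real.exp (l * t) * forcing l b W (t, y) +
        Real.exp (l * t) * (-1 * lap axis (fun x => W (t, x)) y) := by
  have hR := (hW.reg_slice 2 ht).imp fun _ h => h.1
  rw [laplacian_eq, evolution_of_pos ht.1,
    lap_add_of_reg (Reg_kink isAlg_BC (BC_kink b) 2)
      (hR.const_mul BC.const_mul (Real.exp (l * t))),
    lap_const_mul_of_reg hR, lap_kink, deriv_doubleWell]
  have hf : forcing l b W (t, y) = Real.exp (-(l * t)) *
      increment (kink b y) (Real.exp (l * t) * W (t, y)) := by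
    rw [forcing, if_pos ht.1]
    dsimp only
    rw [clamp_eq (hW.small t ht y)]
  rw [hf, ← mul_assoc (Real.exp (l * t)), ← Real.exp_add, add_neg_cancel, Real.exp_zero, one_mul]
  simp only [Pi.add_apply, increment]
  ring

/-- Differentiating `e^{lt}` produces exactly the term that cancels the damping of `W`. -/
lemma IsMild.equation (hW : IsMild l b T w W) {t : ℝ} (ht : t ∈ Ioo 0 T) (x : Strip n) :
    HasDerivAt (fun s => evolution l b u₀ W s x) (laplacian (fun y =>
      deriv doubleWell (evolution l b u₀ W t y) - laplacian (evolution l b u₀ W t) y) x) t := by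
  have hR := (hW.reg_slice 4 ht).imp fun _ h => h.1
  have hL : Reg axis BC 2 (lap axis fun x => W (t, x)) := Reg.lap isAlg_BC.add isAlg_BC.zero hR
  have hN := hW.reg_forcing_slice 2 ht
  have h1 : HasDerivAt (fun s => kink b x + Real.exp (l * s) * W (s, x)) _ t :=
    (((hasDerivAt_id t).const_mul l).exp.mul (hW.hasDerivAt ht x)).const_add (kink b x)
  refine (h1.congr_of_eventuallyEq ?_).congr_deriv ?_
  · filter_upwards [lt_mem_nhds ht.1] with s hs
    rw [evolution_of_pos hs]
    rfl
  · have h2 : (fun y => deriv doubleWell (evolution l b u₀ W t y) -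
        laplacian (evolution l b u₀ W t) y) =
        (fun y => Real.exp (l * t) * forcing l b W (t, y)) +
        fun y => Real.exp (l * t) * (-1 * lap axis (fun x => W (t, x)) y) :=
      funext fun y => hW.chemical_eq ht y
    rw [h2, laplacian_eq, lap_add_of_reg (hN.const_mul BC.const_mul _)
      (Reg.const_mul BC.const_mul (hL.const_mul BC.const_mul (-1)) _), lap_const_mul_of_reg hN,
      lap_const_mul_of_reg (hL.const_mul BC.const_mul (-1)), lap_const_mul_of_reg hL]
    simp only [damped, Pi.add_apply, Pi.mul_apply, id]
    ring

lemma IsMild.tendsto_evolution (hW : IsMild l b T w W) (hw : MemLp w 2 volume)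
    (hu : (fun x => u₀ x - kink b x) =ᵐ[volume] w) :
    Tendsto (fun t => eLpNorm (evolution l b u₀ W t - u₀) 2 volume) (𝓝[>] 0) (𝓝 0) := by
  refine (hW.tendsto_eLpNorm hw).congr' ?_
  filter_upwards [self_mem_nhdsWithin] with t ht
  refine eLpNorm_congr_ae ?_
  filter_upwards [hu] with x hx
  rw [Pi.sub_apply, evolution_of_pos ht, ← hx, Pi.add_apply]
  ring

/-- Convergence in `L²` implies convergence in the sense of distributions. -/
lemma tendsto_integral_mul_of_eLpNorm {u : ℝ → Strip n → ℝ} {φ : Strip n → ℝ}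
    (hφ : Continuous φ) (hφc : HasCompactSupport φ)
    (hu₀ : LocallyIntegrable u₀ volume) (hut : ∀ᶠ t in 𝓝[>] (0 : ℝ), LocallyIntegrable (u t) volume)
    (h : Tendsto (fun t => eLpNorm (u t - u₀) 2 volume) (𝓝[>] 0) (𝓝 0)) :
    Tendsto (fun t => ∫ x, u t x * φ x) (𝓝[>] 0) (𝓝 (∫ x, u₀ x * φ x)) := by
  have h_int : ∀ {f : Strip n → ℝ}, LocallyIntegrable f volume → Integrable fun x => f x * φ x :=
    fun hf => by simpa [mul_comm] using hf.integrable_smul_left_of_hasCompactSupport hφ hφc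
  refine tendsto_integral_of_L1' _ (h_int hu₀).1 (hut.mono fun t ht => h_int ht) ?_
  have hφ2 : eLpNorm φ 2 volume ≠ ⊤ := (hφ.memLp_of_hasCompactSupport hφc).2.ne
  have h1 := ENNReal.Tendsto.mul_const (b := eLpNorm φ 2 volume) h (Or.inr hφ2)
  rw [zero_mul] at h1
  refine tendsto_of_tendsto_of_tendsto_of_le_of_le' tendsto_const_nhds h1
    (Eventually.of_forall fun _ => zero_le) ?_
  filter_upwards [hut] with t ht
  have h2 := eLpNorm_smul_le_mul_eLpNorm (p := 2) (q := 2) (r := 1) (μ := volume)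
    (f := φ) (φ := u t - u₀) hφ.aestronglyMeasurable
    (ht.aestronglyMeasurable.sub hu₀.aestronglyMeasurable)
  refine le_of_eq_of_le ?_ h2
  congr 1
  ext x
  simp [sub_mul]

/-- The strict inequality `T < T'` makes the closed endpoint `T` interior for the mild solution. -/
theorem IsMild.isSolution (hW : IsMild l b T' w W) (hT₀ : 0 < T) (hT : T < T') (hw : MemLp w 2 volume)
    (hu : (fun x => u₀ x - kink b x) =ᵐ[volume] w) : IsSolution T u₀ (evolution l b u₀ W) := by
  have hmem : ∀ t ∈ Ioc 0 T, t ∈ Ioo 0 T' := fun t ht => ⟨ht.1, ht.2.trans_lt hT⟩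
  refine ⟨?_, fun t ht x => (hW.equation (hmem t ht) x).hasDerivWithinAt, ⟨2, ?_⟩, ?_, ?_⟩
  · rintro ⟨t, y⟩ ⟨ht, -⟩
    have h1 : ContDiffAt ℝ ∞ (fun p : ℝ × Cover n => kink b (coverHom n p.2) +
        Real.exp (l * p.1) * W (timeCoverHom n p)) (t, y) := by
      refine ContDiffAt.add ?_ (ContDiffAt.mul (by fun_prop) (hW.contDiffAt (t, y) (hmem t ht)))
      exact (contDiff_infty.2 fun k => CK_kink (n := n) k b).contDiffAt
    refine (h1.congr_of_eventuallyEq ?_).contDiffWithinAt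
    filter_upwards [continuous_fst.continuousAt.eventually (lt_mem_nhds ht.1)] with p hp
    rw [evolution_of_pos hp]
    rfl
  · intro t ht x
    rw [evolution_of_pos ht.1]
    exact (abs_add_le _ _).trans (by
      linarith [abs_kink_le b x, hW.small t (hmem t ht) x])
  · ext x
    simp [evolution]
  · intro φ hφ
    refine tendsto_integral_mul_of_eLpNorm hφ.continuous hφ.2 ?_ ?_ (hW.tendsto_evolution hw hu)
    · have h1 : LocallyIntegrable (fun x => kink b x + w x) volume :=
        (continuous_kink b).locallyIntegrable.add (hw.locallyIntegrable (by norm_num))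
      refine h1.congr ?_
      filter_upwards [hu] with x hx
      rw [← hx]
      ring
    · filter_upwards [Ioo_mem_nhdsGT (hT₀.trans hT)] with t ht
      rw [evolution_of_pos ht.1]
      exact ((continuous_kink b).add
        (continuous_const.mul (hW.reg_slice 0 ht).base.1.1)).locallyIntegrable

end Evolution

end CahnHilliard

end

noncomputable section

set_option linter.unusedSectionVars false

namespace CahnHilliard

variable {n : ℕ}

/-! ### Integration by parts on the strip -/

/-- A function with smooth lift is differentiable, and its derivatives have smooth lifts. -/
lemma hasDir_of_contDiff {V X : Type*} [NormedAddCommGroup V] [NormedSpace ℝ V] [AddCommGroup X]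
    {π : V →+ X} (hπ : Function.Surjective π) {f : X → ℝ} (hf : ContDiff ℝ ∞ fun y => f (π y))
    (e : V) : ∃ f' : X → ℝ, HasDir (fun s : ℝ => π (s • e)) f f' ∧
      ContDiff ℝ ∞ fun y => f' (π y) := by
  have hd : ∀ y, HasDerivAt (fun s : ℝ => f (π y + π (s • e))) (fderiv ℝ (fun y => f (π y)) y e)
      0 := by
    intro y
    have h1 : HasDerivAt (fun s : ℝ => y + s • e) e 0 := by
      simpa using ((hasDerivAt_id (0 : ℝ)).smul_const e).const_add y
    have h2 := ((hf.differentiable (by simp)) (y + (0 : ℝ) • e)).hasFDerivAt.comp_hasDerivAt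
      (0 : ℝ) h1
    simpa [Function.comp_def] using h2
  refine ⟨fun x => deriv (fun s : ℝ => f (x + π (s • e))) 0, fun x => ?_, ?_⟩
  · obtain ⟨y, rfl⟩ := hπ x
    exact (hd y).differentiableAt.hasDerivAt
  · have h3 : (fun y => deriv (fun s : ℝ => f (π y + π (s • e))) 0) =
        fun y => fderiv ℝ (fun y => f (π y)) y e := funext fun y => (hd y).deriv
    rw [h3]
    exact (hf.fderiv_right (m := ∞) (by simp)).clm_apply contDiff_const

/-- Functions on the strip with smooth lift. -/
def SmoothLift (f : Strip n → ℝ) : Prop := ContDiff ℝ ∞ fun y => f (coverHom n y)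

lemma SmoothLift.continuous {f : Strip n → ℝ} (hf : SmoothLift f) : Continuous f :=
  continuous_of_lift (ContDiff.continuous hf)

lemma SmoothLift.hasDir {f : Strip n → ℝ} (hf : SmoothLift f) (i : Option (Fin n)) :
    HasDir (axis i) f (pd axis i f) ∧ SmoothLift (pd axis i f) := by
  obtain ⟨f', h1, h2⟩ := hasDir_of_contDiff isOpenQuotientMap_coverHom.surjective hf (coverBasis i)
  rw [← axis_eq] at h1
  rw [h1.pd_eq]
  exact ⟨h1, h2⟩

lemma SmoothLift.reg {f : Strip n → ℝ} (hf : SmoothLift f) (m : ℕ) : Reg axis SmoothLift m f := by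
  induction m generalizing f with
  | zero => exact hf
  | succ m ih => exact ⟨hf, fun i => ⟨(hf.hasDir i).1, ih (hf.hasDir i).2⟩⟩

lemma IsTestFunction.smoothLift {φ : Strip n → ℝ} (hφ : IsTestFunction φ) : SmoothLift φ := hφ.1

lemma tsupport_pd_subset {X ι : Type*} [AddCommGroup X] [TopologicalSpace X]
    [IsTopologicalAddGroup X] [Fintype ι] {γ : ι → ℝ → X} {i : ι} (hγ : Continuous (γ i))
    (h0 : γ i 0 = 0) (f : X → ℝ) : tsupport (pd γ i f) ⊆ tsupport f := by
  refine closure_minimal (fun x hx => ?_) (isClosed_tsupport f)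
  by_contra h
  refine hx ?_
  have h1 : f =ᶠ[𝓝 x] 0 := notMem_tsupport_iff_eventuallyEq.1 h
  have h2 : Tendsto (fun s => x + γ i s) (𝓝 0) (𝓝 x) := by
    have hc : Continuous fun s => x + γ i s := continuous_const.add hγ
    simpa [h0] using hc.tendsto 0
  have h3 : (fun s => f (x + γ i s)) =ᶠ[𝓝 0] fun _ => 0 := h2.eventually h1
  rw [pd, h3.deriv_eq, deriv_const]

lemma IsTestFunction.pd {φ : Strip n → ℝ} (hφ : IsTestFunction φ) (i : Option (Fin n)) :
    IsTestFunction (pd axis i φ) :=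
  ⟨(hφ.smoothLift.hasDir i).2, hφ.2.of_isClosed_subset (isClosed_tsupport _)
    (tsupport_pd_subset (continuous_axis i) (isOneParam_axis i).zero φ)⟩

lemma IsTestFunction.hasDir {φ : Strip n → ℝ} (hφ : IsTestFunction φ) (i : Option (Fin n)) :
    HasDir (axis i) φ (CahnHilliard.pd axis i φ) := (hφ.smoothLift.hasDir i).1

lemma IsTestFunction.add {φ ψ : Strip n → ℝ} (hφ : IsTestFunction φ) (hψ : IsTestFunction ψ) :
    IsTestFunction (φ + ψ) := ⟨hφ.1.add hψ.1, hφ.2.add hψ.2⟩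

lemma IsTestFunction.neg {φ : Strip n → ℝ} (hφ : IsTestFunction φ) : IsTestFunction (-φ) :=
  ⟨hφ.1.neg, hφ.2.neg⟩

lemma IsTestFunction.zero : IsTestFunction (0 : Strip n → ℝ) :=
  ⟨contDiff_const, HasCompactSupport.zero⟩

lemma IsTestFunction.reg {φ : Strip n → ℝ} (hφ : IsTestFunction φ) (m : ℕ) :
    Reg axis IsTestFunction m φ := by
  induction m generalizing φ with
  | zero => exact hφ
  | succ m ih => exact ⟨hφ, fun i => ⟨hφ.hasDir i, ih (hφ.pd i)⟩⟩

lemma IsTestFunction.lap {φ : Strip n → ℝ} (hφ : IsTestFunction φ) : IsTestFunction (lap axis φ) :=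
  (Reg.lap (m := 0) (fun _ _ => IsTestFunction.add) IsTestFunction.zero (hφ.reg 2)).base

lemma IsTestFunction.integrable_mul {φ f : Strip n → ℝ} (hφ : IsTestFunction φ)
    (hf : Continuous f) : Integrable fun x => φ x * f x :=
  (hφ.continuous.mul hf).integrable_of_hasCompactSupport hφ.2.mul_right

lemma IsTestFunction.integrable {φ : Strip n → ℝ} (hφ : IsTestFunction φ) : Integrable φ :=
  hφ.continuous.integrable_of_hasCompactSupport hφ.2

lemma IsTestFunction.bound {φ : Strip n → ℝ} (hφ : IsTestFunction φ) : ∃ C, ∀ x, |φ x| ≤ C :=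
  hφ.2.exists_bound_of_continuous hφ.continuous

/-- The integral of a derivative vanishes. -/
lemma integral_hasDir_eq_zero (i : Option (Fin n)) {h h' : Strip n → ℝ} (hd : HasDir (axis i) h h')
    (hi : Integrable h) (hi' : Integrable h') (hc : Continuous h') : ∫ x, h' x = 0 := by
  have hax := continuous_axis i
  have h1 : ∀ x, h (x + axis i 1) - h x = ∫ r in (0 : ℝ)..1, h' (x + axis i r) := by
    intro x
    rw [intervalIntegral.integral_eq_sub_of_hasDerivAt
      (fun r _ => HasDir.hasDerivAt (isOneParam_axis i) hd x r)
      ((hc.comp (continuous_const.add hax)).intervalIntegrable _ _), (isOneParam_axis i).zero,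
      add_zero]
  -- Translation invariance kills the integral of a unit increment. By Fubini that integral is an
  -- average over translations of `∫ h'`, hence `∫ h'` itself.
  have h2 : ∫ x, (h (x + axis i 1) - h x) = 0 := by
    rw [integral_sub (hi.comp_add_right _) hi, integral_add_right_eq_self, sub_self]
  simp_rw [h1] at h2
  rw [← intervalIntegral_integral_swap] at h2
  · simp_rw [integral_add_right_eq_self h'] at h2
    simpa using h2
  · have hm : Continuous fun p : ℝ × Strip n => h' (p.2 + axis i p.1) :=
      hc.comp (continuous_snd.add (hax.comp continuous_fst))
    rw [Function.uncurry_def, integrable_prod_iff hm.aestronglyMeasurable]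
    refine ⟨Eventually.of_forall fun r => hi'.comp_add_right (axis i r), ?_⟩
    simp_rw [integral_add_right_eq_self fun x => ‖h' x‖]
    have : IsFiniteMeasure (volume.restrict (uIoc (0 : ℝ) 1)) := by
      rw [uIoc]
      infer_instance
    exact integrable_const _

lemma integral_mul_hasDir {φ f f' : Strip n → ℝ} (hφ : IsTestFunction φ) (i : Option (Fin n))
    (hd : HasDir (axis i) f f') (hf : Continuous f) (hf' : Continuous f') :
    ∫ x, φ x * f' x = -∫ x, pd axis i φ x * f x := by
  have h1 := (hφ.pd i).integrable_mul hf
  have h2 := hφ.integrable_mul hf'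
  have h := integral_hasDir_eq_zero i ((hφ.hasDir i).mul (isOneParam_axis i).zero hd)
    (hφ.integrable_mul hf) (h1.add h2)
    (((hφ.pd i).continuous.mul hf).add (hφ.continuous.mul hf'))
  rw [eq_neg_iff_add_eq_zero, add_comm, ← h]
  exact (integral_add h1 h2).symm

lemma integral_mul_lap {φ f : Strip n → ℝ} (hφ : IsTestFunction φ) (hf : SmoothLift f) :
    ∫ x, φ x * lap axis f x = ∫ x, lap axis φ x * f x := by
  have hr := hf.reg 2
  have hc : ∀ i, Continuous (pd axis i (pd axis i f)) := fun i => ((hr.pd i).pd i).base.continuous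
  simp only [lap, Finset.sum_apply, Finset.mul_sum, Finset.sum_mul]
  rw [integral_finsetSum _ fun i _ => hφ.integrable_mul (hc i),
    integral_finsetSum _ fun i _ => ((hφ.pd i).pd i).integrable_mul hf.continuous]
  refine Finset.sum_congr rfl fun i _ => ?_
  rw [integral_mul_hasDir hφ i ((hr.pd i).hasDir i) (hr.pd i).base.continuous (hc i),
    integral_mul_hasDir (hφ.pd i) i (hr.hasDir i) hf.continuous (hr.pd i).base.continuous, neg_neg]

/-! ### The weak formulation -/

/-- Differentiation under the integral against a compactly supported function. -/
lemma hasDerivAt_integral_mul {f f' : ℝ × Strip n → ℝ} (hf : Continuous f) (hf' : Continuous f')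
    (hd : HasDir (timeShift n) f f') {φ : Strip n → ℝ} (hφ : IsTestFunction φ) (t : ℝ) :
    HasDerivAt (fun t => ∫ x, φ x * f (t, x)) (∫ x, φ x * f' (t, x)) t := by
  have hone : IsOneParam (timeShift n) := fun s r => by simp [timeShift]
  have h3 : ∀ s x, ((0, x) : ℝ × Strip n) + timeShift n s = (s, x) := fun s => by simp [timeShift]
  obtain ⟨C, hC⟩ := ((isCompact_Icc (a := t - 1) (b := t + 1)).prod hφ.2).exists_bound_of_continuousOn
    hf'.continuousOn
  refine (hasDerivAt_integral_of_dominated_loc_of_deriv_le (s := Ioo (t - 1) (t + 1))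
    (F := fun s x => φ x * f (s, x)) (F' := fun s x => φ x * f' (s, x))
    (bound := fun x => |φ x| * C) (Ioo_mem_nhds (by linarith) (by linarith))
    (Eventually.of_forall fun s => (hφ.integrable_mul (hf.comp (by fun_prop))).1)
    (hφ.integrable_mul (hf.comp (by fun_prop))) (hφ.integrable_mul (hf'.comp (by fun_prop))).1
    (Eventually.of_forall fun x s hs => ?_) (hφ.integrable.abs.mul_const C)
    (Eventually.of_forall fun x s hs => ?_)).2
  · rw [norm_mul, Real.norm_eq_abs]
    by_cases hx : x ∈ tsupport φ
    · gcongr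
      exact hC (s, x) ⟨Ioo_subset_Icc_self hs, hx⟩
    · rw [image_eq_zero_of_notMem_tsupport hx]
      simp
  · have := hd.hasDerivAt hone (0, x) s
    simp only [h3] at this
    exact this.const_mul _

/-- Localising in time a function that is smooth on an open time interval. -/
lemma contDiff_timeMul {T : ℝ} {θ : ℝ → ℝ} (hθ : IsCutoff T θ) {f : ℝ × Strip n → ℝ}
    (hf : ContDiffOn ℝ ∞ (fun p => f (timeCoverHom n p)) (Ioo 0 T ×ˢ univ)) :
    ContDiff ℝ ∞ fun p => timeMul θ f (timeCoverHom n p) := by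
  rw [contDiff_iff_contDiffAt]
  intro p
  by_cases hp : p.1 ∈ tsupport θ
  · have h1 : Ioo (0 : ℝ) T ×ˢ (univ : Set (Cover n)) ∈ 𝓝 p :=
      (isOpen_Ioo.prod isOpen_univ).mem_nhds ⟨hθ.support hp, mem_univ _⟩
    exact (hθ.smooth.comp contDiff_fst).contDiffAt.mul (hf.contDiffAt h1)
  · have h1 : θ =ᶠ[𝓝 p.1] 0 := notMem_tsupport_iff_eventuallyEq.1 hp
    refine (contDiffAt_const (c := (0 : ℝ))).congr_of_eventuallyEq ?_
    filter_upwards [continuous_fst.continuousAt.eventually h1] with q hq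
    rw [timeMul]
    exact (congrArg (· * _) hq).trans (zero_mul _)

section Solution

variable {T : ℝ} {u₀ : Strip n → ℝ} {u : ℝ → Strip n → ℝ}

lemma IsSolution.smoothLift (hu : IsSolution T u₀ u) {t : ℝ} (ht : t ∈ Ioc 0 T) :
    SmoothLift (u t) := by
  have h := hu.smooth.comp (contDiff_prodMk_right t).contDiffOn (s := univ)
    fun y _ => ⟨ht, mem_univ _⟩
  exact contDiffOn_univ.1 h

lemma IsSolution.contDiffOn_Ioo (hu : IsSolution T u₀ u) :
    ContDiffOn ℝ ∞ (fun p => (fun q : ℝ × Strip n => u q.1 q.2) (timeCoverHom n p))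
      (Ioo 0 T ×ˢ univ) :=
  hu.smooth.mono (prod_mono Ioo_subset_Ioc_self le_rfl)

lemma IsSolution.hasDerivAt (hu : IsSolution T u₀ u) {t : ℝ} (ht : t ∈ Ioo 0 T) (x : Strip n) :
    HasDerivAt (fun s => u s x)
      (laplacian (fun y => deriv doubleWell (u t y) - laplacian (u t) y) x) t :=
  (hu.equation t (Ioo_subset_Ioc_self ht) x).hasDerivAt (Ioc_mem_nhds ht.1 ht.2)

lemma SmoothLift.lap {f : Strip n → ℝ} (hf : SmoothLift f) : SmoothLift (lap axis f) :=
  (Reg.lap (m := 0) (P := SmoothLift) (fun _ _ h h' => ContDiff.add h h')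
    (contDiff_const (c := (0 : ℝ))) (hf.reg 2)).base

lemma SmoothLift.deriv_doubleWell {f : Strip n → ℝ} (hf : SmoothLift f) :
    SmoothLift fun x => deriv doubleWell (f x) := by
  simp_rw [CahnHilliard.deriv_doubleWell]
  exact ContDiff.sub (ContDiff.pow hf 3) hf

/-- The weak formulation of the equation. -/
lemma IsSolution.weak (hu : IsSolution T u₀ u) {φ : Strip n → ℝ} (hφ : IsTestFunction φ) {t : ℝ}
    (ht : t ∈ Ioo 0 T) :
    HasDerivAt (fun t => ∫ x, φ x * u t x) ((∫ x, lap axis φ x * deriv doubleWell (u t x)) -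
      ∫ x, lap axis (lap axis φ) x * u t x) t := by
  -- A cutoff equal to one near `t` gives a globally smooth function with the same derivative at
  -- `t`.
  obtain ⟨θ, hθ, h1⟩ := exists_cutoff_point ht
  set U : ℝ × Strip n → ℝ := fun q => u q.1 q.2 with hU
  have hsm := contDiff_timeMul (f := U) hθ hu.contDiffOn_Ioo
  obtain ⟨f', hd, hs'⟩ := hasDir_of_contDiff isOpenQuotientMap_timeCoverHom.surjective hsm (1, 0)
  have hshift : (fun s : ℝ => timeCoverHom n (s • (1, 0))) = timeShift n := by
    ext s <;> simp [timeCoverHom_apply, timeShift]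
  rw [hshift] at hd
  have hcont : ∀ {g : ℝ × Strip n → ℝ}, ContDiff ℝ ∞ (fun p => g (timeCoverHom n p)) →
      Continuous g := fun hg =>
    isOpenQuotientMap_timeCoverHom.isQuotientMap.continuous_iff.2 hg.continuous
  have key := hasDerivAt_integral_mul (hcont hsm) (hcont hs') hd hφ t
  have hone : IsOneParam (timeShift n) := fun s r => by simp [timeShift]
  have h3 : ∀ s x, ((0, x) : ℝ × Strip n) + timeShift n s = (s, x) := fun s => by simp [timeShift]
  have hf' : ∀ x, f' (t, x) =
      laplacian (fun y => deriv doubleWell (u t y) - laplacian (u t) y) x := by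
    intro x
    have h4 := hd.hasDerivAt hone (0, x) t
    simp only [h3] at h4
    refine h4.unique ((hu.hasDerivAt ht x).congr_of_eventuallyEq ?_)
    filter_upwards [h1] with s hs
    exact (congrArg (· * _) hs).trans (one_mul _)
  have hut := hu.smoothLift (Ioo_subset_Ioc_self ht)
  refine (key.congr_of_eventuallyEq ?_).congr_deriv ?_
  · filter_upwards [h1] with s hs
    have hs1 : θ s = 1 := hs
    simp only [timeMul, hs1, one_mul, hU]
  · have h5 : SmoothLift fun y => deriv doubleWell (u t y) - lap axis (u t) y :=
      ContDiff.sub hut.deriv_doubleWell hut.lap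
    simp_rw [hf', laplacian_eq]
    rw [integral_mul_lap hφ h5, ← integral_mul_lap hφ.lap hut, ← integral_sub
      (hφ.lap.integrable_mul hut.deriv_doubleWell.continuous)
      (hφ.lap.integrable_mul hut.lap.continuous)]
    simp_rw [mul_sub]

end Solution

end CahnHilliard

end

noncomputable section

set_option linter.unusedSectionVars false

namespace CahnHilliard

variable {n : ℕ}

/-! ### Mollification in space -/

/-- The correlation in space of a function on the strip with a function on space-time. -/
def scorr (ψ : Strip n → ℝ) (f : ℝ × Strip n → ℝ) (q : ℝ × Strip n) : ℝ :=
  ∫ y, ψ y * f (q.1, q.2 + y)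

lemma scorr_eq (ψ : Strip n → ℝ) (f : ℝ × Strip n → ℝ) (t : ℝ) (x : Strip n) :
    scorr ψ f (t, x) = ∫ y, ψ (y - x) * f (t, y) := by
  rw [scorr, ← integral_add_left_eq_self (fun y => ψ (y - x) * f (t, y)) x]
  simp

lemma abs_scorr_le {ψ : Strip n → ℝ} (hψ : Integrable ψ) {f : ℝ × Strip n → ℝ} {t M : ℝ}
    (hf : ∀ x, |f (t, x)| ≤ M) (x : Strip n) : |scorr ψ f (t, x)| ≤ (∫ y, |ψ y|) * M := by
  rw [scorr, ← integral_mul_const]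
  refine norm_integral_le_of_norm_le (f := fun y => ψ y * f (t, x + y)) (hψ.abs.mul_const M)
    (Eventually.of_forall fun y => ?_)
  rw [norm_mul, Real.norm_eq_abs, Real.norm_eq_abs]
  gcongr
  exact hf _

lemma BC_scorr {ψ : Strip n → ℝ} (hψ : Integrable ψ) {f : ℝ × Strip n → ℝ} (hf : BC f) :
    BC (scorr ψ f) := by
  obtain ⟨hc, M, hM⟩ := hf
  refine ⟨continuous_of_dominated (bound := fun y => |ψ y| * M) (fun q => ?_) (fun q => ?_)
    (hψ.abs.mul_const M) (Eventually.of_forall fun y => ?_), _, fun q =>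
    abs_scorr_le hψ (fun x => hM (q.1, x)) q.2⟩
  · exact hψ.1.mul (hc.comp (by fun_prop)).aestronglyMeasurable
  · refine Eventually.of_forall fun y => ?_
    rw [norm_mul, Real.norm_eq_abs, Real.norm_eq_abs]
    gcongr
    exact hM _
  · exact continuous_const.mul (hc.comp (by fun_prop))

/-- After a change of variables the point enters only through `ψ`, which takes all derivatives; `f`
need only be bounded and continuous. -/
lemma hasDir_scorr {ψ : Strip n → ℝ} (hψ : IsTestFunction ψ) {f : ℝ × Strip n → ℝ} (hf : BC f)
    (i : Option (Fin n)) :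
    HasDir (timeAxis i) (scorr ψ f) (scorr (-pd axis i ψ) f) := by
  rintro ⟨t, x⟩
  obtain ⟨hc, M, hM⟩ := hf
  obtain ⟨C, hC⟩ := (hψ.pd i).bound
  have hax := continuous_axis i
  have hM0 : 0 ≤ M := (abs_nonneg _).trans (hM 0)
  have hft : Continuous fun y => f (t, y) := hc.comp (by fun_prop)
  -- A compact set containing the supports of all translates with `|s| ≤ 1`, so that the majorant is
  -- integrable.
  set K : Set (Strip n) := (fun p : Strip n × ℝ => p.1 + (x + axis i p.2)) ''
    (tsupport ψ ×ˢ Icc (-1) 1) with hK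
  have hKc : IsCompact K := (hψ.2.prod isCompact_Icc).image (by fun_prop)
  have hF : ∀ s, Continuous fun y => ψ (y - (x + axis i s)) := fun s =>
    hψ.continuous.comp (by fun_prop)
  have hFi : ∀ s, Integrable fun y => ψ (y - (x + axis i s)) * f (t, y) := fun s =>
    (hψ.integrable.comp_sub_right _).mul_bdd (c := M) hft.aestronglyMeasurable
      (Eventually.of_forall fun y => hM _)
  have hsub : ∀ y s : ℝ, axis (n := n) i (y + s) = axis i y + axis i s := isOneParam_axis i
  have hneg : ∀ s : ℝ, axis (n := n) i (-s) = -axis i s := fun s => by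
    rw [eq_neg_iff_add_eq_zero, ← hsub, neg_add_cancel, (isOneParam_axis i).zero]
  have h := (hasDerivAt_integral_of_dominated_loc_of_deriv_le (s := Ioo (-1 : ℝ) 1) (x₀ := 0)
    (F := fun s y => ψ (y - (x + axis i s)) * f (t, y))
    (F' := fun s y => -pd axis i ψ (y - (x + axis i s)) * f (t, y))
    (bound := K.indicator fun _ => C * M) (Ioo_mem_nhds (by norm_num) (by norm_num))
    (Eventually.of_forall fun s => (hFi s).1) (hFi 0)
    (((hψ.pd i).continuous.comp (by fun_prop)).neg.mul hft).aestronglyMeasurable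
    (Eventually.of_forall fun y s hs => ?_) ?_ (Eventually.of_forall fun y s hs => ?_)).2
  · refine (h.congr_of_eventuallyEq (Eventually.of_forall fun s => ?_)).congr_deriv ?_
    · simp only [timeAxis, Prod.mk_add_mk, add_zero, scorr_eq]
    · rw [scorr_eq]
      simp [(isOneParam_axis i).zero]
  · by_cases hy : y ∈ K
    · rw [indicator_of_mem hy, norm_mul, norm_neg, Real.norm_eq_abs, Real.norm_eq_abs]
      exact mul_le_mul (hC _) (hM _) (abs_nonneg _) ((abs_nonneg _).trans (hC 0))
    · have h0 : y - (x + axis i s) ∉ tsupport (pd axis i ψ) := fun hm =>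
        hy ⟨(y - (x + axis i s), s), ⟨tsupport_pd_subset hax (isOneParam_axis i).zero ψ hm,
          Ioo_subset_Icc_self hs⟩, by simp⟩
      rw [indicator_of_notMem hy, image_eq_zero_of_notMem_tsupport h0]
      simp
  · rw [integrable_indicator_iff hKc.measurableSet]
    exact integrableOn_const hKc.measure_lt_top.ne
  · have h1 := (hψ.hasDir i).hasDerivAt (isOneParam_axis i) (y - x) (-s)
    have h2 := (h1.scomp s (hasDerivAt_neg s)).mul_const (f (t, y))
    refine (h2.congr_of_eventuallyEq (Eventually.of_forall fun r => ?_)).congr_deriv ?_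
    · simp only [Function.comp, hneg]
      congr 2
      abel
    · rw [hneg, neg_one_smul]
      congr 3
      abel

lemma Reg_scorr {ψ : Strip n → ℝ} (hψ : IsTestFunction ψ) {f : ℝ × Strip n → ℝ} (hf : BC f)
    (m : ℕ) : Reg timeAxis BC m (scorr ψ f) := by
  induction m generalizing ψ with
  | zero => exact BC_scorr hψ.integrable hf
  | succ m ih =>
    exact Reg.succ_intro (BC_scorr hψ.integrable hf) (fun i => hasDir_scorr hψ hf i)
      fun i => ih (hψ.pd i).neg

lemma lap_scorr {ψ : Strip n → ℝ} (hψ : IsTestFunction ψ) {f : ℝ × Strip n → ℝ} (hf : BC f) :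
    lap timeAxis (scorr ψ f) = scorr (lap axis ψ) f := by
  ext q
  obtain ⟨hc, M, hM⟩ := hf
  simp only [lap, Finset.sum_apply, scorr, Finset.sum_mul]
  rw [integral_finsetSum]
  · refine Finset.sum_congr rfl fun i _ => ?_
    rw [(hasDir_scorr hψ ⟨hc, M, hM⟩ i).pd_eq, (hasDir_scorr (hψ.pd i).neg ⟨hc, M, hM⟩ i).pd_eq,
      (((hψ.pd i).hasDir i).neg).pd_eq, neg_neg]
    rfl
  · intro i _
    exact ((hψ.pd i).pd i).integrable_mul (hc.comp (by fun_prop))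

/-- Duhamel's formula for regular functions. -/
lemma eq_conv_of_hasDir {l : ℝ} (hl : 0 < l) {Y Y' : ℝ × Strip n → ℝ} (hY : Reg timeAxis BC 4 Y)
    {M : ℝ} (hY' : BddMeas Y' M) (hd : HasDir (timeShift n) Y Y')
    (h0 : ∀ t ≤ 0, ∀ x, Y (t, x) = 0) :
    Y = conv (timeCoverHom n) (heatKer n l 0) (Y' + damped timeAxis l Y) := by
  have hk := integrable_heatKer (n := n) hl zero_le_one
  have hπ := (isOpenQuotientMap_timeCoverHom (n := n)).continuous
  have hone : IsOneParam (timeShift n) := fun s r => by simp [timeShift]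
  obtain ⟨M₀, hM₀⟩ := hY.base.bddMeas
  obtain ⟨M₁, hM₁⟩ := (BC_damped l hY).bddMeas
  -- The time derivative of `K * Y` is computed twice: falling on `Y` it gives `K * Y'`, and by the
  -- equation it is `Y - K * (Δ² + l)Y`.
  rw [conv_add_fun hπ hk hY' hM₁,
    (hasDir_conv_right hπ hone hk hM₀ hY' hd).unique (hasDir_time_conv_heatKer hl hY h0),
    sub_add_cancel]

lemma IsTestFunction.translate {ψ : Strip n → ℝ} (hψ : IsTestFunction ψ) (x : Strip n) :
    IsTestFunction fun y => ψ (y - x) := by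
  refine ⟨?_, hψ.2.comp_homeomorph (Homeomorph.subRight x)⟩
  obtain ⟨a, rfl⟩ := isOpenQuotientMap_coverHom.surjective x
  have h : (fun y => ψ (toStrip n y - coverHom n a)) = fun y => ψ (toStrip n (y - a)) := by
    ext y
    rw [← coverHom_apply, ← map_sub]
    rfl
  rw [h]
  exact hψ.1.comp (contDiff_id.sub contDiff_const)

lemma lap_translate (ψ : Strip n → ℝ) (x : Strip n) :
    lap axis (fun y => ψ (y - x)) = fun y => lap axis ψ (y - x) := by
  have h : ∀ (f : Strip n → ℝ) (i : Option (Fin n)),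
      pd axis i (fun y => f (y - x)) = fun y => pd axis i f (y - x) := by
    intro f i
    ext y
    simp only [pd]
    congr 1
    ext s
    congr 1
    abel
  ext y
  simp only [lap, Finset.sum_apply, h]

/-! ### Uniqueness -/

/-- A weak solution `z` of `z_t = Δ(g - Δz)` with vanishing initial trace. -/
structure IsWeakPair (T : ℝ) (z g : ℝ × Strip n → ℝ) : Prop where
  contz : ContinuousOn z (Ioo 0 T ×ˢ univ)
  contg : ContinuousOn g (Ioo 0 T ×ˢ univ)
  bddz : ∃ M, ∀ t ∈ Ioo 0 T, ∀ x, |z (t, x)| ≤ M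
  bddg : ∃ M, ∀ t ∈ Ioo 0 T, ∀ x, |g (t, x)| ≤ M
  weak : ∀ φ : Strip n → ℝ, IsTestFunction φ → ∀ t ∈ Ioo 0 T,
    HasDerivAt (fun t => ∫ x, φ x * z (t, x)) ((∫ x, lap axis φ x * g (t, x)) -
      ∫ x, lap axis (lap axis φ) x * z (t, x)) t
  initial : ∀ φ : Strip n → ℝ, IsTestFunction φ →
    Tendsto (fun t => ∫ x, φ x * z (t, x)) (𝓝[>] 0) (𝓝 0)

lemma BC_timeMul {T : ℝ} {θ : ℝ → ℝ} (hθ : IsCutoff T θ) {f : ℝ × Strip n → ℝ}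
    (hf : ContinuousOn f (Ioo 0 T ×ˢ univ)) (hb : ∃ M, ∀ t ∈ Ioo 0 T, ∀ x, |f (t, x)| ≤ M) :
    BC (timeMul θ f) := by
  obtain ⟨M, hM⟩ := hb
  obtain ⟨C, hC⟩ := hθ.bound
  refine ⟨continuous_iff_continuousAt.2 fun q => ?_, |C| * |M|, fun q => ?_⟩
  · by_cases hq : q.1 ∈ tsupport θ
    · exact (hθ.smooth.continuous.comp continuous_fst).continuousAt.mul (hf.continuousAt
        ((isOpen_Ioo.prod isOpen_univ).mem_nhds ⟨hθ.support hq, mem_univ _⟩))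
    · have h1 : θ =ᶠ[𝓝 q.1] 0 := notMem_tsupport_iff_eventuallyEq.1 hq
      refine (continuousAt_const (y := (0 : ℝ))).congr ?_
      filter_upwards [continuous_fst.continuousAt.eventually h1] with p hp
      rw [timeMul]
      exact ((congrArg (· * _) hp).trans (zero_mul _)).symm
  · rw [timeMul, abs_mul]
    by_cases hq : q.1 ∈ Ioo 0 T
    · exact mul_le_mul ((hC _).trans (le_abs_self _)) ((hM _ hq q.2).trans (le_abs_self _))
        (abs_nonneg _) (abs_nonneg _)
    · rw [hθ.eq_zero hq, abs_zero, zero_mul]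
      positivity

lemma scorr_timeMul (ψ : Strip n → ℝ) (θ : ℝ → ℝ) (f : ℝ × Strip n → ℝ) :
    scorr ψ (timeMul θ f) = timeMul θ (scorr ψ f) := by
  ext q
  simp only [scorr, timeMul]
  rw [← integral_const_mul]
  congr 1
  ext y
  ring

section WeakPair

variable {T : ℝ} {z g : ℝ × Strip n → ℝ} {ψ : Strip n → ℝ}

/-- Mollification at `x` is testing against the translate of `ψ` to `x`. -/
lemma IsWeakPair.hasDerivAt_scorr (h : IsWeakPair T z g) (hψ : IsTestFunction ψ) {t : ℝ}
    (ht : t ∈ Ioo 0 T) (x : Strip n) :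
    HasDerivAt (fun s => scorr ψ z (s, x))
      (scorr (lap axis ψ) g (t, x) - scorr (lap axis (lap axis ψ)) z (t, x)) t := by
  have h1 := h.weak _ (hψ.translate x) t ht
  rw [lap_translate, lap_translate] at h1
  simpa only [scorr_eq] using h1

lemma IsWeakPair.hasDir_scorr (h : IsWeakPair T z g) (hψ : IsTestFunction ψ) {α : ℝ → ℝ}
    (hα : IsCutoff T α) : HasDir (timeShift n) (scorr ψ (timeMul α z))
      (scorr ψ (timeMul (deriv α) z) + (scorr (lap axis ψ) (timeMul α g) -
        scorr (lap axis (lap axis ψ)) (timeMul α z))) := by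
  rintro ⟨t, x⟩
  suffices H : HasDerivAt (fun s => α s * scorr ψ z (s, x)) (deriv α t * scorr ψ z (t, x) +
      (α t * scorr (lap axis ψ) g (t, x) - α t * scorr (lap axis (lap axis ψ)) z (t, x))) t by
    have h2 : HasDerivAt (fun s => α (t + s) * scorr ψ z (t + s, x)) _ 0 :=
      HasDerivAt.comp_const_add (a := t) (x := 0) (by simpa only [add_zero] using H)
    simp only [scorr_timeMul]
    refine (h2.congr_of_eventuallyEq (Eventually.of_forall fun s => ?_)).congr_deriv ?_
    · simp [timeShift, timeMul]
    · simp [timeMul]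
  by_cases ht : t ∈ tsupport α
  · refine ((hα.hasDerivAt t).mul (h.hasDerivAt_scorr hψ (hα.support ht) x)).congr_deriv ?_
    ring
  · have h1 : α =ᶠ[𝓝 t] 0 := notMem_tsupport_iff_eventuallyEq.1 ht
    have h2 : deriv α t = 0 := by
      rw [h1.deriv_eq]
      exact deriv_const t (0 : ℝ)
    rw [h2, image_eq_zero_of_notMem_tsupport ht]
    refine ((hasDerivAt_const t (0 : ℝ)).congr_of_eventuallyEq ?_).congr_deriv (by simp)
    filter_upwards [h1] with s hs
    exact (congrArg (· * _) hs).trans (zero_mul _)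

/-- The mollified and localised mild formulation. -/
lemma IsWeakPair.scorr_eq_conv (h : IsWeakPair T z g) (hψ : IsTestFunction ψ) {l : ℝ}
    (hl : 0 < l) {θ : ℝ → ℝ} (hθ : IsCutoff T θ) :
    scorr ψ (timeMul (fun t => Real.exp (-(l * t)) * θ t) z) =
      conv (timeCoverHom n) (heatKer n l 0)
        (scorr ψ (timeMul (fun t => Real.exp (-(l * t)) * deriv θ t) z)) +
      conv (timeCoverHom n) (heatKer n l 1)
        (scorr ψ (timeMul (fun t => Real.exp (-(l * t)) * θ t) g)) := by
  have hE : ContDiff ℝ ∞ fun t : ℝ => Real.exp (-(l * t)) := by fun_prop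
  set α := fun t => Real.exp (-(l * t)) * θ t with hαdef
  have hα : IsCutoff T α := hθ.smooth_mul hE
  have hβ : IsCutoff T fun t => Real.exp (-(l * t)) * deriv θ t := hθ.deriv.smooth_mul hE
  -- The term `-lα` will cancel the zeroth-order part of the damped operator.
  have hα' : deriv α = fun t => Real.exp (-(l * t)) * deriv θ t - l * α t := by
    ext t
    have h1 : HasDerivAt (fun t : ℝ => Real.exp (-(l * t))) (Real.exp (-(l * t)) * -(l * 1)) t :=
      ((hasDerivAt_id t).const_mul l).neg.exp
    have h2 : HasDerivAt α _ t := h1.mul (hθ.hasDerivAt t)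
    rw [h2.deriv, hαdef]
    ring
  have hz := BC_timeMul hα h.contz h.bddz
  have hg := BC_timeMul hα h.contg h.bddg
  have hz' := BC_timeMul hβ h.contz h.bddz
  have hd := h.hasDir_scorr hψ hα
  have hRg := Reg_scorr hψ hg 2
  have hRz := Reg_scorr hψ hz 4
  have hk := integrable_heatKer (n := n) hl zero_le_one
  have hlapg : BC (lap timeAxis (scorr ψ (timeMul α g))) := by
    rw [lap_scorr hψ hg]
    exact BC_scorr hψ.lap.integrable hg
  have hY' : BC (scorr ψ (timeMul (deriv α) z) + (scorr (lap axis ψ) (timeMul α g) -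
        scorr (lap axis (lap axis ψ)) (timeMul α z))) := by
    rw [sub_eq_add_neg, ← neg_one_mul]
    exact (BC_scorr hψ.integrable (BC_timeMul hα.deriv h.contz h.bddz)).add
      ((BC_scorr hψ.lap.integrable hg).add
        ((BC.const (-1)).mul (BC_scorr hψ.lap.lap.integrable hz)))
  obtain ⟨M, hM⟩ := hY'.bddMeas
  obtain ⟨M₁, hM₁⟩ := (BC_scorr hψ.integrable hz').bddMeas
  obtain ⟨M₂, hM₂⟩ := hlapg.bddMeas
  have key := eq_conv_of_hasDir hl hRz hM hd fun t ht x => by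
    rw [scorr_timeMul, timeMul, hα.eq_zero fun h => absurd h.1 (not_lt.2 ht), zero_mul]
  rw [conv_heatKer_one hl hRg, ← conv_add_fun isOpenQuotientMap_timeCoverHom.continuous hk hM₁ hM₂]
  refine key.trans ?_
  congr 1
  rw [damped, lap_scorr hψ hz, lap_scorr hψ.lap hz, lap_scorr hψ hg]
  ext q
  simp only [Pi.add_apply, Pi.sub_apply, Pi.mul_apply, scorr_timeMul, timeMul, hα']
  ring

end WeakPair

end CahnHilliard

end

/-! ### The halving estimate for differences of solutions, and concentrated test functions -/

noncomputable section

set_option linter.unusedSectionVars false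

namespace CahnHilliard

variable {n : ℕ}

lemma deriv_smoothTransition_eq_zero {r : ℝ} (hr : r < 0 ∨ 1 < r) :
    deriv Real.smoothTransition r = 0 := by
  rcases hr with hr | hr
  · have h : Real.smoothTransition =ᶠ[𝓝 r] fun _ => 0 := by
      filter_upwards [gt_mem_nhds hr] with s hs
      exact Real.smoothTransition.zero_of_nonpos (le_of_lt hs)
    rw [h.deriv_eq, deriv_const]
  · have h : Real.smoothTransition =ᶠ[𝓝 r] fun _ => 1 := by
      filter_upwards [lt_mem_nhds hr] with s hs
      exact Real.smoothTransition.one_of_one_le (le_of_lt hs)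
    rw [h.deriv_eq, deriv_const]

lemma exists_bound_deriv_smoothTransition : ∃ C, ∀ r, |deriv Real.smoothTransition r| ≤ C := by
  have hc : Continuous (deriv Real.smoothTransition) :=
    (Real.smoothTransition.contDiff (n := 1)).continuous_deriv le_rfl
  obtain ⟨C, hC⟩ := (isCompact_Icc (a := (0 : ℝ)) (b := 1)).exists_bound_of_continuousOn
    hc.continuousOn
  refine ⟨C, fun r => ?_⟩
  by_cases hr : r ∈ Icc (0 : ℝ) 1
  · exact hC r hr
  · rw [deriv_smoothTransition_eq_zero (by rw [mem_Icc, not_and_or] at hr; simpa using hr), abs_zero]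
    exact (norm_nonneg _).trans (hC 0 (by simp))

/-- Cutoffs increasing to one, with controlled derivatives. -/
lemma exists_cutoff_seq {t T : ℝ} (ht : t ∈ Ioo 0 T) : ∃ (θ : ℕ → ℝ → ℝ) (C : ℝ),
    (∀ j, IsCutoff T (θ j)) ∧ (∀ j s, |θ j s| ≤ 1) ∧ (∀ᶠ j in atTop, θ j t = 1) ∧
    (∀ j, ∀ s ∈ Ioc 0 t, |deriv (θ j) s| * s ≤ C) ∧
    (∀ s ∈ Ioc 0 t, ∀ᶠ j in atTop, deriv (θ j) s = 0) := by
  obtain ⟨C, hC⟩ := exists_bound_deriv_smoothTransition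
  have hC0 : 0 ≤ C := (abs_nonneg _).trans (hC 0)
  obtain ⟨h0, hT⟩ := ht
  set a := t + (T - t) / 3 with ha
  set b := t + 2 * (T - t) / 3 with hb
  have hta : t < a := by linarith
  have hab : a < b := by linarith
  have hbT : b < T := by linarith
  -- `κ` switches off between `t` and `T`, while `σ j` switches on for `s` between `1/(j+1)` and
  -- `2/(j+1)`. There the derivative is of order `j + 1`, so its product with `s` stays bounded.
  let κ : ℝ → ℝ := fun s => Real.smoothTransition ((b - s) / (b - a))
  have hκ : ContDiff ℝ ∞ κ := Real.smoothTransition.contDiff.comp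
    ((contDiff_const.sub contDiff_id).div_const _)
  have hκ1 : ∀ s < a, κ s = 1 := fun s hs => Real.smoothTransition.one_of_one_le (by
    rw [le_div_iff₀ (by linarith)]
    linarith)
  have hκ0 : ∀ s, b ≤ s → κ s = 0 := fun s hs => Real.smoothTransition.zero_of_nonpos
    (div_nonpos_of_nonpos_of_nonneg (by linarith) (by linarith))
  let σ : ℕ → ℝ → ℝ := fun j s => Real.smoothTransition (((j : ℝ) + 1) * s - 1)
  have hσ : ∀ j, ContDiff ℝ ∞ (σ j) := fun j => Real.smoothTransition.contDiff.comp
    ((contDiff_const.mul contDiff_id).sub contDiff_const)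
  have hderiv : ∀ j, ∀ s ≤ t, deriv (fun s => σ j s * κ s) s =
      ((j : ℝ) + 1) * deriv Real.smoothTransition (((j : ℝ) + 1) * s - 1) := by
    intro j s hs
    have h1 : (fun s => σ j s * κ s) =ᶠ[𝓝 s] σ j := by
      filter_upwards [gt_mem_nhds (hs.trans_lt hta)] with r hr
      rw [hκ1 r hr, mul_one]
    rw [h1.deriv_eq]
    have h2 : HasDerivAt (fun s : ℝ => ((j : ℝ) + 1) * s - 1) (((j : ℝ) + 1) * 1) s :=
      ((hasDerivAt_id s).const_mul _).sub_const _
    have h3 := ((Real.smoothTransition.contDiff (n := 1)).differentiable one_ne_zero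
      (((j : ℝ) + 1) * s - 1)).hasDerivAt.comp s h2
    rw [show σ j = Real.smoothTransition ∘ fun s : ℝ => ((j : ℝ) + 1) * s - 1 from rfl, h3.deriv]
    ring
  have hlarge : ∀ s : ℝ, 0 < s → ∀ᶠ j : ℕ in atTop, 2 < ((j : ℝ) + 1) * s := by
    intro s hs
    filter_upwards [(tendsto_natCast_atTop_atTop (R := ℝ)).eventually_gt_atTop (2 / s)] with j hj
    rw [div_lt_iff₀ hs] at hj
    nlinarith
  refine ⟨fun j s => σ j s * κ s, 2 * C, fun j => ⟨(hσ j).mul hκ, ?_⟩, fun j s => ?_, ?_,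
    fun j s hs => ?_, fun s hs => ?_⟩
  · have hj : (0 : ℝ) < (j : ℝ) + 1 := by positivity
    have h1 : tsupport (fun s => σ j s * κ s) ⊆ Icc (1 / ((j : ℝ) + 1)) b := by
      refine closure_minimal (fun s hs => ?_) isClosed_Icc
      rw [Function.mem_support] at hs
      refine ⟨?_, ?_⟩
      · by_contra h
        rw [not_le, lt_div_iff₀ hj] at h
        exact hs (by
          change Real.smoothTransition _ * _ = 0
          rw [Real.smoothTransition.zero_of_nonpos (by linarith), zero_mul])
      · by_contra h
        exact hs (by rw [hκ0 s (not_le.1 h).le, mul_zero])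
    exact h1.trans fun s hs => ⟨lt_of_lt_of_le (by positivity) hs.1, hs.2.trans_lt hbT⟩
  · rw [abs_mul, abs_of_nonneg (Real.smoothTransition.nonneg _),
      abs_of_nonneg (Real.smoothTransition.nonneg _)]
    exact mul_le_one₀ (Real.smoothTransition.le_one _) (Real.smoothTransition.nonneg _)
      (Real.smoothTransition.le_one _)
  · filter_upwards [hlarge t h0] with j hj
    rw [hκ1 t hta, mul_one]
    exact Real.smoothTransition.one_of_one_le (by linarith)
  · rw [hderiv j s hs.2, abs_mul, abs_of_pos (by positivity)]
    by_cases hr : 1 < ((j : ℝ) + 1) * s - 1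
    · rw [deriv_smoothTransition_eq_zero (Or.inr hr)]
      simpa using hC0
    · have h1 : ((j : ℝ) + 1) * s ≤ 2 := by linarith
      have h2 := hC (((j : ℝ) + 1) * s - 1)
      have h3 : 0 ≤ ((j : ℝ) + 1) * s := mul_nonneg (by positivity) hs.1.le
      calc _ = (((j : ℝ) + 1) * s) * |deriv Real.smoothTransition (((j : ℝ) + 1) * s - 1)| := by
            ring
        _ ≤ 2 * C := mul_le_mul h1 h2 (abs_nonneg _) (by norm_num)
  · filter_upwards [hlarge s hs.1] with j hj
    rw [hderiv j s hs.2, deriv_smoothTransition_eq_zero (Or.inr (by linarith)), mul_zero]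

section WeakPair

variable {T : ℝ} {z g : ℝ × Strip n → ℝ} {ψ : Strip n → ℝ}

/-- The mollified solution grows at most linearly. -/
lemma IsWeakPair.abs_scorr_le_mul (h : IsWeakPair T z g) (hψ : IsTestFunction ψ) :
    ∃ C, ∀ t ∈ Ioo 0 T, ∀ x, |scorr ψ z (t, x)| ≤ C * t := by
  obtain ⟨M, hM⟩ := h.bddz
  obtain ⟨M', hM'⟩ := h.bddg
  refine ⟨(∫ y, |lap axis ψ y|) * M' + (∫ y, |lap axis (lap axis ψ) y|) * M, fun t ht x => ?_⟩
  set C := (∫ y, |lap axis ψ y|) * M' + (∫ y, |lap axis (lap axis ψ) y|) * M with hC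
  -- The mollification has a bounded time derivative and vanishing initial trace, so the mean value
  -- inequality on `[s, t]` passes to the limit `s → 0`.
  have hlim : Tendsto (fun s => |scorr ψ z (t, x) - scorr ψ z (s, x)|) (𝓝[>] 0)
      (𝓝 |scorr ψ z (t, x) - 0|) := by
    refine (tendsto_const_nhds.sub ?_).abs
    have := h.initial _ (hψ.translate x)
    simpa only [scorr_eq] using this
  rw [sub_zero] at hlim
  have hlim' : Tendsto (fun s : ℝ => C * (t - s)) (𝓝[>] 0) (𝓝 (C * (t - 0))) :=
    ((by fun_prop : Continuous fun s : ℝ => C * (t - s)).tendsto 0).mono_left nhdsWithin_le_nhds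
  rw [sub_zero] at hlim'
  refine le_of_tendsto_of_tendsto hlim hlim' ?_
  filter_upwards [Ioo_mem_nhdsGT ht.1] with s hs
  have hmem : ∀ r ∈ Icc s t, r ∈ Ioo 0 T := fun r hr => ⟨hs.1.trans_le hr.1, hr.2.trans_lt ht.2⟩
  have := Convex.norm_image_sub_le_of_norm_hasDerivWithin_le (𝕜 := ℝ) (s := Icc s t) (C := C)
    (fun r hr => (h.hasDerivAt_scorr hψ (hmem r hr) x).hasDerivWithinAt)
    (fun r hr => (norm_sub_le _ _).trans (add_le_add
      (abs_scorr_le hψ.lap.integrable (hM' r (hmem r hr)) x)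
      (abs_scorr_le hψ.lap.lap.integrable (hM r (hmem r hr)) x)))
    (convex_Icc s t) (left_mem_Icc.2 hs.2.le) (right_mem_Icc.2 hs.2.le)
  rwa [Real.norm_eq_abs, Real.norm_of_nonneg (sub_nonneg.2 hs.2.le)] at this

/-- In the localised Duhamel formula the term with `θ_j'` tends to zero, because `|θ_j'(s)| ≤ C / s`
on `(0, t]` while the mollification is `O(s)`. The forcing term costs the kernel mass times `L`, at
most one half. -/
lemma IsWeakPair.abs_scorr_le_half (h : IsWeakPair T z g) (hψ : IsTestFunction ψ) {l L Λ : ℝ}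
    (hl : 0 < l) (hL : 0 ≤ L) (hl' : (∫ q, |heatKer n l 1 q|) * L ≤ 1 / 2)
    (hg : ∀ t ∈ Ioo 0 T, ∀ x, |g (t, x)| ≤ L * |z (t, x)|)
    (hz : ∀ t ∈ Ioo 0 T, ∀ x, Real.exp (-(l * t)) * |z (t, x)| ≤ Λ) {t : ℝ} (ht : t ∈ Ioo 0 T)
    (x : Strip n) :
    |Real.exp (-(l * t)) * scorr ψ z (t, x)| ≤ (∫ y, |ψ y|) * (Λ / 2) := by
  obtain ⟨θ, C, hθ, hθ1, hθt, hθd, hθ0⟩ := exists_cutoff_seq ht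
  obtain ⟨C', hC'⟩ := h.abs_scorr_le_mul hψ
  have hC0 : 0 ≤ C := (mul_nonneg (abs_nonneg _) ht.1.le).trans (hθd 0 t ⟨ht.1, le_rfl⟩)
  have hC'0 : 0 ≤ C' := by
    have := (abs_nonneg _).trans (hC' t ht x)
    exact nonneg_of_mul_nonneg_left this ht.1
  have hΛ : 0 ≤ Λ := (mul_nonneg (Real.exp_pos _).le (abs_nonneg _)).trans (hz t ht x)
  have hk := integrable_heatKer (n := n) hl zero_le_one
  have hk1 := integrable_heatKer (n := n) hl (j := 1) le_rfl
  have hE : ContDiff ℝ ∞ fun t : ℝ => Real.exp (-(l * t)) := by fun_prop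
  let F : ℕ → ℝ × Strip n → ℝ := fun j =>
    scorr ψ (timeMul (fun t => Real.exp (-(l * t)) * deriv (θ j) t) z)
  have hF : ∀ j q, F j q = Real.exp (-(l * q.1)) * deriv (θ j) q.1 * scorr ψ z q := fun j q => by
    simp only [F, scorr_timeMul, timeMul]
  have hFm : ∀ j, Measurable (F j) := fun j => (BC_scorr hψ.integrable
    (BC_timeMul ((hθ j).deriv.smooth_mul hE) h.contz h.bddz)).1.measurable
  have hFz : ∀ j, ∀ q : ℝ × Strip n, q.1 ≤ 0 → F j q = 0 := fun j q hq => by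
    rw [hF, (hθ j).deriv.eq_zero fun h => absurd h.1 (not_lt.2 hq)]
    ring
  have hFb : ∀ j, ∀ q : ℝ × Strip n, q.1 ≤ t → |F j q| ≤ C * C' := by
    intro j q hq
    rcases le_or_gt q.1 0 with h0 | h0
    · rw [hFz j q h0, abs_zero]
      positivity
    · have hqm : q.1 ∈ Ioo 0 T := ⟨h0, hq.trans_lt ht.2⟩
      rw [hF, abs_mul, abs_mul, Real.abs_exp]
      have h1 : Real.exp (-(l * q.1)) ≤ 1 := Real.exp_le_one_iff.2 (by nlinarith)
      calc _ ≤ 1 * |deriv (θ j) q.1| * (C' * q.1) := by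
            gcongr
            exact hC' q.1 hqm q.2
        _ = (|deriv (θ j) q.1| * q.1) * C' := by ring
        _ ≤ C * C' := by
            gcongr
            exact hθd j q.1 ⟨h0, hq⟩
  -- Dominated convergence: the integrands are uniformly bounded by the kernel, and `θ_j'`
  -- eventually vanishes at each fixed positive time up to `t`.
  have hlim : Tendsto (fun j => conv (timeCoverHom n) (heatKer n l 0) (F j) (t, x)) atTop
      (𝓝 (∫ _ : ℝ × Cover n, (0 : ℝ))) := by
    refine tendsto_integral_of_dominated_convergence (fun q => |heatKer n l 0 q| * (C * C'))
      (fun j => ?_) (hk.abs.mul_const _) (fun j => Eventually.of_forall fun q => ?_)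
      (Eventually.of_forall fun q => ?_)
    · exact hk.1.mul (measurable_comp_sub isOpenQuotientMap_timeCoverHom.continuous (hFm j)
        (t, x)).aestronglyMeasurable
    · obtain ⟨s, y⟩ := q
      rw [norm_mul, Real.norm_eq_abs, Real.norm_eq_abs]
      rcases le_or_gt s 0 with hs | hs
      · simp [heatKer_of_nonpos l 0 hs]
      · gcongr
        exact hFb j _ (by simp [timeCoverHom_apply, hs.le])
    · obtain ⟨s, y⟩ := q
      rcases le_or_gt s 0 with hs | hs
      · simp [heatKer_of_nonpos l 0 hs]
      · rw [← mul_zero (heatKer n l 0 (s, y))]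
        refine Tendsto.const_mul _ (tendsto_const_nhds.congr' ?_)
        rcases le_or_gt (t - s) 0 with h0 | h0
        · exact Eventually.of_forall fun j => (hFz j _ (by simpa [timeCoverHom_apply] using h0)).symm
        · filter_upwards [hθ0 (t - s) ⟨h0, by linarith⟩] with j hj
          rw [hF]
          simp [timeCoverHom_apply, hj]
  rw [integral_zero] at hlim
  have hbound : ∀ j, |conv (timeCoverHom n) (heatKer n l 1)
      (scorr ψ (timeMul (fun t => Real.exp (-(l * t)) * θ j t) g)) (t, x)| ≤
      (∫ y, |ψ y|) * (Λ / 2) := by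
    intro j
    have h1 : ∀ q, |scorr ψ (timeMul (fun t => Real.exp (-(l * t)) * θ j t) g) q| ≤
        (∫ y, |ψ y|) * (L * Λ) := by
      rintro ⟨s, x⟩
      refine abs_scorr_le hψ.integrable (fun x => ?_) x
      simp only [timeMul]
      by_cases hs : s ∈ Ioo 0 T
      · rw [abs_mul, abs_mul, Real.abs_exp]
        calc _ ≤ Real.exp (-(l * s)) * 1 * (L * |z (s, x)|) := by
              gcongr
              · exact hθ1 j s
              · exact hg s hs x
          _ = L * (Real.exp (-(l * s)) * |z (s, x)|) := by ring
          _ ≤ L * Λ := by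
              gcongr
              exact hz s hs x
      · rw [(hθ j).eq_zero hs]
        simp only [mul_zero, zero_mul, abs_zero]
        positivity
    refine (abs_conv_le h1 hk1 (t, x)).trans ?_
    have hψ0 : 0 ≤ ∫ y, |ψ y| := integral_nonneg fun _ => abs_nonneg _
    calc _ = (∫ y, |ψ y|) * (((∫ q, |heatKer n l 1 q|) * L) * Λ) := by ring
      _ ≤ (∫ y, |ψ y|) * (1 / 2 * Λ) := by gcongr
      _ = _ := by ring
  have hfin : ∀ᶠ j in atTop, |Real.exp (-(l * t)) * scorr ψ z (t, x)| ≤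
      |conv (timeCoverHom n) (heatKer n l 0) (F j) (t, x)| + (∫ y, |ψ y|) * (Λ / 2) := by
    filter_upwards [hθt] with j hj
    have h1 := congrFun (h.scorr_eq_conv hψ hl (hθ j)) (t, x)
    rw [scorr_timeMul, timeMul, hj, mul_one, Pi.add_apply] at h1
    rw [h1]
    exact (abs_add_le _ _).trans (add_le_add le_rfl (hbound j))
  have hl2 := (hlim.abs).add_const ((∫ y, |ψ y|) * (Λ / 2))
  rw [abs_zero, zero_add] at hl2
  exact ge_of_tendsto hl2 hfin

end WeakPair

/-! ### Concentrated test functions -/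

/-- A smooth gauge for the distance to the origin of the strip. -/
def gauge (x : Strip n) : ℝ := ∑ i, (1 - ((AddCircle.toCircle (x.1 i) : Circle) : ℂ).re) + x.2 ^ 2

lemma continuous_gauge : Continuous (gauge (n := n)) := by
  unfold gauge
  have h : Continuous fun x : UnitAddCircle => ((AddCircle.toCircle x : Circle) : ℂ).re :=
    Complex.continuous_re.comp (continuous_subtype_val.comp AddCircle.continuous_toCircle)
  refine (continuous_finsetSum _ fun i _ => continuous_const.sub (h.comp ?_)).add (by fun_prop)
  fun_prop

lemma gauge_term_nonneg (x : UnitAddCircle) :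
    0 ≤ 1 - ((AddCircle.toCircle x : Circle) : ℂ).re := by
  have h := Complex.re_le_norm ((AddCircle.toCircle x : Circle) : ℂ)
  rw [Circle.norm_coe] at h
  linarith

lemma gauge_pos {x : Strip n} (hx : x ≠ 0) : 0 < gauge x := by
  have hs : 0 ≤ ∑ i, (1 - ((AddCircle.toCircle (x.1 i) : Circle) : ℂ).re) :=
    Finset.sum_nonneg fun i _ => gauge_term_nonneg _
  by_contra h
  rw [not_lt, gauge] at h
  have h2 : x.2 = 0 := by
    have : x.2 ^ 2 = 0 := le_antisymm (by linarith) (sq_nonneg _)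
    exact pow_eq_zero_iff (two_ne_zero) |>.1 this
  have h1 : ∑ i, (1 - ((AddCircle.toCircle (x.1 i) : Circle) : ℂ).re) = 0 :=
    le_antisymm (by nlinarith [sq_nonneg x.2]) hs
  rw [Finset.sum_eq_zero_iff_of_nonneg fun i _ => gauge_term_nonneg _] at h1
  refine hx (Prod.ext (funext fun i => ?_) h2)
  have h3 : ((AddCircle.toCircle (x.1 i) : Circle) : ℂ).re = 1 := by
    have := h1 i (Finset.mem_univ i)
    linarith
  have h4 : (AddCircle.toCircle (x.1 i) : Circle) = 1 := by
    ext
    have h5 : Complex.normSq ((AddCircle.toCircle (x.1 i) : Circle) : ℂ) = 1 := Circle.normSq_coe _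
    rw [Complex.normSq_apply, h3] at h5
    refine Complex.ext (by simpa using h3) ?_
    have : ((AddCircle.toCircle (x.1 i) : Circle) : ℂ).im *
      ((AddCircle.toCircle (x.1 i) : Circle) : ℂ).im = 0 := by linarith
    simpa using this
  rw [← AddCircle.toCircle_zero (T := 1)] at h4
  exact AddCircle.injective_toCircle one_ne_zero h4

lemma gauge_zero : gauge (0 : Strip n) = 0 := by
  simp [gauge]

lemma isCompact_gauge_le (ε : ℝ) : IsCompact {x : Strip n | gauge x ≤ ε} := by
  have hsub : {x : Strip n | gauge x ≤ ε} ⊆ univ ×ˢ Icc (-√ε) √ε := by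
    intro x hx
    refine ⟨mem_univ _, ?_⟩
    have hs : 0 ≤ ∑ i, (1 - ((AddCircle.toCircle (x.1 i) : Circle) : ℂ).re) :=
      Finset.sum_nonneg fun i _ => gauge_term_nonneg _
    have h1 : x.2 ^ 2 ≤ ε := by
      have : gauge x ≤ ε := hx
      rw [gauge] at this
      linarith
    exact abs_le.1 (Real.abs_le_sqrt h1)
  exact (isCompact_univ.prod isCompact_Icc).of_isClosed_subset
    (isClosed_le continuous_gauge continuous_const) hsub

lemma contDiff_gauge : ContDiff ℝ ∞ fun y => gauge (toStrip n y) := by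
  have h : ∀ y : Cover n, gauge (toStrip n y) =
      ∑ i, (1 - Real.cos (2 * Real.pi * y.1 i)) + y.2 ^ 2 := by
    intro y
    simp only [gauge, toStrip]
    congr 1
    refine Finset.sum_congr rfl fun i _ => ?_
    rw [AddCircle.toCircle_apply_mk, Circle.coe_exp, Complex.exp_ofReal_mul_I_re, div_one]
  simp_rw [h]
  refine (ContDiff.sum fun i _ => contDiff_const.sub (Real.contDiff_cos.comp
    (contDiff_const.mul ?_))).add (contDiff_snd.pow 2)
  exact (contDiff_apply ℝ ℝ i).comp contDiff_fst

/-- Nonnegative test functions concentrated near the origin. -/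
lemma exists_testFunction {U : Set (Strip n)} (hU : U ∈ 𝓝 0) :
    ∃ ψ : Strip n → ℝ, IsTestFunction ψ ∧ (∀ x, 0 ≤ ψ x) ∧ (∀ x ∉ U, ψ x = 0) ∧ 0 < ∫ x, ψ x := by
  obtain ⟨V, hVU, hV, h0⟩ := mem_nhds_iff.1 hU
  -- The gauge has a positive minimum on the compact set of points of gauge at most `1` outside `V`;
  -- any smaller level works.
  obtain ⟨ε, hε, hsub⟩ : ∃ ε > 0, {x : Strip n | gauge x ≤ ε} ⊆ V := by
    rcases ({x : Strip n | gauge x ≤ 1} \ V).eq_empty_or_nonempty with he | hne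
    · exact ⟨1, one_pos, sdiff_eq_empty.1 he⟩
    · obtain ⟨x₀, hx₀, hmin⟩ := ((isCompact_gauge_le (n := n) 1).diff hV).exists_isMinOn hne
        continuous_gauge.continuousOn
      have hpos : 0 < gauge x₀ := gauge_pos fun h => hx₀.2 (h ▸ h0)
      refine ⟨min 1 (gauge x₀ / 2), by positivity, fun x hx => ?_⟩
      by_contra hxV
      have h1 : gauge x ≤ 1 := le_trans hx (min_le_left _ _)
      have h2 : gauge x ≤ gauge x₀ / 2 := le_trans hx (min_le_right _ _)
      have h3 : gauge x₀ ≤ gauge x := hmin ⟨h1, hxV⟩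
      linarith
  let ψ : Strip n → ℝ := fun x => expNegInvGlue (ε - gauge x)
  have hsupp : ∀ x, x ∉ {x : Strip n | gauge x ≤ ε} → ψ x = 0 := fun x hx =>
    expNegInvGlue.zero_of_nonpos (by
      have : ε < gauge x := not_le.1 hx
      linarith)
  have htest : IsTestFunction ψ := ⟨expNegInvGlue.contDiff.comp (contDiff_const.sub contDiff_gauge),
    HasCompactSupport.intro (isCompact_gauge_le ε) hsupp⟩
  refine ⟨ψ, htest, fun x => expNegInvGlue.nonneg _, fun x hx => hsupp x fun h => hx (hVU (hsub h)),
    ?_⟩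
  refine htest.continuous.integral_pos_of_hasCompactSupport_nonneg_nonzero htest.2
    (fun x => expNegInvGlue.nonneg _) (x := 0) ?_
  exact ne_of_gt (expNegInvGlue.pos_of_pos (by rw [gauge_zero]; linarith))

/-- Pointwise bounds from bounds on averages. -/
lemma abs_le_of_scorr {f : Strip n → ℝ} (hf : Continuous f) {c : ℝ} {x : Strip n}
    (h : ∀ ψ : Strip n → ℝ, IsTestFunction ψ → |∫ y, ψ y * f (x + y)| ≤ (∫ y, |ψ y|) * c) :
    |f x| ≤ c := by
  by_contra hc
  rw [not_le] at hc
  obtain ⟨σ, hσ, hσf⟩ : ∃ σ : ℝ, |σ| = 1 ∧ σ * f x = |f x| := by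
    rcases le_total 0 (f x) with h0 | h0
    · exact ⟨1, by simp, by rw [abs_of_nonneg h0, one_mul]⟩
    · exact ⟨-1, by simp, by rw [abs_of_nonpos h0]; ring⟩
  set c' := (c + |f x|) / 2 with hc'
  have hU : {y : Strip n | c' < σ * f (x + y)} ∈ 𝓝 0 := by
    refine (isOpen_lt continuous_const (by fun_prop)).mem_nhds ?_
    simp only [mem_ofPred_eq, add_zero, hσf]
    linarith
  obtain ⟨ψ, hψ, hnn, hz, hpos⟩ := exists_testFunction hU
  have h1 := h ψ hψ
  have h2 : ∫ y, |ψ y| = ∫ y, ψ y := by simp_rw [abs_of_nonneg (hnn _)]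
  have hcont : Continuous fun y => f (x + y) := hf.comp (by fun_prop)
  have h3 : ∫ y, ψ y * c' ≤ ∫ y, ψ y * (σ * f (x + y)) := by
    refine integral_mono (hψ.integrable.mul_const _)
      (hψ.integrable_mul (continuous_const.mul hcont)) fun y => ?_
    by_cases hy : y ∈ {y : Strip n | c' < σ * f (x + y)}
    · exact mul_le_mul_of_nonneg_left (le_of_lt hy) (hnn y)
    · simp [hz y hy]
  have h4 : ∫ y, ψ y * (σ * f (x + y)) = σ * ∫ y, ψ y * f (x + y) := by
    rw [← integral_const_mul]
    congr 1
    ext y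
    ring
  have h5 : σ * ∫ y, ψ y * f (x + y) ≤ |∫ y, ψ y * f (x + y)| := by
    refine (le_abs_self _).trans ?_
    rw [abs_mul, hσ, one_mul]
  rw [integral_mul_const, h4] at h3
  rw [h2] at h1
  have : (∫ y, ψ y) * c' ≤ (∫ y, ψ y) * c := h3.trans (h5.trans h1)
  have := le_of_mul_le_mul_left this hpos
  linarith

end CahnHilliard

end

/-! ### Uniqueness of bounded smooth solutions -/

noncomputable section

set_option linter.unusedSectionVars false

namespace CahnHilliard

variable {n : ℕ} {T : ℝ} {u₀ : Strip n → ℝ} {u w : ℝ → Strip n → ℝ}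

lemma IsWeakPair.half {z g : ℝ × Strip n → ℝ} (h : IsWeakPair T z g) {l L Λ : ℝ}
    (hl : 0 < l) (hL : 0 ≤ L) (hl' : (∫ q, |heatKer n l 1 q|) * L ≤ 1 / 2)
    (hg : ∀ t ∈ Ioo 0 T, ∀ x, |g (t, x)| ≤ L * |z (t, x)|)
    (hz : ∀ t ∈ Ioo 0 T, ∀ x, Real.exp (-(l * t)) * |z (t, x)| ≤ Λ) {t : ℝ} (ht : t ∈ Ioo 0 T)
    (x : Strip n) : Real.exp (-(l * t)) * |z (t, x)| ≤ Λ / 2 := by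
  have hc : Continuous fun y => z (t, y) :=
    h.contz.comp_continuous (by fun_prop) fun y => ⟨ht, mem_univ _⟩
  have h1 := abs_le_of_scorr (f := fun y => Real.exp (-(l * t)) * z (t, y)) (x := x)
    (continuous_const.mul hc) (c := Λ / 2) fun ψ hψ => ?_
  · rwa [abs_mul, Real.abs_exp] at h1
  · have h2 := h.abs_scorr_le_half hψ hl hL hl' hg hz ht x
    rw [scorr, ← integral_const_mul] at h2
    simpa only [mul_left_comm] using h2

/-- The bound on `e^{-lt}|z|` can be halved indefinitely, since the damping rate `l` depends only on
`L`. -/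
lemma IsWeakPair.eq_zero {z g : ℝ × Strip n → ℝ} (h : IsWeakPair T z g) {L : ℝ} (hL : 0 ≤ L)
    (hg : ∀ t ∈ Ioo 0 T, ∀ x, |g (t, x)| ≤ L * |z (t, x)|) {t : ℝ} (ht : t ∈ Ioo 0 T)
    (x : Strip n) : z (t, x) = 0 := by
  obtain ⟨l, hl, hl'⟩ := exists_damping n hL
  obtain ⟨M, hM⟩ := h.bddz
  have key : ∀ k : ℕ, ∀ t ∈ Ioo 0 T, ∀ x, Real.exp (-(l * t)) * |z (t, x)| ≤ M * (1 / 2) ^ k := by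
    intro k
    induction k with
    | zero =>
      intro t ht x
      have h1 : Real.exp (-(l * t)) ≤ 1 := Real.exp_le_one_iff.2 (by nlinarith [ht.1])
      have h2 := hM t ht x
      have h3 := abs_nonneg (z (t, x))
      rw [pow_zero, mul_one]
      nlinarith [Real.exp_pos (-(l * t))]
    | succ k ih =>
      intro t ht x
      refine (h.half hl hL hl' hg ih ht x).trans (le_of_eq ?_)
      rw [pow_succ]
      ring
  have hlim : Tendsto (fun k : ℕ => M * (1 / 2 : ℝ) ^ k) atTop (𝓝 (M * 0)) :=
    (tendsto_pow_atTop_nhds_zero_of_lt_one (by norm_num) (by norm_num)).const_mul M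
  rw [mul_zero] at hlim
  have h0 := ge_of_tendsto' hlim fun k => key k t ht x
  have h1 := (mul_nonpos_iff_pos_imp_nonpos.1 h0).1 (Real.exp_pos _)
  exact abs_nonpos_iff.1 h1

lemma IsSolution.continuousOn (hu : IsSolution T u₀ u) :
    ContinuousOn (fun q : ℝ × Strip n => u q.1 q.2) (Ioo 0 T ×ˢ univ) := by
  rintro q hq
  obtain ⟨p, rfl⟩ := (isOpenQuotientMap_timeCoverHom (n := n)).surjective q
  refine ContinuousAt.continuousWithinAt ?_
  rw [← isOpenQuotientMap_timeCoverHom.continuousAt_comp_iff]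
  have hp : Ioo (0 : ℝ) T ×ˢ (univ : Set (Cover n)) ∈ 𝓝 p :=
    (isOpen_Ioo.prod isOpen_univ).mem_nhds ⟨hq.1, mem_univ _⟩
  exact hu.contDiffOn_Ioo.continuousOn.continuousAt hp

lemma IsSolution.isWeakPair (hT : 0 < T) (hu : IsSolution T u₀ u) (hw : IsSolution T u₀ w) :
    IsWeakPair T (fun q => u q.1 q.2 - w q.1 q.2)
      (fun q => deriv doubleWell (u q.1 q.2) - deriv doubleWell (w q.1 q.2)) := by
  obtain ⟨M, hM⟩ := hu.bounded
  obtain ⟨M', hM'⟩ := hw.bounded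
  have hcont : Continuous (deriv doubleWell) := by
    rw [funext deriv_doubleWell]
    fun_prop
  have hbd : ∀ {a R : ℝ}, |a| ≤ R → |deriv doubleWell a| ≤ R ^ 3 + R := by
    intro a R ha
    rw [deriv_doubleWell]
    refine (abs_sub _ _).trans (add_le_add ?_ ha)
    rw [abs_pow]
    gcongr
  have h_int : ∀ {φ f : Strip n → ℝ}, IsTestFunction φ → SmoothLift f →
      Integrable fun x => φ x * f x := fun hφ hf => hφ.integrable_mul hf.continuous
  have hus := fun t (ht : t ∈ Ioo 0 T) => hu.smoothLift (Ioo_subset_Ioc_self ht)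
  have hws := fun t (ht : t ∈ Ioo 0 T) => hw.smoothLift (Ioo_subset_Ioc_self ht)
  have hsub : ∀ {φ : Strip n → ℝ}, IsTestFunction φ → ∀ t ∈ Ioo 0 T,
      ∫ x, φ x * (u t x - w t x) = (∫ x, φ x * u t x) - ∫ x, φ x * w t x := by
    intro φ hφ t ht
    rw [← integral_sub (h_int hφ (hus t ht)) (h_int hφ (hws t ht))]
    simp_rw [mul_sub]
  refine ⟨hu.continuousOn.sub hw.continuousOn, (hcont.comp_continuousOn hu.continuousOn).sub
    (hcont.comp_continuousOn hw.continuousOn), ⟨M + M', fun t ht x => ?_⟩,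
    ⟨M ^ 3 + M + (M' ^ 3 + M'), fun t ht x => ?_⟩, fun φ hφ t ht => ?_, fun φ hφ => ?_⟩
  · exact (abs_sub _ _).trans (add_le_add (hM t (Ioo_subset_Ioc_self ht) x)
      (hM' t (Ioo_subset_Ioc_self ht) x))
  · exact (abs_sub _ _).trans (add_le_add (hbd (hM t (Ioo_subset_Ioc_self ht) x))
      (hbd (hM' t (Ioo_subset_Ioc_self ht) x)))
  · refine (((hu.weak hφ ht).sub (hw.weak hφ ht)).congr_of_eventuallyEq ?_).congr_deriv ?_
    · filter_upwards [Ioo_mem_nhds ht.1 ht.2] with s hs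
      exact hsub hφ s hs
    · rw [hsub hφ.lap.lap t ht]
      simp_rw [mul_sub]
      rw [integral_sub (h_int hφ.lap (hus t ht).deriv_doubleWell)
        (h_int hφ.lap (hws t ht).deriv_doubleWell)]
      ring
  · have h1 := (hu.initial_limit φ hφ).sub (hw.initial_limit φ hφ)
    rw [sub_self] at h1
    refine h1.congr' ?_
    filter_upwards [Ioo_mem_nhdsGT hT] with t ht
    rw [hsub hφ t ht]
    simp_rw [mul_comm (φ _)]

/-- Bounded smooth solutions are unique. -/
theorem IsSolution.eqOn (hT : 0 < T) (hu : IsSolution T u₀ u) (hw : IsSolution T u₀ w) :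
    EqOn u w (Icc 0 T) := by
  obtain ⟨M, hM⟩ := hu.bounded
  obtain ⟨M', hM'⟩ := hw.bounded
  have hzero : ∀ t ∈ Ioo 0 T, ∀ x, u t x - w t x = 0 := by
    intro t ht x
    refine (hu.isWeakPair hT hw).eq_zero (L := 3 * (max M M') ^ 2 + 1) (by positivity)
      (fun s hs y => ?_) ht x
    have h1 := abs_increment_sub_le (v := 0) (w := u s y) (w' := w s y) (R := max M M')
      (by rw [zero_add]; exact (hM s (Ioo_subset_Ioc_self hs) y).trans (le_max_left _ _))
      (by rw [zero_add]; exact (hM' s (Ioo_subset_Ioc_self hs) y).trans (le_max_right _ _))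
    simpa [increment, deriv_doubleWell] using h1
  intro t ht
  rcases eq_or_lt_of_le ht.1 with h0 | h0
  · rw [← h0, hu.initial, hw.initial]
  ext x
  rcases eq_or_lt_of_le ht.2 with h1 | h1
  · subst h1
    have hmem : t ∈ Ioc 0 t := ⟨h0, le_rfl⟩
    -- At the final time the equation is one-sided, so equality is inherited from earlier times by
    -- left continuity.
    have hc := ((hu.equation t hmem x).continuousWithinAt.sub
      (hw.equation t hmem x).continuousWithinAt).mono Ioo_subset_Ioc_self
    have : (𝓝[Ioo 0 t] t).NeBot := by
      rw [nhdsWithin_Ioo_eq_nhdsLT h0]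
      infer_instance
    have h2 : Tendsto (fun s => u s x - w s x) (𝓝[Ioo 0 t] t) (𝓝 0) := by
      refine tendsto_const_nhds.congr' ?_
      filter_upwards [self_mem_nhdsWithin] with s hs
      exact (hzero s hs x).symm
    exact sub_eq_zero.1 (tendsto_nhds_unique hc h2)
  · exact sub_eq_zero.1 (hzero t ⟨h0, h1⟩ x)

end CahnHilliard

end

noncomputable section

set_option linter.unusedSectionVars false

namespace CahnHilliard

variable {n : ℕ}

/-! ### Sobolev regularity -/

/-- Bounded continuous square integrable functions on the strip. -/
def BCL2 (f : Strip n → ℝ) : Prop := BC f ∧ MemLp f 2 volume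

lemma BCL2.add {f g : Strip n → ℝ} (hf : BCL2 f) (hg : BCL2 g) : BCL2 (f + g) :=
  ⟨hf.1.add hg.1, hf.2.add hg.2⟩

lemma BC.mul_BCL2 {f g : Strip n → ℝ} (hf : BC f) (hg : BCL2 g) : BCL2 (f * g) := by
  refine ⟨hf.mul hg.1, ?_⟩
  obtain ⟨hc, M, hM⟩ := hf
  exact hg.2.of_le_mul (c := M) (hc.mul hg.1.1).aestronglyMeasurable
    (Eventually.of_forall fun x => by
      rw [Pi.mul_apply, norm_mul]
      gcongr
      exact hM x)

lemma memSobolev_of_reg {j : ℕ} {f : Strip n → ℝ} (hf : Reg axis BCL2 j f) : MemSobolev j f := by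
  induction j generalizing f with
  | zero => exact hf.2
  | succ j ih =>
    refine ⟨hf.1.2, fun i => ⟨pd axis i f, fun φ hφ => ?_, ih (hf.pd i)⟩⟩
    have h := integral_mul_hasDir hφ i (hf.hasDir i) hf.base.1.1 (hf.pd i).base.1.1
    simp_rw [mul_comm (pd axis i f _)]
    rw [h, neg_neg]
    simp_rw [mul_comm (f _)]
    rfl

/-! ### Differences of kinks -/

lemma kink_eq_kink_add (b c : ℝ) (x : Strip n) : kink c x = kink b (x + axis none (b - c)) := by
  simp only [kink, axis, Prod.snd_add]
  congr 2
  ring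

lemma sq_tanh_lt_one (x : ℝ) : Real.tanh x ^ 2 < 1 := by
  rw [sq_lt_one_iff_abs_lt_one]
  exact Real.abs_tanh_lt_one x

/-- Uses `cosh² = 1 + sinh²` and `|sinh x| ≥ |x|`. This crude decay is enough for the slope of the
kink to be integrable. -/
lemma one_sub_tanh_sq_le (x : ℝ) : 1 - Real.tanh x ^ 2 ≤ (1 + x ^ 2)⁻¹ := by
  have hc := Real.cosh_pos x
  have h1 : 1 - Real.tanh x ^ 2 = (Real.cosh x ^ 2)⁻¹ := by
    rw [Real.tanh_eq_sinh_div_cosh]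
    have := Real.cosh_sq x
    field_simp
    linarith
  rw [h1]
  refine inv_anti₀ (by positivity) ?_
  rw [Real.cosh_sq, add_comm]
  have h2 : |x| ≤ |Real.sinh x| := by
    rw [Real.abs_sinh]
    exact Real.self_le_sinh_iff.2 (abs_nonneg x)
  have := sq_le_sq.2 h2
  linarith

/-- The slope of the kink. -/
def kinkSlope (b : ℝ) (x : Strip n) : ℝ := (1 - kink b x ^ 2) / √2

lemma continuous_kinkSlope (b : ℝ) : Continuous (kinkSlope (n := n) b) :=
  (continuous_const.sub ((continuous_kink b).pow 2)).div_const _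

lemma kinkSlope_nonneg (b : ℝ) (x : Strip n) : 0 ≤ kinkSlope b x :=
  div_nonneg (sub_nonneg.2 (sq_tanh_lt_one _).le) (by positivity)

lemma integrable_kinkSlope (b : ℝ) : Integrable (kinkSlope (n := n) b) := by
  have h1 : Integrable fun z : ℝ => (1 + ((z - b) / √2) ^ 2)⁻¹ :=
    (integrable_inv_one_add_sq.comp_div (by positivity : (√2 : ℝ) ≠ 0)).comp_sub_right b
  have h2 : Integrable (fun x : Strip n => (1 + ((x.2 - b) / √2) ^ 2)⁻¹)
      ((volume : Measure (Fin n → UnitAddCircle)).prod (volume : Measure ℝ)) := h1.comp_snd _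
  refine (h2.div_const √2).mono' (continuous_kinkSlope b).aestronglyMeasurable
    (Eventually.of_forall fun x => ?_)
  rw [Real.norm_of_nonneg (kinkSlope_nonneg b x)]
  exact div_le_div_of_nonneg_right (one_sub_tanh_sq_le _) (by positivity)

/-- The total variation of the kink. -/
def kinkMass (n : ℕ) : ℝ := ∫ x : Strip n, kinkSlope 0 x

lemma integral_kinkSlope (b : ℝ) : ∫ x : Strip n, kinkSlope b x = kinkMass n := by
  have h : (fun x : Strip n => kinkSlope b x) = fun x => kinkSlope 0 (x + axis none (0 - b)) := by
    ext x
    rw [kinkSlope, kinkSlope, ← kink_eq_kink_add]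
  rw [h, integral_add_right_eq_self (kinkSlope (n := n) 0), kinkMass]

/-- The difference is an integral of translates of the nonnegative slope over an interval of length
`|b - c|`, and every translate has the same mass. -/
lemma integrable_kink_sub (b c : ℝ) : Integrable (fun x : Strip n => kink b x - kink c x) ∧
    ∫ x : Strip n, |kink b x - kink c x| ≤ |b - c| * kinkMass n := by
  have hax := continuous_axis (none : Option (Fin n))
  have h1 : ∀ x : Strip n, kink b x - kink c x =
      -∫ r in (0 : ℝ)..(b - c), kinkSlope b (x + axis none r) := by
    intro x
    have hd : HasDir (axis none) (kink (n := n) b) (kinkSlope b) := hasDir_kink b none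
    rw [intervalIntegral.integral_eq_sub_of_hasDerivAt
      (fun r _ => HasDir.hasDerivAt (isOneParam_axis none) hd x r)
      (((continuous_kinkSlope b).comp (continuous_const.add hax)).intervalIntegrable _ _),
      (isOneParam_axis none).zero, add_zero, ← kink_eq_kink_add]
    ring
  have hm : Continuous fun p : ℝ × Strip n => kinkSlope b (p.2 + axis none p.1) :=
    (continuous_kinkSlope b).comp (continuous_snd.add (hax.comp continuous_fst))
  have hfin : IsFiniteMeasure (volume.restrict (uIoc (0 : ℝ) (b - c))) := by
    rw [uIoc]
    infer_instance
  have h_int : Integrable (fun p : ℝ × Strip n => kinkSlope b (p.2 + axis none p.1))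
      ((volume.restrict (uIoc (0 : ℝ) (b - c))).prod volume) := by
    rw [integrable_prod_iff hm.aestronglyMeasurable]
    refine ⟨Eventually.of_forall fun r => (integrable_kinkSlope b).comp_add_right (axis none r), ?_⟩
    simp_rw [integral_add_right_eq_self fun x => ‖kinkSlope (n := n) b x‖]
    exact integrable_const _
  have habs : ∀ x : Strip n, |kink b x - kink c x| =
      ∫ r in uIoc (0 : ℝ) (b - c), kinkSlope b (x + axis none r) := by
    intro x
    rw [h1, abs_neg, intervalIntegral.abs_intervalIntegral_eq, abs_of_nonneg]
    exact integral_nonneg fun r => kinkSlope_nonneg b _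
  have hI : Integrable fun x : Strip n => |kink b x - kink c x| := by
    simp_rw [habs]
    exact h_int.integral_prod_right
  refine ⟨(integrable_norm_iff (((continuous_kink b).sub
    (continuous_kink c)).aestronglyMeasurable)).1 hI, le_of_eq ?_⟩
  simp_rw [habs]
  rw [integral_integral_swap (f := fun (x : Strip n) r => kinkSlope b (x + axis none r)) h_int.swap]
  simp_rw [integral_add_right_eq_self (kinkSlope (n := n) b), integral_kinkSlope]
  rw [integral_const, smul_eq_mul]
  congr 1
  simp [Measure.real, uIoc, max_sub_min_eq_abs]

lemma abs_kink_sub_le (b c : ℝ) (x : Strip n) : |kink b x - kink c x| ≤ |b - c| := by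
  have hlip : ∀ y y' : ℝ, |Real.tanh y - Real.tanh y'| ≤ |y - y'| := by
    intro y y'
    have := Convex.norm_image_sub_le_of_norm_hasDerivWithin_le (𝕜 := ℝ) (s := univ) (C := 1)
      (fun r _ => (hasDerivAt_tanh r).hasDerivWithinAt) (fun r _ => ?_) convex_univ (mem_univ y')
      (mem_univ y)
    · simpa using this
    · rw [Real.norm_of_nonneg (sub_nonneg.2 (sq_tanh_lt_one r).le)]
      linarith [sq_nonneg (Real.tanh r)]
  refine (hlip _ _).trans ?_
  have h2 : (x.2 - b) / √2 - (x.2 - c) / √2 = (c - b) / √2 := by ring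
  rw [h2, abs_div, abs_of_pos (by positivity : (0 : ℝ) < √2), abs_sub_comm]
  exact div_le_self (abs_nonneg _) (Real.one_le_sqrt.2 one_le_two)

lemma abs_kink_sub_le_two (b c : ℝ) (x : Strip n) : |kink b x - kink c x| ≤ 2 :=
  (abs_sub _ _).trans (by linarith [abs_kink_le b x, abs_kink_le c x])

lemma integrable_sq_kink_sub (b c : ℝ) :
    Integrable (fun x : Strip n => (kink b x - kink c x) ^ 2) := by
  simp_rw [sq]
  exact (integrable_kink_sub b c).1.mul_bdd (c := 2)
    ((continuous_kink b).sub (continuous_kink c)).aestronglyMeasurable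
    (Eventually.of_forall fun x => abs_kink_sub_le_two b c x)

lemma BCL2_kink_sub (b c : ℝ) : BCL2 (kink (n := n) b - kink c) := by
  have hc := (continuous_kink (n := n) b).sub (continuous_kink c)
  exact ⟨⟨hc, 2, abs_kink_sub_le_two b c⟩,
    (memLp_two_iff_integrable_sq hc.aestronglyMeasurable).2 (integrable_sq_kink_sub b c)⟩

/-- The derivative of `v_b - v_c` is `-(v_b + v_c)(v_b - v_c) / √2`: a bounded regular function
times the difference itself. -/
lemma Reg_kink_sub (b c : ℝ) (m : ℕ) : Reg axis BCL2 m (kink (n := n) b - kink c) := by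
  induction m with
  | zero => exact BCL2_kink_sub b c
  | succ m ih =>
    refine Reg.succ_intro (BCL2_kink_sub b c)
      (fun i => (hasDir_kink b i).sub (hasDir_kink c i)) fun i => ?_
    cases i with
    | none =>
      have h1 : Reg axis BC m ((fun _ => -(1 / √2)) * (kink (n := n) b + kink c)) :=
        Reg.mul (fun i => (isOneParam_axis i).zero) isAlg_BC.add isAlg_BC.mul
          (Reg.const isAlg_BC.zero _ (BC.const _)) (Reg.add isAlg_BC.add
            (Reg_kink isAlg_BC (BC_kink b) m) (Reg_kink isAlg_BC (BC_kink c) m))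
      have h2 := Reg.mul (fun i => (isOneParam_axis i).zero) (fun _ _ => BCL2.add)
        (fun _ _ => BC.mul_BCL2) h1 ih
      convert! h2 using 1
      ext x
      simp only [Option.elim, Pi.sub_apply, Pi.mul_apply, Pi.add_apply]
      ring
    | some i =>
      have h3 : (fun x : Strip n => (some i).elim ((1 - kink b x ^ 2) / √2) fun _ => 0) -
          (fun x => (some i).elim ((1 - kink c x ^ 2) / √2) fun _ => 0) = 0 := by
        ext x
        simp
      rw [h3]
      exact Reg.zero ⟨BC.zero, MemLp.zero⟩

lemma monotone_tanh : Monotone Real.tanh :=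
  monotone_of_deriv_nonneg (fun x => (hasDerivAt_tanh x).differentiableAt) fun x => by
    rw [(hasDerivAt_tanh x).deriv]
    exact sub_nonneg.2 (sq_tanh_lt_one x).le

lemma volume_slab {b c : ℝ} (hbc : b ≤ c) :
    (volume : Measure (Strip n)).real (univ ×ˢ Icc b c) = c - b := by
  have h1 : (volume : Measure (Fin n → UnitAddCircle)) univ = 1 := by
    rw [volume_pi, Measure.pi_univ]
    simp
  rw [Measure.real, Measure.volume_eq_prod, Measure.prod_prod, h1, one_mul, Real.volume_Icc,
    ENNReal.toReal_ofReal (by linarith)]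

/-- Distinct kinks are far apart in `L²`. -/
lemma le_integral_sq_kink_sub (b c : ℝ) :
    |b - c| * Real.tanh (|b - c| / (2 * √2)) ^ 2 ≤ ∫ x : Strip n, (kink b x - kink c x) ^ 2 := by
  wlog hbc : b ≤ c generalizing b c
  · have := this c b (not_le.1 hbc).le
    rw [abs_sub_comm] at this
    refine this.trans (le_of_eq ?_)
    congr 1
    ext x
    ring
  rw [abs_sub_comm, abs_of_nonneg (sub_nonneg.2 hbc)]
  set τ := Real.tanh ((c - b) / (2 * √2)) with hτ
  have hs : MeasurableSet ((univ : Set (Fin n → UnitAddCircle)) ×ˢ Icc b c) :=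
    MeasurableSet.univ.prod measurableSet_Icc
  have h0 : ∀ y : ℝ, 0 ≤ y → 0 ≤ Real.tanh y := fun y hy => by
    simpa using monotone_tanh hy
  have hτ0 : 0 ≤ τ := h0 _ (div_nonneg (sub_nonneg.2 hbc) (by positivity))
  -- Between the two centres `v_b ≥ 0 ≥ v_c`, and the farther centre is at distance at least `(c -
  -- b) / 2`.
  have hpt : ∀ x ∈ (univ : Set (Fin n → UnitAddCircle)) ×ˢ Icc b c,
      τ ^ 2 ≤ (kink b x - kink c x) ^ 2 := by
    rintro x ⟨-, hx1, hx2⟩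
    refine pow_le_pow_left₀ hτ0 ?_ 2
    have h2 : kink c x = -Real.tanh ((c - x.2) / √2) := by
      rw [kink, ← Real.tanh_neg]
      congr 1
      ring
    have h3 : 0 ≤ Real.tanh ((c - x.2) / √2) :=
      h0 _ (div_nonneg (sub_nonneg.2 hx2) (by positivity))
    have h4 : 0 ≤ kink b x := h0 _ (div_nonneg (sub_nonneg.2 hx1) (by positivity))
    rw [h2, sub_neg_eq_add]
    rcases le_total ((c - b) / 2) (x.2 - b) with h | h
    · have : τ ≤ kink b x := monotone_tanh (by
        rw [← div_div]
        gcongr)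
      linarith
    · have : τ ≤ Real.tanh ((c - x.2) / √2) := monotone_tanh (by
        rw [← div_div]
        have : (c - b) / 2 ≤ c - x.2 := by linarith
        gcongr)
      linarith
  calc (c - b) * τ ^ 2 = ∫ _ in (univ : Set (Fin n → UnitAddCircle)) ×ˢ Icc b c, τ ^ 2 := by
        rw [setIntegral_const, volume_slab hbc, smul_eq_mul]
    _ ≤ ∫ x in (univ : Set (Fin n → UnitAddCircle)) ×ˢ Icc b c, (kink b x - kink c x) ^ 2 := by
        refine setIntegral_mono_on ?_ (integrable_sq_kink_sub b c).integrableOn hs hpt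
        refine integrableOn_const ?_
        rw [Measure.volume_eq_prod, Measure.prod_prod]
        exact ENNReal.mul_ne_top (measure_ne_top _ _) (by simp)
    _ ≤ _ := setIntegral_le_integral (integrable_sq_kink_sub b c)
        (Eventually.of_forall fun x => sq_nonneg _)

lemma integral_sq_kink_sub_le (b c : ℝ) :
    ∫ x : Strip n, (kink b x - kink c x) ^ 2 ≤ 2 * (|b - c| * kinkMass n) := by
  obtain ⟨h1, h2⟩ := integrable_kink_sub (n := n) b c
  refine le_trans ?_ (mul_le_mul_of_nonneg_left h2 zero_le_two)
  rw [← integral_const_mul]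
  refine integral_mono (integrable_sq_kink_sub b c) (h1.abs.const_mul 2) fun x => ?_
  dsimp only
  rw [← sq_abs, sq]
  exact mul_le_mul_of_nonneg_right (abs_kink_sub_le_two b c x) (abs_nonneg _)

/-! ### Closest kinks -/

lemma toReal_eLpNorm_sq {f : Strip n → ℝ} (hf : MemLp f 2 volume) :
    (eLpNorm f 2 volume).toReal ^ 2 = ∫ x, f x ^ 2 := by
  have h0 : 0 ≤ ∫ x, f x ^ 2 := integral_nonneg fun x => sq_nonneg _
  rw [hf.eLpNorm_eq_integral_rpow_norm two_ne_zero ENNReal.ofNat_ne_top]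
  simp only [ENNReal.toReal_ofNat, Real.rpow_two, Real.norm_eq_abs, sq_abs]
  rw [ENNReal.toReal_ofReal (by positivity), ← Real.rpow_natCast, ← Real.rpow_mul h0]
  norm_num

section Closest

variable {f : Strip n → ℝ} {b : ℝ}

lemma memLp_sub_kink (hf : MemLp (f - kink b) 2 volume) (c : ℝ) : MemLp (f - kink c) 2 volume := by
  have h := hf.add (BCL2_kink_sub b c).2
  rwa [sub_add_sub_cancel] at h

lemma toReal_eLpNorm_sub_le {f g : Strip n → ℝ} (hf : MemLp f 2 volume) (hg : MemLp g 2 volume) :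
    (eLpNorm (f + g) 2 volume).toReal ≤
      (eLpNorm f 2 volume).toReal + (eLpNorm g 2 volume).toReal := by
  rw [← ENNReal.toReal_add hf.2.ne hg.2.ne]
  exact ENNReal.toReal_mono (ENNReal.add_ne_top.2 ⟨hf.2.ne, hg.2.ne⟩)
    (eLpNorm_add_le hf.1 hg.1 (by norm_num))

/-- Existence of an `L²`-closest kink. -/
lemma exists_isClosestKink (hf : MemLp (f - kink b) 2 volume) : ∃ c, IsClosestKink f c := by
  let F : ℝ → ℝ := fun c => (eLpNorm (f - kink c) 2 volume).toReal
  let D : ℝ → ℝ → ℝ := fun c c' => (eLpNorm (kink (n := n) c - kink c') 2 volume).toReal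
  have hD : ∀ c c', D c c' ^ 2 = ∫ x : Strip n, (kink c x - kink c' x) ^ 2 := fun c c' =>
    toReal_eLpNorm_sq (BCL2_kink_sub c c').2
  have hD0 : ∀ c c', 0 ≤ D c c' := fun c c' => ENNReal.toReal_nonneg
  have htri : ∀ c c', F c ≤ F c' + D c' c := by
    intro c c'
    have h := toReal_eLpNorm_sub_le (memLp_sub_kink hf c') (BCL2_kink_sub (n := n) c' c).2
    rwa [sub_add_sub_cancel] at h
  have hDs : ∀ c c', D c c' = D c' c := fun c c' => by
    simp only [D]
    rw [← neg_sub, eLpNorm_neg]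
  have hcont : Continuous F := by
    rw [continuous_iff_continuousAt]
    intro c
    rw [ContinuousAt, tendsto_iff_dist_tendsto_zero]
    have hlim : Tendsto (fun c' => √(2 * (|c' - c| * kinkMass n))) (𝓝 c) (𝓝 0) := by
      have h : Continuous fun c' => √(2 * (|c' - c| * kinkMass n)) := by fun_prop
      simpa using h.tendsto c
    refine squeeze_zero (fun _ => dist_nonneg) (fun c' => ?_) hlim
    have h1 : D c' c ≤ √(2 * (|c' - c| * kinkMass n)) := by
      refine Real.le_sqrt_of_sq_le ?_
      rw [hD]
      exact integral_sq_kink_sub_le c' c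
    rw [Real.dist_eq, abs_le]
    constructor
    · linarith [htri c c']
    · linarith [htri c' c, hDs c' c]
  -- By the triangle inequality `F c ≥ D b c - F b`, and `D b c` grows at least like `√|b - c|`.
  have hcoer : Tendsto F (cocompact ℝ) atTop := by
    set κ := Real.tanh (1 / (2 * √2)) with hκ
    have hκ0 : 0 < κ := by
      have h2 : (0 : ℝ) < 1 / (2 * √2) := by positivity
      rw [hκ, Real.tanh_eq_sinh_div_cosh]
      exact div_pos (Real.sinh_pos_iff.2 h2) (Real.cosh_pos _)
    have habs : Tendsto (fun c => |b - c|) (cocompact ℝ) atTop := by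
      have h : Tendsto (fun c : ℝ => dist c b) (cocompact ℝ) atTop := tendsto_dist_right_cocompact_atTop b
      refine h.congr fun c => ?_
      rw [Real.dist_eq, abs_sub_comm]
    have hsq : Tendsto (fun c => √(|b - c| * κ ^ 2) - F b) (cocompact ℝ) atTop :=
      tendsto_atTop_add_const_right _ _ (Real.tendsto_sqrt_atTop.comp
        (habs.atTop_mul_const (by positivity)))
    refine tendsto_atTop_mono' _ ?_ hsq
    filter_upwards [habs.eventually_ge_atTop 1] with c hc
    have h1 : √(|b - c| * κ ^ 2) ≤ D b c := by
      rw [← Real.sqrt_sq (hD0 b c), hD]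
      refine Real.sqrt_le_sqrt (le_trans ?_ (le_integral_sq_kink_sub b c))
      have h3 : κ ≤ Real.tanh (|b - c| / (2 * √2)) := monotone_tanh (by gcongr)
      gcongr
    have h2 : D b c ≤ F c + F b := by
      have h := toReal_eLpNorm_sub_le (memLp_sub_kink hf c) hf.neg
      rw [eLpNorm_neg, ← sub_eq_add_neg, sub_sub_sub_cancel_left] at h
      exact h
    linarith
  obtain ⟨c, hc⟩ := hcont.exists_forall_le hcoer
  exact ⟨c, fun a => (ENNReal.toReal_le_toReal (memLp_sub_kink hf c).2.ne
    (memLp_sub_kink hf a).2.ne).1 (hc a)⟩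

/-- If `f` is uniformly close to a kink, then so is every `L²`-closest kink. -/
lemma IsClosestKink.abs_sub_le (hf : MemLp (f - kink b) 2 volume) {ε η : ℝ} (hη : 0 < η)
    (hε : ∀ᵐ x, |f x - kink b x| ≤ ε)
    (hεη : 2 * ε * kinkMass n < Real.tanh (η / (2 * √2)) ^ 2) {c : ℝ} (hc : IsClosestKink f c) :
    |b - c| ≤ η := by
  by_contra hcon
  rw [not_le] at hcon
  have hε0 : 0 ≤ ε := by
    obtain ⟨x, hx⟩ := hε.exists
    exact (abs_nonneg _).trans hx
  have hfc := memLp_sub_kink hf c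
  have h1 : ∫ x, (f x - kink c x) ^ 2 ≤ ∫ x, (f x - kink b x) ^ 2 := by
    have e1 := toReal_eLpNorm_sq hfc
    have e2 := toReal_eLpNorm_sq hf
    simp only [Pi.sub_apply] at e1 e2
    rw [← e1, ← e2]
    have := (ENNReal.toReal_le_toReal hfc.2.ne hf.2.ne).2 (hc b)
    gcongr
  obtain ⟨hi, hL1⟩ := integrable_kink_sub (n := n) b c
  have hcross : Integrable fun x => (f x - kink b x) * (kink b x - kink c x) := by
    refine Integrable.bdd_mul (c := ε) hi hf.1 ?_
    filter_upwards [hε] with x hx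
    exact hx
  have hsq : Integrable fun x => (f x - kink b x) ^ 2 := hf.integrable_sq
  have hsum : Integrable fun x => 2 * ((f x - kink b x) * (kink b x - kink c x)) +
      (kink b x - kink c x) ^ 2 := (hcross.const_mul 2).add (integrable_sq_kink_sub b c)
  -- Expanding the square around `v_b`, minimality forces the cross term to outweigh the squared
  -- distance between the kinks. Both are at least linear in `|b - c|`, and the cross term carries
  -- the small factor `ε`.
  have h2 : ∫ x, (f x - kink c x) ^ 2 = (∫ x, (f x - kink b x) ^ 2) +
      (2 * (∫ x, (f x - kink b x) * (kink b x - kink c x)) +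
        ∫ x : Strip n, (kink b x - kink c x) ^ 2) := by
    rw [← integral_const_mul, ← integral_add (hcross.const_mul 2) (integrable_sq_kink_sub b c),
      ← integral_add hsq hsum]
    congr 1
    ext x
    ring
  have h3 : |∫ x, (f x - kink b x) * (kink b x - kink c x)| ≤ ε * (|b - c| * kinkMass n) := by
    refine le_trans ?_ (mul_le_mul_of_nonneg_left hL1 hε0)
    rw [← integral_const_mul]
    refine norm_integral_le_of_norm_le (f := fun x => (f x - kink b x) * (kink b x - kink c x))
      (hi.abs.const_mul ε) ?_
    filter_upwards [hε] with x hx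
    rw [norm_mul, Real.norm_eq_abs, Real.norm_eq_abs]
    gcongr
  have h4 := le_integral_sq_kink_sub (n := n) b c
  have h5 : Real.tanh (η / (2 * √2)) ≤ Real.tanh (|b - c| / (2 * √2)) :=
    monotone_tanh (by gcongr)
  have h6 : 0 ≤ Real.tanh (η / (2 * √2)) := by
    have := monotone_tanh (show 0 ≤ η / (2 * √2) by positivity)
    simpa using this
  have h7 : |b - c| * Real.tanh (η / (2 * √2)) ^ 2 ≤
      |b - c| * Real.tanh (|b - c| / (2 * √2)) ^ 2 := by gcongr
  have h8 : |b - c| * (2 * ε * kinkMass n) < |b - c| * Real.tanh (η / (2 * √2)) ^ 2 :=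
    mul_lt_mul_of_pos_left hεη (hη.trans hcon)
  have h9 := (abs_le.1 h3).1
  nlinarith

end Closest

end CahnHilliard

end

noncomputable section

set_option linter.unusedSectionVars false

namespace CahnHilliard

variable {n : ℕ}

/-! ### Existence for small perturbations of a kink -/

/-- An essentially bounded `L²` function has an everywhere bounded Borel representative. -/
lemma exists_bddMeas_ae_eq {f : Strip n → ℝ} (hf : MemLp f 2 volume) {δ : ℝ} (hδ : 0 ≤ δ)
    (hb : ∀ᵐ x, |f x| ≤ δ) : ∃ w, BddMeas w δ ∧ MemLp w 2 volume ∧ f =ᵐ[volume] w := by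
  have hm := hf.1.stronglyMeasurable_mk.measurable
  have hae : f =ᵐ[volume] {x | |hf.1.mk f x| ≤ δ}.indicator (hf.1.mk f) := by
    filter_upwards [hb, hf.1.ae_eq_mk] with x hx hx'
    rw [indicator_of_mem, hx']
    rwa [mem_ofPred_eq, ← hx']
  refine ⟨_, ⟨hm.indicator (measurableSet_le hm.abs measurable_const), fun x => ?_⟩,
    hf.ae_eq hae, hae⟩
  by_cases hx : |hf.1.mk f x| ≤ δ
  · rwa [indicator_of_mem (by exact hx)]
  · rwa [indicator_of_notMem (by exact hx), abs_zero]

/-- Small data give mild solutions that stay small on `(0, T)`. -/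
lemma exists_isMild {l b T δ : ℝ} {w : Strip n → ℝ} (hl : 0 < l)
    (hl' : (∫ q, |heatKer n l 1 q|) * 13 ≤ 1 / 2) (hw : BddMeas w δ) (hw2 : MemLp w 2 volume)
    (hδ : Real.exp (l * T) * (2 * (heatMass n 0 * δ)) ≤ 1) :
    ∃ W, IsMild l b T w W ∧ ∀ q, |W q| ≤ 2 * (heatMass n 0 * δ) := by
  have hA := bddMeas_freeEvolution hl.le hw
  have ha := eLpNorm_freeEvolution_le hl.le hw.1
  have hfin : ENNReal.ofReal (heatMass n 0) * eLpNorm w 2 volume ≠ ⊤ :=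
    ENNReal.mul_ne_top ENNReal.ofReal_ne_top hw2.2.ne
  obtain ⟨B, hBc, hB, hBeq, hB2⟩ := exists_mild (b := b) hl hl' hA ha
  have hle : ∀ q, |(freeEvolution l w + B) q| ≤ 2 * (heatMass n 0 * δ) := fun q =>
    (abs_add_le _ _).trans (by linarith [hA.2 q, hB.2 q])
  refine ⟨freeEvolution l w + B, ⟨hl, ⟨_, hw⟩, ⟨_, hA.1.add hB.1, hle⟩, ?_, ?_, ?_⟩, hle⟩
  · exact L2Bdd.add hA.1 hB.1 ⟨_, hfin, ha⟩ ⟨_, hfin, hB2⟩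
  · exact congrArg (freeEvolution l w + ·) hBeq
  · intro t ht x
    rw [abs_mul, Real.abs_exp]
    refine le_trans ?_ hδ
    exact mul_le_mul (Real.exp_le_exp.2 (mul_le_mul_of_nonneg_left ht.2.le hl.le)) (hle _)
      (abs_nonneg _) (Real.exp_nonneg _)

lemma IsMild.memSobolev_sub_kink {l b T : ℝ} {w : Strip n → ℝ} {W : ℝ × Strip n → ℝ}
    (hW : IsMild l b T w W) {t : ℝ} (ht : t ∈ Ioo 0 T) (u₀ : Strip n → ℝ) (c : ℝ) (j : ℕ) :
    MemSobolev j (evolution l b u₀ W t - kink c) := by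
  refine memSobolev_of_reg ?_
  have h1 : Reg axis BCL2 j fun x => Real.exp (l * t) * W (t, x) :=
    Reg.const_mul (fun _ _ hf => (BC.const _).mul_BCL2 hf) (hW.reg_slice j ht) _
  have h2 := Reg.add (fun _ _ => BCL2.add) h1 (Reg_kink_sub b c j)
  convert! h2 using 1
  rw [evolution_of_pos ht.1]
  ext x
  simp only [Pi.add_apply, Pi.sub_apply]
  ring

end CahnHilliard

end

/-! ### Choice of constants and conclusion -/

theorem theorem5p1 (n : ℕ) (δbar : ℝ) (hδbar : 0 < δbar) (T : ℝ) (hT : 0 < T) :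
    ∃ δ : ℝ, 0 < δ ∧
      ∀ (b : ℝ) (u₀ : CahnHilliard.Strip n → ℝ),
        MemLp u₀ ∞ volume →
        CahnHilliard.MemSobolev 1 (u₀ - CahnHilliard.kink b) →
        eLpNorm (u₀ - CahnHilliard.kink b) ∞ volume ≤ ENNReal.ofReal δ →
        ∃ u : ℝ → CahnHilliard.Strip n → ℝ,
          CahnHilliard.IsSolution T u₀ u ∧
          Tendsto (fun t => eLpNorm (u t - u₀) 2 volume) (𝓝[>] 0) (𝓝 0) ∧
          (∀ w : ℝ → CahnHilliard.Strip n → ℝ,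
            CahnHilliard.IsSolution T u₀ w → EqOn w u (Icc 0 T)) ∧
          (∀ t ∈ Icc 0 T,
            (∃ c, CahnHilliard.IsClosestKink (u t) c) ∧
            ∀ c, CahnHilliard.IsClosestKink (u t) c →
              eLpNorm (u t - CahnHilliard.kink c) ∞ volume ≤ ENNReal.ofReal δbar) ∧
          (∀ t ∈ Ioc 0 T, ∀ c, CahnHilliard.IsClosestKink (u t) c →
            ∀ j : ℕ, CahnHilliard.MemSobolev j (u t - CahnHilliard.kink c)) := by
  have hκ : 0 < Real.tanh (δbar / 2 / (2 * √2)) := by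
    rw [Real.tanh_eq_sinh_div_cosh]
    exact div_pos (Real.sinh_pos_iff.2 (by positivity)) (Real.cosh_pos _)
  -- `ε` is the uniform closeness to the initial kink kept on `[0, T]`. The last condition keeps
  -- closest kinks within `δbar / 2` in the centre parameter, and `ε ≤ δbar / 2` supplies the other
  -- half of `δbar`.
  obtain ⟨ε, hε0, hε1, hε2, hε3⟩ : ∃ ε : ℝ, 0 < ε ∧ ε ≤ 1 ∧ ε ≤ δbar / 2 ∧
      2 * ε * CahnHilliard.kinkMass n < Real.tanh (δbar / 2 / (2 * √2)) ^ 2 := by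
    have h1 : Tendsto (fun ε : ℝ => 2 * ε * CahnHilliard.kinkMass n) (𝓝[>] 0) (𝓝 0) := by
      have h : Continuous fun ε : ℝ => 2 * ε * CahnHilliard.kinkMass n := by fun_prop
      simpa using (h.tendsto 0).mono_left nhdsWithin_le_nhds
    obtain ⟨ε, h, h', h''⟩ := ((h1.eventually_lt_const (pow_pos hκ 2)).and
      (inter_mem (Ioo_mem_nhdsGT one_pos) (Ioo_mem_nhdsGT (half_pos hδbar)))).exists
    exact ⟨ε, h'.1, h'.2.le, h''.2.le, h⟩
  obtain ⟨l, hl, hl'⟩ := CahnHilliard.exists_damping n (L := 13) (by norm_num)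
  have hM := CahnHilliard.heatMass_nonneg n 0
  -- The amplification factor from datum to solution, on `(0, T + 1)` so that `T` is interior; `δ =
  -- ε / (K + 1)` also covers `K = 0`.
  set K := Real.exp (l * (T + 1)) * (2 * CahnHilliard.heatMass n 0) with hK
  have hK0 : 0 ≤ K := by positivity
  have hKδ : Real.exp (l * (T + 1)) * (2 * (CahnHilliard.heatMass n 0 * (ε / (K + 1)))) ≤ ε := by
    have h : K * (ε / (K + 1)) ≤ ε := by
      rw [mul_div_assoc', div_le_iff₀ (by positivity)]
      nlinarith
    rw [hK] at h ⊢
    linarith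
  have hδε : ε / (K + 1) ≤ ε := div_le_self hε0.le (by linarith)
  refine ⟨ε / (K + 1), by positivity, fun b u₀ _ hS hδ => ?_⟩
  have hb : ∀ᵐ x, |u₀ x - CahnHilliard.kink b x| ≤ ε / (K + 1) := by
    filter_upwards [ae_le_eLpNormEssSup (f := u₀ - CahnHilliard.kink b)] with x hx
    rw [eLpNorm_exponent_top] at hδ
    have h := hx.trans hδ
    rw [← ofReal_norm] at h
    exact (ENNReal.ofReal_le_ofReal_iff (by positivity)).1 h
  obtain ⟨w, hw, hw2, hae⟩ := CahnHilliard.exists_bddMeas_ae_eq hS.1 (by positivity) hb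
  obtain ⟨W, hW, hWle⟩ := CahnHilliard.exists_isMild (b := b) hl hl' hw hw2 (hKδ.trans hε1)
  have hsol := hW.isSolution hT (lt_add_one T) hw2 hae
  -- At `t = 0` the bound holds only almost everywhere and comes from the datum; for `t > 0` it
  -- comes from the mild solution.
  have hclose : ∀ t ∈ Icc 0 T,
      MemLp (CahnHilliard.evolution l b u₀ W t - CahnHilliard.kink b) 2 volume ∧
      ∀ᵐ x, |CahnHilliard.evolution l b u₀ W t x - CahnHilliard.kink b x| ≤ ε := by
    intro t ht
    rcases ht.1.eq_or_lt with rfl | h0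
    · rw [hsol.initial]
      exact ⟨hS.1, hb.mono fun x hx => hx.trans hδε⟩
    · refine ⟨hW.memSobolev_sub_kink ⟨h0, ht.2.trans_lt (lt_add_one T)⟩ u₀ b 0,
        Eventually.of_forall fun x => ?_⟩
      rw [CahnHilliard.evolution_of_pos h0, Pi.add_apply, add_sub_cancel_left, abs_mul,
        Real.abs_exp]
      refine le_trans (mul_le_mul (Real.exp_le_exp.2 (mul_le_mul_of_nonneg_left ?_ hl.le))
        (hWle _) (abs_nonneg _) (Real.exp_nonneg _)) hKδ
      linarith [ht.2]
  refine ⟨CahnHilliard.evolution l b u₀ W, hsol, hW.tendsto_evolution hw2 hae,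
    fun v hv => hv.eqOn hT hsol, fun t ht => ⟨CahnHilliard.exists_isClosestKink (hclose t ht).1,
      fun c hc => ?_⟩,
    fun t ht c _ j => hW.memSobolev_sub_kink ⟨ht.1, ht.2.trans_lt (lt_add_one T)⟩ u₀ c j⟩
  have hbc := hc.abs_sub_le (hclose t ht).1 (half_pos hδbar) (hclose t ht).2 hε3
  rw [eLpNorm_exponent_top]
  refine eLpNormEssSup_le_of_ae_bound ?_
  filter_upwards [(hclose t ht).2] with x hx
  have h := abs_sub_le (CahnHilliard.evolution l b u₀ W t x) (CahnHilliard.kink b x)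
    (CahnHilliard.kink c x)
  have h' := CahnHilliard.abs_kink_sub_le b c x
  rw [Real.norm_eq_abs, Pi.sub_apply]
  linarith
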